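/- Let $a,b\in\mathbb R^2$ be linearly independent, let $\Gamma=\mathbb Z a+\mathbb Z b$ be the lattice they generate, with fundamental cell $M_\Gamma=\{sa+tb : s,t\in[0,1]\}$ and dual lattice $\Gamma^*=\{\gamma^*\in\mathbb R^2 : \gamma^*\cdot\gamma\in 2\pi\mathbb Z\ \text{for all }\gamma\in\Gamma\}$, and let $\mathbb V=\mathbb R^2/\Gamma$ be the torus with its normalized Lebesgue measure. Assume $(\mathrm A_w)$: the vector potential $A_\Gamma:\mathbb R^2\to\mathbb R^2$ and the scalar potential $V_\Gamma:\mathbb R^2\to\mathbb R$ are $\Gamma$-periodic, the two components of $A_\Gamma$ are $C^1$ and bounded with bounded first derivatives, and $V_\Gamma$ is measurable with $\int_{M_\Gamma}|V_\Gamma(r)|^2\,d^2r<\infty$. For $k\in\mathbb R^2$ let $$H_{\mathrm{per}}(k)=\tfrac12\bigl[-i\nabla_\theta+k-A_\Gamma(\theta)\bigr]^2+V_\Gamma(\theta)$$ act in $L^2(\mathbb V)$, where derivatives are weak derivatives on the torus and sums, compositions and multiplication operators have their natural domains. Then: (i) For all $k\in\mathbb R^2$ the operator $H_{\mathrm{per}}(k)$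 has domain equal to the Sobolev space $H^2(\mathbb V)$, is self-adjoint on it, and is bounded below. (ii) For all $k\in\mathbb R^2$, $H_{\mathrm{per}}(k)$ has compact resolvent and its spectrum is purely discrete (every point of the spectrum is isolated in the spectrum and is an eigenvalue of finite multiplicity); its eigenvalues can be arranged in an infinite increasing sequence $E_1(k)\le E_2(k)\le E_3(k)\le\dots$ in which each is repeated according to its multiplicity, and $E_n(k)\to+\infty$ as $n\to\infty$. (iii) With the eigenvalues so arranged for each $k$, every $E_n(\cdot)$ is a continuous and $\Gamma^*$-periodic function of $k\in\mathbb R^2$. -/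

import Mathlib

/-! ### Unbounded operators on a Hilbert space -/

namespace UnboundedOperator

variable {H : Type*} [NormedAddCommGroup H] [InnerProductSpace ℂ H]

/-- The natural domain `{x ∈ dom T | T x ∈ dom S}` of the composition `S ∘ T`. -/
def compDomain (S T : H →ₗ.[ℂ] H) : Submodule ℂ H :=
  (S.domain.comap T.toFun).map T.domain.subtype

theorem mem_domain_of_mem_compDomain {S T : H →ₗ.[ℂ] H} {x : H} (hx : x ∈ compDomain S T) :
    x ∈ T.domain := by
  obtain ⟨y, -, rfl⟩ := hx
  exact y.2

theorem apply_mem_domain_of_mem_compDomain {S T : H →ₗ.[ℂ] H} {x : H} (hx : x ∈ compDomain S T) :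
    T ⟨x, mem_domain_of_mem_compDomain hx⟩ ∈ S.domain := by
  obtain ⟨y, hy, rfl⟩ := hx
  exact hy

/-- The composition `S ∘ T` of unbounded operators on its natural domain. -/
noncomputable def comp (S T : H →ₗ.[ℂ] H) : H →ₗ.[ℂ] H where
  domain := compDomain S T
  toFun :=
    { toFun := fun x => S ⟨T ⟨x, mem_domain_of_mem_compDomain x.2⟩,
        apply_mem_domain_of_mem_compDomain x.2⟩
      map_add' := fun x y => by
        rw [← S.map_add]
        congr 1
        exact Subtype.ext (T.map_add ⟨x, mem_domain_of_mem_compDomain x.2⟩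
          ⟨y, mem_domain_of_mem_compDomain y.2⟩)
      map_smul' := fun c x => by
        rw [RingHom.id_apply, ← S.map_smul]
        congr 1
        exact Subtype.ext (T.map_smul c ⟨x, mem_domain_of_mem_compDomain x.2⟩) }

/-- `T` is bounded below: `⟨x, T x⟩ ≥ c ‖x‖²` on the domain of `T`, for some real `c`. -/
def IsBoundedBelow (T : H →ₗ.[ℂ] H) : Prop :=
  ∃ c : ℝ, ∀ x : T.domain, c * ‖(x : H)‖ ^ 2 ≤ (inner ℂ (x : H) (T x)).re

/-- The bounded operator `R` is the resolvent `(T - z)⁻¹`, that is, for all `x` and `y`,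
`x ∈ dom T` and `(T - z) x = y` if and only if `x = R y`. -/
def IsResolventAt (T : H →ₗ.[ℂ] H) (z : ℂ) (R : H →L[ℂ] H) : Prop :=
  ∀ x y : H, (x, y + z • x) ∈ T.graph ↔ x = R y

/-- The resolvent set of an unbounded operator. -/
def resolventSet (T : H →ₗ.[ℂ] H) : Set ℂ := {z | ∃ R : H →L[ℂ] H, IsResolventAt T z R}

/-- The spectrum of an unbounded operator. -/
def spectrum (T : H →ₗ.[ℂ] H) : Set ℂ := (resolventSet T)ᶜ

/-- `T` has compact resolvent: its resolvent set is nonempty and `(T - z)⁻¹` is a compact operator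
for every `z` in the resolvent set. -/
def HasCompactResolvent (T : H →ₗ.[ℂ] H) : Prop :=
  (resolventSet T).Nonempty ∧
    ∀ (z : ℂ) (R : H →L[ℂ] H), IsResolventAt T z R → IsCompactOperator R

/-- The eigenspace `{x ∈ dom T | T x = z x}`. -/
def eigenspace (T : H →ₗ.[ℂ] H) (z : ℂ) : Submodule ℂ H :=
  T.graph.comap (LinearMap.id.prod (z • LinearMap.id))

/-- The spectrum of `T` is purely discrete: each of its points is an isolated point of the spectrum
and an eigenvalue of finite multiplicity. -/
def HasPurelyDiscreteSpectrum (T : H →ₗ.[ℂ] H) : Prop :=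
  ∀ z ∈ spectrum T,
    (∃ ε > 0, ∀ w ∈ spectrum T, dist w z < ε → w = z) ∧
      eigenspace T z ≠ ⊥ ∧ FiniteDimensional ℂ (eigenspace T z)

/-- The sequence `e 0 ≤ e 1 ≤ e 2 ≤ …` lists the real eigenvalues of `T` in increasing order, each
of them repeated according to its multiplicity (so a number that is not an eigenvalue does not
occur). -/
def IsEigenvalueList (T : H →ₗ.[ℂ] H) (e : ℕ → ℝ) : Prop :=
  Monotone e ∧ ∀ l : ℝ,
    Set.encard {n | e n = l} = Cardinal.toENat (Module.rank ℂ (eigenspace T (l : ℂ)))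

end UnboundedOperator

/-! ### Lattices in the plane and periodic functions -/

namespace BlochFiber

/-- The Euclidean plane. -/
abbrev Plane : Type := EuclideanSpace ℝ (Fin 2)

/-- The lattice `Γ = ℤ a + ℤ b`. -/
def lattice (a b : Plane) : Set Plane := {g | ∃ m n : ℤ, g = (m : ℝ) • a + (n : ℝ) • b}

/-- The dual lattice `Γ* = {γ* | γ* · γ ∈ 2πℤ for all γ ∈ Γ}`. -/
def dualLattice (a b : Plane) : Set Plane :=
  {g' | ∀ g ∈ lattice a b, ∃ m : ℤ, inner ℝ g' g = 2 * Real.pi * m}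

/-- The fundamental cell `M_Γ = {s a + t b | s, t ∈ [0, 1]}`. -/
def cell (a b : Plane) : Set Plane :=
  {r | ∃ s ∈ Set.Icc (0 : ℝ) 1, ∃ t ∈ Set.Icc (0 : ℝ) 1, r = s • a + t • b}

/-- `f` is `Γ`-periodic. -/
def IsPeriodic (a b : Plane) {Y : Type*} (f : Plane → Y) : Prop :=
  ∀ g ∈ lattice a b, ∀ r, f (r + g) = f r

/-- The internal potentials, weak form: `A` and `V` are `Γ`-periodic, the two components of
`A` are continuously differentiable and bounded with bounded first derivatives, and `V` is square
integrable over the fundamental cell. -/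
structure WeakAssumption (a b : Plane) (A : Plane → Plane) (V : Plane → ℝ) : Prop where
  periodic_A : IsPeriodic a b A
  periodic_V : IsPeriodic a b V
  contDiff_A : ∀ j, ContDiff ℝ 1 fun r => A r j
  bounded_A : ∀ j, ∃ C : ℝ, ∀ r, |A r j| ≤ C
  bounded_fderiv_A : ∀ j, ∃ C : ℝ, ∀ r, ‖fderiv ℝ (fun x => A x j) r‖ ≤ C
  memLp_V : MeasureTheory.MemLp V 2 (MeasureTheory.volume.restrict (cell a b))

/-! ### The torus `ℝ² / Γ` -/

/-- The normalized Lebesgue measure on the fundamental cell. This is the normalized measure of the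
torus `ℝ² / Γ`, the torus being the cell with opposite edges identified (the edges are null
sets). -/
noncomputable def torusMeasure (a b : Plane) : MeasureTheory.Measure Plane :=
  ProbabilityTheory.cond MeasureTheory.volume (cell a b)

/-- The Hilbert space `L²(ℝ² / Γ)`: a square integrable function on the torus, or equivalently a
`Γ`-periodic function, is given by its values almost everywhere on the fundamental cell. -/
abbrev TorusL2 (a b : Plane) : Type := MeasureTheory.Lp ℂ 2 (torusMeasure a b)

/-- Smooth functions on the torus `ℝ² / Γ`, that is, smooth `Γ`-periodic functions. -/
def IsTorusSmooth (a b : Plane) (f : Plane → ℂ) : Prop :=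
  ContDiff ℝ (⊤ : ℕ∞) f ∧ IsPeriodic a b f

/-- The classical partial derivative `∂_j f`. -/
noncomputable def pderiv (j : Fin 2) (f : Plane → ℂ) (x : Plane) : ℂ :=
  fderiv ℝ f x (EuclideanSpace.single j 1)

/-- `g` is the weak partial derivative `∂_j u` on the torus: `∫ u ∂_j f = - ∫ g f` for all smooth
functions `f` on the torus. -/
def IsWeakDeriv (a b : Plane) (j : Fin 2) (u g : TorusL2 a b) : Prop :=
  ∀ f : Plane → ℂ, IsTorusSmooth a b f →
    ∫ x, u x * pderiv j f x ∂torusMeasure a b = - ∫ x, g x * f x ∂torusMeasure a b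

/-- The Sobolev space `H²(ℝ² / Γ)`: all weak partial derivatives of order at most two exist in
`L²`. -/
def sobolevTwo (a b : Plane) : Set (TorusL2 a b) :=
  {u | ∀ i, ∃ g, IsWeakDeriv a b i u g ∧ ∀ j, ∃ h, IsWeakDeriv a b j g h}

/-! ### The fiber operators -/

theorem isCompact_cell (a b : Plane) : IsCompact (cell a b) := by
  have h : cell a b = (fun p : ℝ × ℝ => p.1 • a + p.2 • b) ''
      (Set.Icc (0 : ℝ) 1 ×ˢ Set.Icc (0 : ℝ) 1) := by
    ext r
    constructor
    · rintro ⟨s, hs, t, ht, rfl⟩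
      exact ⟨(s, t), ⟨hs, ht⟩, rfl⟩
    · rintro ⟨⟨s, t⟩, ⟨hs, ht⟩, rfl⟩
      exact ⟨s, hs, t, ht, rfl⟩
  rw [h]
  exact (isCompact_Icc.prod isCompact_Icc).image (by fun_prop)

theorem memLp_of_continuous (a b : Plane) {f : Plane → ℂ} (hf : Continuous f) :
    MeasureTheory.MemLp f 2 (torusMeasure a b) := by
  obtain ⟨C, hC⟩ := (isCompact_cell a b).exists_bound_of_continuousOn hf.continuousOn
  have : MeasureTheory.IsFiniteMeasure (torusMeasure a b) := by
    unfold torusMeasure; infer_instance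
  exact MeasureTheory.MemLp.of_bound hf.aestronglyMeasurable C
    (ProbabilityTheory.ae_cond_of_forall_mem (isCompact_cell a b).measurableSet hC)

theorem integrable_mul_of_continuous (a b : Plane) (u : TorusL2 a b) {f : Plane → ℂ}
    (hf : Continuous f) : MeasureTheory.Integrable (fun x => u x * f x) (torusMeasure a b) :=
  (MeasureTheory.Lp.memLp u).integrable_mul (memLp_of_continuous a b hf)

theorem IsTorusSmooth.continuous_pderiv {a b : Plane} {f : Plane → ℂ} (hf : IsTorusSmooth a b f)
    (j : Fin 2) : Continuous (pderiv j f) :=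
  (hf.1.continuous_fderiv (by simp)).clm_apply continuous_const

theorem integral_add_mul (a b : Plane) (u v : TorusL2 a b) {f : Plane → ℂ} (hf : Continuous f) :
    ∫ x, (u + v) x * f x ∂torusMeasure a b =
      ∫ x, u x * f x ∂torusMeasure a b + ∫ x, v x * f x ∂torusMeasure a b := by
  rw [← MeasureTheory.integral_add (integrable_mul_of_continuous a b u hf)
    (integrable_mul_of_continuous a b v hf)]
  refine MeasureTheory.integral_congr_ae ?_
  filter_upwards [MeasureTheory.Lp.coeFn_add u v] with x hx
  rw [hx, Pi.add_apply, add_mul]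

theorem integral_smul_mul (a b : Plane) (c : ℂ) (u : TorusL2 a b) (f : Plane → ℂ) :
    ∫ x, (c • u) x * f x ∂torusMeasure a b = c * ∫ x, u x * f x ∂torusMeasure a b := by
  rw [← MeasureTheory.integral_const_mul]
  refine MeasureTheory.integral_congr_ae ?_
  filter_upwards [MeasureTheory.Lp.coeFn_smul c u] with x hx
  rw [hx, Pi.smul_apply, smul_eq_mul, mul_assoc]

/-- The graph of the weak partial derivative `∂_j` on `L²(ℝ² / Γ)`. -/
def weakDerivGraph (a b : Plane) (j : Fin 2) : Submodule ℂ (TorusL2 a b × TorusL2 a b) where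
  carrier := {p | IsWeakDeriv a b j p.1 p.2}
  zero_mem' := fun f _ => by
    have h (f : Plane → ℂ) :
        ∫ x, (0 : TorusL2 a b) x * f x ∂torusMeasure a b = 0 := by
      simpa using integral_smul_mul a b 0 0 f
    simp only [Prod.fst_zero, Prod.snd_zero, h, neg_zero]
  add_mem' := fun {p q} hp hq f hf => by
    simp only [Prod.fst_add, Prod.snd_add]
    rw [integral_add_mul a b _ _ (hf.continuous_pderiv j),
      integral_add_mul a b _ _ hf.1.continuous, hp f hf, hq f hf, neg_add]
  smul_mem' := fun c p hp f hf => by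
    simp only [Prod.smul_fst, Prod.smul_snd]
    rw [integral_smul_mul, integral_smul_mul, hp f hf, mul_neg]

/-- The weak partial derivative `∂_j` as an unbounded operator on `L²(ℝ² / Γ)`, with domain the
functions that have a weak partial derivative in `L²`. -/
noncomputable def weakDeriv (a b : Plane) (j : Fin 2) : TorusL2 a b →ₗ.[ℂ] TorusL2 a b :=
  (weakDerivGraph a b j).toLinearPMap

/-- Coordinates with respect to the basis `a, b`. -/
noncomputable def coords (a b : Plane) (hab : LinearIndependent ℝ ![a, b]) :
    Plane ≃L[ℝ] (Fin 2 → ℝ) :=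
  (basisOfLinearIndependentOfCardEqFinrank hab (by simp)).equivFunL

theorem coords_symm_apply {a b : Plane} (hab : LinearIndependent ℝ ![a, b]) (x : Fin 2 → ℝ) :
    (coords a b hab).symm x = x 0 • a + x 1 • b := by
  change (basisOfLinearIndependentOfCardEqFinrank hab _).equivFun.symm x = _
  rw [Module.Basis.equivFun_symm_apply]
  simp

theorem coords_add_lattice {a b : Plane} (hab : LinearIndependent ℝ ![a, b]) {g : Plane}
    (hg : g ∈ lattice a b) (r : Plane) (i : Fin 2) :
    ∃ m : ℤ, coords a b hab (r + g) i = coords a b hab r i + m := by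
  obtain ⟨m, n, rfl⟩ := hg
  have h : (m : ℝ) • a + (n : ℝ) • b = (coords a b hab).symm ![(m : ℝ), (n : ℝ)] := by
    simp [coords_symm_apply]
  rw [map_add, h, ContinuousLinearEquiv.apply_symm_apply]
  fin_cases i
  · exact ⟨m, rfl⟩
  · exact ⟨n, rfl⟩

theorem torusMeasure_eq_map {a b : Plane} (hab : LinearIndependent ℝ ![a, b]) :
    torusMeasure a b = MeasureTheory.Measure.map (coords a b hab).symm
      (MeasureTheory.volume.restrict (Set.Icc (0 : Fin 2 → ℝ) 1)) := by
  set e := (coords a b hab).symm with he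
  let em : (Fin 2 → ℝ) ≃ᵐ Plane := e.toHomeomorph.toMeasurableEquiv
  have hcell : em ⁻¹' cell a b = Set.Icc (0 : Fin 2 → ℝ) 1 := by
    ext x
    constructor
    · rintro ⟨s, hs, t, ht, h⟩
      have h' : e x = e ![s, t] := by
        rw [show e x = s • a + t • b from h, he, coords_symm_apply]; simp
      obtain rfl := e.injective h'
      refine ⟨fun i => ?_, fun i => ?_⟩ <;> fin_cases i
      exacts [hs.1, ht.1, hs.2, ht.2]
    · rintro ⟨h0, h1⟩
      exact ⟨x 0, ⟨h0 0, h1 0⟩, x 1, ⟨h0 1, h1 1⟩, coords_symm_apply hab x⟩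
  have hmap : MeasureTheory.Measure.map em
      (MeasureTheory.volume.restrict (Set.Icc (0 : Fin 2 → ℝ) 1)) =
        (MeasureTheory.Measure.map em MeasureTheory.volume).restrict (cell a b) := by
    rw [MeasurableEquiv.restrict_map, hcell]
  have : (MeasureTheory.Measure.map em MeasureTheory.volume).IsAddHaarMeasure :=
    e.isAddHaarMeasure_map MeasureTheory.volume
  obtain ⟨c, hc⟩ : ∃ c : NNReal, MeasureTheory.Measure.map em MeasureTheory.volume =
      c • (MeasureTheory.volume : MeasureTheory.Measure Plane) :=
    ⟨_, MeasureTheory.Measure.isAddLeftInvariant_eq_smul _ _⟩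
  change _ = MeasureTheory.Measure.map em _
  rw [hmap, hc, MeasureTheory.Measure.restrict_smul, torusMeasure, ProbabilityTheory.cond]
  have hone : (c : ENNReal) * MeasureTheory.volume (cell a b) = 1 := by
    have h1 : MeasureTheory.Measure.map em MeasureTheory.volume (cell a b) = 1 := by
      rw [em.map_apply, hcell, Real.volume_Icc_pi]; simp
    rw [hc] at h1
    exact h1
  rw [← ENNReal.eq_inv_of_mul_eq_one_left hone]
  rfl

/-- Only the zero function is orthogonal to all smooth functions on the torus. -/
theorem eq_zero_of_integral_mul_eq_zero {a b : Plane} (hab : LinearIndependent ℝ ![a, b])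
    (g : TorusL2 a b)
    (hg : ∀ f, IsTorusSmooth a b f → ∫ x, g x * f x ∂torusMeasure a b = 0) : g = 0 := by
  let _ : MeasureTheory.MeasureSpace UnitAddCircle := ⟨AddCircle.haarAddCircle⟩
  set e := (coords a b hab).symm with he
  let em : (Fin 2 → ℝ) ≃ᵐ Plane := e.toHomeomorph.toMeasurableEquiv
  let I : Set (Fin 2 → ℝ) := {x | ∀ i, x i ∈ Set.Ioc ((0 : Fin 2 → ℝ) i) ((0 : Fin 2 → ℝ) i + 1)}
  have hI : MeasurableSet I := MeasurableSet.univ_pi' fun i => measurableSet_Ioc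
  have hIcc : I =ᵐ[MeasureTheory.volume] Set.Icc (0 : Fin 2 → ℝ) 1 := by
    have h : I = Set.univ.pi fun i => Set.Ioc ((0 : Fin 2 → ℝ) i) ((1 : Fin 2 → ℝ) i) := by
      ext x
      simp [I]
    rw [h]
    exact MeasureTheory.Measure.univ_pi_Ioc_ae_eq_Icc (μ := fun _ : Fin 2 =>
      (MeasureTheory.volume : MeasureTheory.Measure ℝ))
  have hμ : torusMeasure a b = MeasureTheory.Measure.map em (MeasureTheory.volume.restrict I) := by
    rw [torusMeasure_eq_map hab, MeasureTheory.Measure.restrict_congr_set hIcc]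
    rfl
  have hp : MeasureTheory.MeasurePreserving em (MeasureTheory.volume.restrict I)
      (torusMeasure a b) := ⟨em.measurable, hμ.symm⟩
  let q := UnitAddTorus.measurableEquivPiIoc (0 : Fin 2 → ℝ)
  have hq : MeasureTheory.MeasurePreserving (fun t => (q t : Fin 2 → ℝ)) MeasureTheory.volume
      (MeasureTheory.volume.restrict I) := by
    have h1 := UnitAddTorus.measurePreserving_equivPiIoc (0 : Fin 2 → ℝ)
    have h2 : MeasureTheory.MeasurePreserving (Subtype.val : I → Fin 2 → ℝ)
        (MeasureTheory.Measure.comap Subtype.val MeasureTheory.volume)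
        (MeasureTheory.volume.restrict I) :=
      ⟨measurable_subtype_coe, map_comap_subtype_coe hI _⟩
    exact h2.comp h1
  have hpq := hp.comp hq
  set P : UnitAddTorus (Fin 2) → Plane := em ∘ fun t => (q t : Fin 2 → ℝ) with hP
  have hG : MeasureTheory.MemLp (g ∘ P) 2 MeasureTheory.volume :=
    (MeasureTheory.Lp.memLp g).comp_measurePreserving hpq
  have hzero : hG.toLp (g ∘ P) = 0 := by
    rw [← UnitAddTorus.mFourierBasis.repr.map_eq_zero_iff]
    ext n
    rw [UnitAddTorus.mFourierBasis_repr]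
    let f : Plane → ℂ := fun y => UnitAddTorus.mFourier (-n)
      (fun i => ((coords a b hab y i : ℝ) : UnitAddCircle))
    have hf : IsTorusSmooth a b f := by
      constructor
      · have : f = fun y => ∏ i, Complex.exp (2 * Real.pi * Complex.I * ((-n) i : ℤ) *
            ((coords a b hab y i : ℝ) : ℂ) / (1 : ℝ)) := by
          ext y
          simp only [f, UnitAddTorus.mFourier, ContinuousMap.coe_mk, fourier_coe_apply]
        rw [this]
        refine contDiff_prod fun i _ => ContDiff.cexp ?_
        have : ContDiff ℝ (⊤ : ℕ∞) fun y => coords a b hab y i :=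
          (contDiff_apply ℝ ℝ i).comp (coords a b hab).contDiff
        have h2 : ContDiff ℝ (⊤ : ℕ∞) fun y => ((coords a b hab y i : ℝ) : ℂ) :=
          Complex.ofRealCLM.contDiff.comp this
        exact (contDiff_const.mul h2).div_const _
      · intro l hl r
        simp only [f]
        congr 1
        ext i
        obtain ⟨m, hm⟩ := coords_add_lattice hab hl r i
        rw [hm, AddCircle.coe_add]
        simp
    have key : ∫ t, (fun x => f x * g x) (P t) = ∫ x, f x * g x ∂torusMeasure a b := by
      have h (F : Plane → ℂ) (hF : MeasureTheory.AEStronglyMeasurable F (torusMeasure a b)) :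
          ∫ t, F (P t) = ∫ x, F x ∂torusMeasure a b := by
        rw [← hpq.map_eq] at hF ⊢
        exact (MeasureTheory.integral_map hpq.measurable.aemeasurable hF).symm
      refine h (fun x => f x * g x) ?_
      exact hf.1.continuous.aestronglyMeasurable.mul (MeasureTheory.Lp.aestronglyMeasurable g)
    have h0 : ∫ x, f x * g x ∂torusMeasure a b = 0 := by
      simpa only [mul_comm] using hg f hf
    rw [UnitAddTorus.mFourierCoeff]
    refine Eq.trans (MeasureTheory.integral_congr_ae ?_) (key.trans h0)
    filter_upwards [hG.coeFn_toLp] with t ht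
    rw [ht]
    have : (fun i => ((coords a b hab (P t) i : ℝ) : UnitAddCircle)) = t := by
      have h1 : coords a b hab (P t) = (q t : Fin 2 → ℝ) :=
        (coords a b hab).apply_symm_apply _
      rw [h1]
      exact q.symm_apply_apply t
    simp only [f, this, Function.comp_apply, smul_eq_mul]
  have hae : g ∘ P =ᵐ[MeasureTheory.volume] 0 :=
    hG.coeFn_toLp.symm.trans (hzero ▸ MeasureTheory.Lp.coeFn_zero ℂ 2 _)
  have hset : MeasurableSet {x | g x = 0} :=
    (MeasureTheory.Lp.stronglyMeasurable g).measurable (measurableSet_singleton 0)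
  refine (MeasureTheory.Lp.eq_zero_iff_ae_eq_zero).2 ?_
  have hmap : ∀ᵐ x ∂MeasureTheory.Measure.map P MeasureTheory.volume, g x = 0 :=
    (MeasureTheory.ae_map_iff hpq.measurable.aemeasurable hset).2 hae
  rw [hpq.map_eq] at hmap
  exact hmap

/-- Weak derivatives are unique: the graph of `weakDeriv` is the relation that defines it. -/
theorem weakDeriv_graph {a b : Plane} (hab : LinearIndependent ℝ ![a, b]) (j : Fin 2) :
    (weakDeriv a b j).graph = weakDerivGraph a b j := by
  refine Submodule.toLinearPMap_graph_eq _ ?_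
  rintro ⟨u, g⟩ h hu
  obtain rfl : u = 0 := hu
  refine eq_zero_of_integral_mul_eq_zero hab g fun f hf => ?_
  have h0 := integral_smul_mul a b 0 (0 : TorusL2 a b) (pderiv j f)
  rw [zero_smul, zero_mul] at h0
  exact neg_eq_zero.mp ((h f hf).symm.trans h0)

/-- Multiplication by the real function `f` as an unbounded operator on `L²(ℝ² / Γ)`, with its
natural domain `{u | f u ∈ L²}`. -/
noncomputable def mulOp (a b : Plane) (f : Plane → ℝ) : TorusL2 a b →ₗ.[ℂ] TorusL2 a b where
  domain :=
    { carrier := {u | MeasureTheory.MemLp (fun x => (f x : ℂ) * u x) 2 (torusMeasure a b)}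
      zero_mem' := by
        refine MeasureTheory.MemLp.ae_eq ?_ MeasureTheory.MemLp.zero
        filter_upwards [MeasureTheory.Lp.coeFn_zero ℂ 2 (torusMeasure a b)] with x hx
        simp only [hx, Pi.zero_apply, mul_zero]
      add_mem' := fun {u v} hu hv => by
        refine MeasureTheory.MemLp.ae_eq ?_ (hu.add hv)
        filter_upwards [MeasureTheory.Lp.coeFn_add u v] with x hx
        simp only [hx, Pi.add_apply, mul_add]
      smul_mem' := fun c u hu => by
        refine MeasureTheory.MemLp.ae_eq ?_ (hu.const_smul c)
        filter_upwards [MeasureTheory.Lp.coeFn_smul c u] with x hx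
        simp only [hx, Pi.smul_apply, smul_eq_mul, mul_left_comm] }
  toFun :=
    { toFun := fun u => MeasureTheory.MemLp.toLp (fun x => (f x : ℂ) * u.1 x) u.2
      map_add' := fun u v => by
        rw [← MeasureTheory.MemLp.toLp_add, MeasureTheory.MemLp.toLp_eq_toLp_iff]
        filter_upwards [MeasureTheory.Lp.coeFn_add u.1 v.1] with x hx
        change (f x : ℂ) * (u.1 + v.1 : TorusL2 a b) x = f x * u.1 x + f x * v.1 x
        rw [hx, Pi.add_apply, mul_add]
      map_smul' := fun c u => by
        rw [RingHom.id_apply, ← MeasureTheory.MemLp.toLp_const_smul,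
          MeasureTheory.MemLp.toLp_eq_toLp_iff]
        filter_upwards [MeasureTheory.Lp.coeFn_smul c u.1] with x hx
        change (f x : ℂ) * (c • u.1 : TorusL2 a b) x = c * (f x * u.1 x)
        rw [hx, Pi.smul_apply, smul_eq_mul, mul_left_comm] }

/-- The component `-i ∂_j + k_j - A_j` of the kinetic momentum. -/
noncomputable def kineticMomentum (a b : Plane) (A : Plane → Plane) (k : Plane) (j : Fin 2) :
    TorusL2 a b →ₗ.[ℂ] TorusL2 a b :=
  (-Complex.I) • weakDeriv a b j + mulOp a b (fun x => k j - A x j)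

/-- The fiber operator `H_per(k) = ½ (-i ∇ + k - A)² + V` with its natural domain. -/
noncomputable def fiberHamiltonian (a b : Plane) (A : Plane → Plane) (V : Plane → ℝ) (k : Plane) :
    TorusL2 a b →ₗ.[ℂ] TorusL2 a b :=
  (1 / 2 : ℂ) •
      (UnboundedOperator.comp (kineticMomentum a b A k 0) (kineticMomentum a b A k 0) +
        UnboundedOperator.comp (kineticMomentum a b A k 1) (kineticMomentum a b A k 1)) +
    mulOp a b V

end BlochFiber

/-! ### Graphs of unbounded operators -/

namespace UnboundedOperator

variable {H : Type*} [NormedAddCommGroup H] [InnerProductSpace ℂ H]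

/-! In the Fourier basis of the torus, `∂_j` is multiplication by `i ξ_j`, with `ξ` running through
the dual lattice. So `-Δ/2 + l` has an explicit diagonal inverse `R₀` (`freeResolvent`), which is
compact and has range `H²`. With `W = k - A`, the central identity is `(H(k) + l) R₀ = 1 + K`
(`exists_mem_graph_freeResolvent`), where `K` collects `-i W·∂`, `-(i/2) div W`, `W²/2` and `V`,
each composed with `R₀`. The first term is `O(l^(-1/2))`, the next two are `O(1/l)`. For `V`, which
is only square integrable, dimension two enters: `∑ (|ξ|²/2 + l)⁻²` is finite and tends to `0` as `l
→ ∞`, so `R₀` maps `L²` into `L^∞` with small norm. Hence `‖K‖ ≤ 1/2` for all large `l`, and a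
Neumann series gives the compact resolvent `R₀ (1 + K)⁻¹`.

The natural domain is `H²`: by the Leibniz rule a function in the domain of `(-i∂_j + W_j)²` has
weak derivatives `∂_j u` and `∂_j² u`, and these for `j = 0, 1` already place `u` in the range of
`R₀`. Conversely the central identity puts that range into the domain.

The spectral statements are then abstract. A symmetric operator with a real resolvent point is
self-adjoint; its compact resolvent yields an orthonormal eigenbasis; since no eigenvalue lies at or
below `-l₀`, the eigenvalues tend to `+∞` and can be sorted. A sorted list is determined by the
multiplicities (`eq_of_encard_eq`), so results for the list of an eigenbasis hold for every list.

Continuity is a min-max argument (`IsEigenbasis.le_of_norm_sub_le`): `H(k + g) - H(k) = g·p +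
|g|²/2`, with `p = -i∇ + W`, is small relative to `H(k) + l`, uniformly in `l ≥ l₀`, so that `E_n +
l₀` changes only by a factor close to `1`. Periodicity holds because for `g ∈ Γ*` the function
`exp(-i g·x)` lives on the torus and intertwines `H(k)` with `H(k + g)`. -/

theorem mem_graph_add {S T : H →ₗ.[ℂ] H} {x y : H} :
    (x, y) ∈ (S + T).graph ↔ ∃ u v, (x, u) ∈ S.graph ∧ (x, v) ∈ T.graph ∧ u + v = y := by
  constructor
  · intro h
    obtain ⟨z, rfl, rfl⟩ := (LinearPMap.mem_graph_iff _).1 h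
    exact ⟨S ⟨z, z.2.1⟩, T ⟨z, z.2.2⟩, S.mem_graph ⟨z, z.2.1⟩, T.mem_graph ⟨z, z.2.2⟩, rfl⟩
  · rintro ⟨u, v, hu, hv, rfl⟩
    obtain ⟨⟨z, hz⟩, h, rfl⟩ := (LinearPMap.mem_graph_iff _).1 hu
    obtain rfl : z = x := h
    obtain ⟨⟨w, hw⟩, h, rfl⟩ := (LinearPMap.mem_graph_iff _).1 hv
    obtain rfl : w = z := h
    exact (S + T).mem_graph ⟨w, hz, hw⟩

theorem mem_graph_smul {T : H →ₗ.[ℂ] H} {c : ℂ} {x y : H} :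
    (x, y) ∈ (c • T).graph ↔ ∃ u, (x, u) ∈ T.graph ∧ c • u = y := by
  rw [LinearPMap.smul_graph]
  constructor
  · rintro ⟨⟨u, v⟩, h, h'⟩
    obtain ⟨rfl, rfl⟩ := Prod.mk.inj h'
    exact ⟨v, h, rfl⟩
  · rintro ⟨u, h, rfl⟩
    exact ⟨(x, u), h, rfl⟩

theorem mem_graph_comp {S T : H →ₗ.[ℂ] H} {x z : H} :
    (x, z) ∈ (comp S T).graph ↔ ∃ y, (x, y) ∈ T.graph ∧ (y, z) ∈ S.graph := by
  constructor
  · intro h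
    obtain ⟨w, rfl, rfl⟩ := (LinearPMap.mem_graph_iff _).1 h
    exact ⟨_, T.mem_graph ⟨w, mem_domain_of_mem_compDomain w.2⟩,
      S.mem_graph ⟨_, apply_mem_domain_of_mem_compDomain w.2⟩⟩
  · rintro ⟨y, h, h'⟩
    obtain ⟨w, rfl, rfl⟩ := (LinearPMap.mem_graph_iff _).1 h
    obtain ⟨v, hv, rfl⟩ := (LinearPMap.mem_graph_iff _).1 h'
    have hw : (w : H) ∈ compDomain S T := ⟨w, by
      have := v.2
      rw [hv] at this
      exact this, rfl⟩
    have := (comp S T).mem_graph ⟨w, hw⟩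
    convert this using 2
    change S v = S ⟨T w, _⟩
    congr 1
    exact Subtype.ext hv

theorem mem_eigenspace {T : H →ₗ.[ℂ] H} {z : ℂ} {x : H} :
    x ∈ eigenspace T z ↔ (x, z • x) ∈ T.graph := Iff.rfl

/-! ### Symmetric operators -/

/-- The operator `T` is symmetric. -/
def IsSymmetric (T : H →ₗ.[ℂ] H) : Prop :=
  ∀ x x' y y', (x, x') ∈ T.graph → (y, y') ∈ T.graph → inner ℂ x' y = inner ℂ x y'

theorem IsSymmetric.add {S T : H →ₗ.[ℂ] H} (hS : IsSymmetric S) (hT : IsSymmetric T) :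
    IsSymmetric (S + T) := by
  intro x x' y y' hx hy
  obtain ⟨u, v, hu, hv, rfl⟩ := mem_graph_add.1 hx
  obtain ⟨u', v', hu', hv', rfl⟩ := mem_graph_add.1 hy
  rw [inner_add_left, inner_add_right, hS _ _ _ _ hu hu', hT _ _ _ _ hv hv']

theorem IsSymmetric.smul {T : H →ₗ.[ℂ] H} (hT : IsSymmetric T) {c : ℂ}
    (hc : starRingEnd ℂ c = c) : IsSymmetric (c • T) := by
  intro x x' y y' hx hy
  obtain ⟨u, hu, rfl⟩ := mem_graph_smul.1 hx
  obtain ⟨u', hu', rfl⟩ := mem_graph_smul.1 hy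
  rw [inner_smul_left, inner_smul_right, hc, hT _ _ _ _ hu hu']

theorem IsSymmetric.comp_self {T : H →ₗ.[ℂ] H} (hT : IsSymmetric T) :
    IsSymmetric (comp T T) := by
  intro x x' y y' hx hy
  obtain ⟨u, hu, hu'⟩ := mem_graph_comp.1 hx
  obtain ⟨v, hv, hv'⟩ := mem_graph_comp.1 hy
  rw [hT _ _ _ _ hu' hv, hT _ _ _ _ hu hv']

theorem IsResolventAt.apply_mem {T : H →ₗ.[ℂ] H} {z : ℂ} {R : H →L[ℂ] H}
    (h : IsResolventAt T z R) (y : H) : (R y, y + z • R y) ∈ T.graph :=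
  (h _ _).2 rfl

theorem IsResolventAt.injective {T : H →ₗ.[ℂ] H} {z : ℂ} {R : H →L[ℂ] H}
    (h : IsResolventAt T z R) : Function.Injective R := by
  rw [injective_iff_map_eq_zero]
  intro y hy
  have := h.apply_mem y
  rw [hy, smul_zero, add_zero] at this
  exact T.graph_fst_eq_zero_snd this rfl

theorem IsResolventAt.apply_eq {T : H →ₗ.[ℂ] H} {z : ℂ} {R : H →L[ℂ] H}
    (h : IsResolventAt T z R) {x x' : H} (hx : (x, x') ∈ T.graph) : R (x' - z • x) = x :=
  ((h _ _).1 (by simpa using hx)).symm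

theorem IsResolventAt.isSymmetric {T : H →ₗ.[ℂ] H} (hT : IsSymmetric T) {c : ℝ} {R : H →L[ℂ] H}
    (h : IsResolventAt T c R) : (R : H →ₗ[ℂ] H).IsSymmetric := by
  intro y y'
  have := hT _ _ _ _ (h.apply_mem y) (h.apply_mem y')
  rw [inner_add_left, inner_add_right, inner_smul_left, inner_smul_right, Complex.conj_ofReal] at this
  exact (add_right_cancel this).symm

/-- The domain contains the range of `R`. If `y` is orthogonal to it, then `0 = ⟨R (R y), y⟩ = ‖R
y‖²`, and `R` is injective. -/
theorem IsResolventAt.dense_domain [CompleteSpace H] {T : H →ₗ.[ℂ] H} (hT : IsSymmetric T) {c : ℝ}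
    {R : H →L[ℂ] H} (h : IsResolventAt T c R) : Dense (T.domain : Set H) := by
  rw [Submodule.dense_iff_topologicalClosure_eq_top, Submodule.topologicalClosure_eq_top_iff,
    Submodule.eq_bot_iff]
  intro y hy
  apply h.injective
  rw [map_zero]
  have h1 := (Submodule.mem_orthogonal _ _).1 hy (R (R y))
    (LinearPMap.mem_domain_of_mem_graph (h.apply_mem _))
  have h2 := h.isSymmetric hT (R y) y
  simp only [ContinuousLinearMap.coe_coe] at h2
  rw [h2] at h1
  exact inner_self_eq_zero.1 h1

/-- A symmetric operator with a resolvent at a real point is self-adjoint. -/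
theorem IsResolventAt.isSelfAdjoint [CompleteSpace H] {T : H →ₗ.[ℂ] H} (hT : IsSymmetric T) {c : ℝ}
    {R : H →L[ℂ] H} (h : IsResolventAt T c R) : IsSelfAdjoint T := by
  have hd := h.dense_domain hT
  rw [LinearPMap.isSelfAdjoint_def]
  refine (LinearPMap.eq_of_le_of_domain_eq (LinearPMap.IsFormalAdjoint.le_adjoint hd ?_) ?_).symm
  · exact fun x y => hT _ _ _ _ (T.mem_graph x) (T.mem_graph y)
  · refine le_antisymm
      (LinearPMap.IsFormalAdjoint.le_adjoint hd
        fun x y => hT _ _ _ _ (T.mem_graph x) (T.mem_graph y)).1 fun y hy => ?_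
    set w := T.adjoint ⟨y, hy⟩ with hw
    have hkey : ∀ x x', (x, x') ∈ T.graph → inner ℂ w x = inner ℂ y x' := by
      intro x x' hx
      obtain ⟨z, rfl, rfl⟩ := (LinearPMap.mem_graph_iff _).1 hx
      exact LinearPMap.adjoint_isFormalAdjoint hd ⟨y, hy⟩ z
    -- With `w = T* y`, testing against `v = (T - c) R v` moves `R` to the other side, so `y` lies
    -- in the range of `R`, hence in the domain of `T`.
    have : y = R (w - (c : ℂ) • y) := by
      refine ext_inner_right ℂ fun v => ?_
      have h1 := hkey _ _ (h.apply_mem v)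
      have h2 := h.isSymmetric hT (w - (c : ℂ) • y) v
      simp only [ContinuousLinearMap.coe_coe] at h2
      rw [h2, inner_sub_left, h1, inner_add_right, inner_smul_left, inner_smul_right,
        Complex.conj_ofReal]
      ring
    rw [this]
    exact LinearPMap.mem_domain_of_mem_graph (h.apply_mem _)

/-! ### Compact resolvents -/

/-- If `(T - z)⁻¹` exists, then `(T - w)⁻¹ = (T - z)⁻¹ + (w - z) (T - z)⁻¹ (T - w)⁻¹`. -/
theorem IsResolventAt.eq_add {T : H →ₗ.[ℂ] H} {z w : ℂ} {R S : H →L[ℂ] H}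
    (h : IsResolventAt T z R) (h' : IsResolventAt T w S) :
    S = R + (w - z) • R.comp S := by
  ext y
  have := h.apply_eq (h'.apply_mem y)
  rw [add_sub_assoc, ← sub_smul, map_add, map_smul] at this
  simpa using this.symm

/-- By the resolvent identity, compactness at one point spreads to every point of the resolvent set.
-/
theorem IsResolventAt.hasCompactResolvent {T : H →ₗ.[ℂ] H} {z : ℂ} {R : H →L[ℂ] H}
    (h : IsResolventAt T z R) (hR : IsCompactOperator R) : HasCompactResolvent T := by
  refine ⟨⟨z, R, h⟩, fun w S hS => ?_⟩
  rw [h.eq_add hS]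
  exact hR.add ((hR.comp_clm S).smul (w - z))

/-- Points of the spectrum of an operator with compact resolvent are eigenvalues. -/
theorem IsResolventAt.eigenspace_ne_bot [CompleteSpace H] {T : H →ₗ.[ℂ] H} {z : ℂ} {R : H →L[ℂ] H}
    (h : IsResolventAt T z R) (hR : IsCompactOperator R) {w : ℂ} (hw : w ∈ spectrum T) :
    eigenspace T w ≠ ⊥ := by
  intro hbot
  apply hw
  have hwz : w - z ≠ 0 := by
    intro h0
    rw [sub_eq_zero] at h0
    exact hw (h0 ▸ ⟨R, h⟩)
  -- Fredholm alternative for `R` at `(w - z)⁻¹`: an eigenvector of `R` there is an eigenvector of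
  -- `T` at `w`; otherwise `(T - w)⁻¹` is built from `Q = ((w - z)⁻¹ - R)⁻¹`.
  rcases hR.hasEigenvalue_or_mem_resolventSet (inv_ne_zero hwz) with hev | hres
  · exfalso
    obtain ⟨v, hv, hv0⟩ := hev.exists_hasEigenvector
    rw [Module.End.mem_eigenspace_iff] at hv
    have hv' : R v = (w - z)⁻¹ • v := hv
    have h1 := h.apply_mem v
    have h2 := T.graph.smul_mem (w - z) h1
    rw [hv', Prod.smul_mk, smul_inv_smul₀ hwz, smul_add, smul_comm (w - z) z,
      smul_inv_smul₀ hwz, ← add_smul, sub_add_cancel] at h2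
    exact hv0 ((Submodule.mem_bot ℂ).1 (hbot ▸ mem_eigenspace.2 h2))
  · rw [spectrum.mem_resolventSet_iff] at hres
    obtain ⟨U, hU⟩ := hres
    set Q : H →L[ℂ] H := (↑U⁻¹ : H →L[ℂ] H) with hQ
    have hQ1 : ∀ x, Q ((w - z)⁻¹ • x - R x) = x := by
      intro x
      have : (Q * (U : H →L[ℂ] H)) x = x := by rw [hQ, Units.inv_mul]; rfl
      rw [hU] at this
      simpa [Algebra.algebraMap_eq_smul_one] using this
    have hQ2 : ∀ x, (w - z)⁻¹ • Q x - R (Q x) = x := by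
      intro x
      have : ((U : H →L[ℂ] H) * Q) x = x := by rw [hQ, Units.mul_inv]; rfl
      rw [hU] at this
      simpa [Algebra.algebraMap_eq_smul_one] using this
    -- The equation `(T - w) x = y` means `x = R (y + (w - z) x)`, that is, `((w - z)⁻¹ - R) ((w -
    -- z) x) = R y`.
    refine ⟨(w - z)⁻¹ • Q.comp R, fun x y => ?_⟩
    have e1 : (x, y + w • x) ∈ T.graph ↔ x = R (y + (w - z) • x) := by
      rw [← h]
      simp [add_assoc, ← add_smul]
    rw [e1]
    constructor
    · intro hx
      have : Q (R y) = (w - z) • x := by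
        have h3 := hQ1 ((w - z) • x)
        rw [inv_smul_smul₀ hwz] at h3
        rw [← h3]
        congr 1
        rw [map_add] at hx
        exact eq_sub_of_add_eq hx.symm
      simp [this, inv_smul_smul₀ hwz]
    · intro hx
      have h3 : Q (R y) = (w - z) • x := by
        rw [hx]
        simp [smul_inv_smul₀ hwz]
      have h4 := hQ2 (R y)
      rw [h3, inv_smul_smul₀ hwz] at h4
      rw [map_add, ← h4, sub_add_cancel]

end UnboundedOperator

/-! ### Eigenbases -/

namespace UnboundedOperator

variable {H : Type*} [NormedAddCommGroup H] [InnerProductSpace ℂ H]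

/-- A compact symmetric injective operator has an orthonormal basis of eigenvectors. -/
theorem exists_hilbertBasis_eigenvectors [CompleteSpace H] {R : H →L[ℂ] H}
    (hR : IsCompactOperator R) (hs : (R : H →ₗ[ℂ] H).IsSymmetric) (hinj : Function.Injective R) :
    ∃ (ι : Type) (b : HilbertBasis ι ℂ H) (m : ι → ℝ), ∀ i, m i ≠ 0 ∧ R (b i) = (m i : ℂ) • b i := by
  have hfin (μ : ℂ) : FiniteDimensional ℂ (Module.End.eigenspace (R : H →ₗ[ℂ] H) μ) := by
    rcases eq_or_ne μ 0 with rfl | hμ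
    · have : Module.End.eigenspace (R : H →ₗ[ℂ] H) 0 = ⊥ := by
        rw [Module.End.eigenspace_zero, LinearMap.ker_eq_bot]
        exact hinj
      rw [this]
      infer_instance
    · exact R.finite_dimensional_eigenspace hR μ hμ
  -- The index runs over all complex `μ`; a `μ` that is not an eigenvalue contributes the empty type
  -- `Fin 0`.
  let v : (Σ μ : ℂ, Fin (Module.finrank ℂ (Module.End.eigenspace (R : H →ₗ[ℂ] H) μ))) → H :=
    fun i => (stdOrthonormalBasis ℂ (Module.End.eigenspace (R : H →ₗ[ℂ] H) i.1) i.2 : H)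
  have hv : Orthonormal ℂ v := hs.orthogonalFamily_eigenspaces.orthonormal_sigma_orthonormal
    fun μ => (stdOrthonormalBasis ℂ (Module.End.eigenspace (R : H →ₗ[ℂ] H) μ)).orthonormal
  have hspan : (Submodule.span ℂ (Set.range v))ᗮ = ⊥ := by
    rw [eq_bot_iff, ← R.orthogonalComplement_iSup_eigenspaces_eq_bot hR hs]
    refine Submodule.orthogonal_le (iSup_le fun μ x hx => ?_)
    have h := (stdOrthonormalBasis ℂ (Module.End.eigenspace (R : H →ₗ[ℂ] H) μ)).sum_repr ⟨x, hx⟩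
    have h' := congrArg Subtype.val h
    rw [← show ((⟨x, hx⟩ : Module.End.eigenspace (R : H →ₗ[ℂ] H) μ) : H) = x from rfl, ← h,
      Submodule.coe_sum]
    refine Submodule.sum_mem _ fun j _ => ?_
    rw [Submodule.coe_smul]
    exact Submodule.smul_mem _ _ (Submodule.subset_span ⟨⟨μ, j⟩, rfl⟩)
  have hev (i) : R (v i) = i.1 • v i := Module.End.mem_eigenspace_iff.1
    (stdOrthonormalBasis ℂ (Module.End.eigenspace (R : H →ₗ[ℂ] H) i.1) i.2).2
  refine ⟨_, HilbertBasis.mkOfOrthogonalEqBot hv hspan, fun i => i.1.re, fun i => ?_⟩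
  rw [HilbertBasis.coe_mkOfOrthogonalEqBot]
  have hne : v i ≠ 0 := hv.ne_zero i
  have hre : ((i.1.re : ℝ) : ℂ) = i.1 := Complex.conj_eq_iff_re.1 (hs.conj_eigenvalue_eq_self
    (Module.End.hasEigenvalue_of_hasEigenvector
      ⟨Module.End.mem_eigenspace_iff.2 (hev i), hne⟩))
  refine ⟨fun h0 => hne (hinj ?_), by rw [hre]; exact hev i⟩
  rw [hev i, ← hre, show i.1.re = 0 from h0, map_zero, Complex.ofReal_zero, zero_smul]

/-- The eigenvalues of a compact operator along an orthonormal family accumulate only at zero. -/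
theorem finite_setOf_le_eigenvalue {R : H →L[ℂ] H} (hR : IsCompactOperator R) {ι : Type*}
    {v : ι → H} (hv : Orthonormal ℂ v) {m : ι → ℝ} (hm : ∀ i, R (v i) = (m i : ℂ) • v i)
    {ε : ℝ} (hε : 0 < ε) : {i | ε ≤ |m i|}.Finite := by
  by_contra hinf
  let f := Set.Infinite.natEmbedding _ hinf
  obtain ⟨K, hK, hK'⟩ := hR.image_closedBall_subset_compact 1
  -- Infinitely many such indices would give a convergent subsequence of images, although distinct
  -- images are at distance at least `ε`: pair `R (v i) - R (v j)` with `v i`.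
  obtain ⟨y, -, ψ, hψ, hψy⟩ := hK.tendsto_subseq (x := fun n => R (v (f n)))
    (fun n => hK' ⟨v (f n), by simp [hv.1], rfl⟩)
  have hc := hψy.cauchySeq
  rw [Metric.cauchySeq_iff'] at hc
  obtain ⟨N, hN⟩ := hc ε hε
  have h1 := hN (N + 1) (Nat.le_succ N)
  set i : ι := (f (ψ (N + 1))).1 with hi
  set j : ι := (f (ψ N)).1 with hj
  have hij : i ≠ j := by
    intro h
    have := f.injective (Subtype.ext h)
    exact absurd (hψ.injective this) (Nat.succ_ne_self N)
  have h2 : ‖R (v i) - R (v j)‖ < ε := by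
    rw [← dist_eq_norm]; exact h1
  have h3 : inner ℂ (v i) (R (v i) - R (v j)) = (m i : ℂ) := by
    rw [hm, hm, inner_sub_right, inner_smul_right, inner_smul_right, hv.2 hij,
      inner_self_eq_norm_sq_to_K, hv.1]
    simp
  have h4 := norm_inner_le_norm (𝕜 := ℂ) (v i) (R (v i) - R (v j))
  rw [h3, hv.1, one_mul, Complex.norm_real] at h4
  have h5 : ε ≤ |m i| := (f (ψ (N + 1))).2
  rw [Real.norm_eq_abs] at h4
  linarith

/-- A function with finite sublevel sets on an infinite type can be sorted. -/
theorem exists_equiv_monotone {ι : Type*} [Infinite ι] {E : ι → ℝ}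
    (hE : ∀ L, {i | E i ≤ L}.Finite) : ∃ σ : ℕ ≃ ι, Monotone (E ∘ σ) := by
  classical
  have : Countable ι := by
    rw [← Set.countable_univ_iff]
    refine (Set.countable_iUnion fun n : ℕ => (hE n).countable).mono fun i _ => ?_
    obtain ⟨n, hn⟩ := exists_nat_ge (E i)
    exact Set.mem_iUnion.2 ⟨n, hn⟩
  obtain ⟨enc, henc⟩ := exists_injective_nat ι
  -- Ties of `E` are broken by an enumeration, which gives a strict total order with finite initial
  -- segments; counting predecessors then embeds `ι` in `ℕ`.
  let lt (j i : ι) : Prop := E j < E i ∨ E j = E i ∧ enc j < enc i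
  have hfin (i : ι) : {j | lt j i}.Finite :=
    (hE (E i)).subset fun j hj => hj.elim le_of_lt fun h => h.1.le
  let rk (i : ι) : ℕ := {j | lt j i}.ncard
  have hmono {i j : ι} (h : lt i j) : rk i < rk j := by
    refine Set.ncard_lt_ncard ⟨fun l hl => ?_, fun hsub => ?_⟩ (hfin j)
    · rcases hl with hl | hl <;> rcases h with h | h
      · exact Or.inl (hl.trans h)
      · exact Or.inl (hl.trans_eq h.1)
      · exact Or.inl (hl.1.trans_lt h)
      · exact Or.inr ⟨hl.1.trans h.1, hl.2.trans h.2⟩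
    · have : lt i i := hsub h
      rcases this with h' | h'
      · exact lt_irrefl _ h'
      · exact lt_irrefl _ h'.2
  have htri (i j : ι) : lt i j ∨ i = j ∨ lt j i := by
    rcases lt_trichotomy (E i) (E j) with h | h | h
    · exact Or.inl (Or.inl h)
    · rcases lt_trichotomy (enc i) (enc j) with h' | h' | h'
      · exact Or.inl (Or.inr ⟨h, h'⟩)
      · exact Or.inr (Or.inl (henc h'))
      · exact Or.inr (Or.inr (Or.inr ⟨h.symm, h'⟩))
    · exact Or.inr (Or.inr (Or.inl h))
  have hinj : Function.Injective rk := by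
    intro i j hij
    rcases htri i j with h | h | h
    · exact absurd hij (hmono h).ne
    · exact h
    · exact absurd hij (hmono h).ne'
  have hle {i j : ι} (h : rk i ≤ rk j) : E i ≤ E j := by
    rcases htri i j with h' | h' | h'
    · exact h'.elim le_of_lt fun h => h.1.le
    · rw [h']
    · exact absurd (hmono h') h.not_gt
  have : Infinite (Set.range rk) := Set.infinite_coe_iff.2 (Set.infinite_range_of_injective hinj)
  -- It is enough that the ranks form an infinite set of naturals; that set is enumerated in
  -- increasing order.
  let o := Nat.Subtype.orderIsoOfNat (Set.range rk)
  refine ⟨o.toEquiv.trans (Equiv.ofInjective rk hinj).symm, fun n n' hn => hle ?_⟩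
  have h1 (n : ℕ) : rk ((Equiv.ofInjective rk hinj).symm (o n)) = o n :=
    congrArg Subtype.val ((Equiv.ofInjective rk hinj).apply_symm_apply (o n))
  change rk ((Equiv.ofInjective rk hinj).symm (o n)) ≤ rk ((Equiv.ofInjective rk hinj).symm (o n'))
  rw [h1, h1]
  exact o.monotone hn

/-- The orthonormal basis `φ` consists of eigenvectors of `T`, with eigenvalues `e`. -/
def IsEigenbasis {ι : Type*} (T : H →ₗ.[ℂ] H) (φ : HilbertBasis ι ℂ H) (e : ι → ℝ) : Prop :=
  ∀ n, (φ n, (e n : ℂ) • φ n) ∈ T.graph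

/-- A symmetric operator with compact resolvent whose eigenvalues are bounded below has an
orthonormal basis of eigenvectors, ordered by their eigenvalues. -/
theorem IsResolventAt.exists_isEigenbasis [CompleteSpace H] (hH : ¬ FiniteDimensional ℂ H)
    {T : H →ₗ.[ℂ] H} (hT : IsSymmetric T) {c : ℝ} {R : H →L[ℂ] H} (h : IsResolventAt T c R)
    (hR : IsCompactOperator R)
    (hc : ∀ l : ℝ, l ≤ c → ∀ x, (x, (l : ℂ) • x) ∈ T.graph → x = 0) :
    ∃ (φ : HilbertBasis ℕ ℂ H) (e : ℕ → ℝ), IsEigenbasis T φ e ∧ Monotone e ∧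
      Filter.Tendsto e Filter.atTop Filter.atTop ∧ ∀ n, c < e n := by
  obtain ⟨ι, b, m, hb⟩ := exists_hilbertBasis_eigenvectors hR (h.isSymmetric hT) h.injective
  have hinf : Infinite ι := by
    by_contra hfin
    rw [not_infinite_iff_finite] at hfin
    have := Fintype.ofFinite ι
    exact hH b.toOrthonormalBasis.toBasis.finiteDimensional_of_finite
  -- An eigenvalue `m` of `(T - c)⁻¹` is the eigenvalue `m⁻¹ + c` of `T`.
  set E : ι → ℝ := fun i => (m i)⁻¹ + c with hE
  have hgr (i : ι) : (b i, (E i : ℂ) • b i) ∈ T.graph := by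
    have h1 := T.graph.smul_mem ((m i : ℂ)⁻¹) (h.apply_mem (b i))
    have h0 : (m i : ℂ) ≠ 0 := Complex.ofReal_ne_zero.2 (hb i).1
    rw [(hb i).2, Prod.smul_mk, inv_smul_smul₀ h0, smul_add, smul_comm _ (c : ℂ),
      inv_smul_smul₀ h0, ← add_smul] at h1
    simpa [hE] using h1
  have hgt (i : ι) : c < E i := by
    by_contra hle
    exact b.orthonormal.ne_zero i (hc _ (not_lt.1 hle) _ (hgr i))
  have hfin (L : ℝ) : {i | E i ≤ L}.Finite := by
    rcases le_or_gt L c with hL | hL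
    · convert Set.finite_empty (α := ι)
      refine Set.eq_empty_of_forall_notMem fun i hi => ?_
      exact absurd (hgt i) (not_lt.2 ((show E i ≤ L from hi).trans hL))
    -- Since `c < E i`, the number `m i` is positive, and `E i ≤ L` forces `m i ≥ (L - c)⁻¹`;
    -- compactness leaves finitely many such `i`.
    · refine (finite_setOf_le_eigenvalue hR b.orthonormal (fun i => (hb i).2)
        (inv_pos.2 (sub_pos.2 hL))).subset fun i hi => ?_
      have h1 : (m i)⁻¹ ≤ L - c := by
        have : (m i)⁻¹ + c ≤ L := hi
        linarith
      have h2 : 0 < (m i)⁻¹ := by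
        have : c < (m i)⁻¹ + c := hgt i
        linarith
      have h3 : (L - c)⁻¹ ≤ m i := by
        rw [inv_le_comm₀ (sub_pos.2 hL) (inv_pos.1 h2)]
        exact h1
      exact h3.trans (le_abs_self _)
  obtain ⟨σ, hσ⟩ := exists_equiv_monotone hfin
  have hφ : ∃ φ : HilbertBasis ℕ ℂ H, ⇑φ = b ∘ σ := by
    refine ⟨HilbertBasis.mk (b.orthonormal.comp σ σ.injective) ?_, HilbertBasis.coe_mk _ _⟩
    rw [Set.range_comp, σ.range_eq_univ, Set.image_univ, b.dense_span]
  obtain ⟨φ, hφ⟩ := hφ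
  refine ⟨φ, E ∘ σ, fun n => ?_, hσ, ?_, fun n => hgt _⟩
  · rw [hφ]
    exact hgr (σ n)
  · refine Filter.tendsto_atTop_atTop_of_monotone hσ fun L => ?_
    by_contra! hcon
    refine Set.infinite_univ (α := ℕ) (((hfin L).preimage σ.injective.injOn).subset fun n _ => ?_)
    exact (hcon n).le

/-! ### Spectral consequences of an orthonormal eigenbasis -/

section Eigenbasis

variable {ι : Type*} {T : H →ₗ.[ℂ] H} {φ : HilbertBasis ι ℂ H} {e : ι → ℝ}

theorem IsEigenbasis.inner_eq (h : IsEigenbasis T φ e) (hT : IsSymmetric T) {x x' : H}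
    (hx : (x, x') ∈ T.graph) (n : ι) : inner ℂ (φ n) x' = e n * inner ℂ (φ n) x := by
  have := hT _ _ _ _ (h n) hx
  rw [inner_smul_left, Complex.conj_ofReal] at this
  exact this.symm

theorem hasSum_norm_inner_sq (φ : HilbertBasis ι ℂ H) (x : H) :
    HasSum (fun n => ‖inner ℂ (φ n) x‖ ^ 2) (‖x‖ ^ 2) := by
  have := Complex.hasSum_re (φ.hasSum_inner_mul_inner x x)
  rw [show (inner ℂ x x).re = ‖x‖ ^ 2 from inner_self_eq_norm_sq (𝕜 := ℂ) x] at this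
  convert! this using 1
  ext n
  rw [← inner_conj_symm x, Complex.conj_mul']
  norm_cast

/-- Symmetry moves `T` onto the eigenvectors, so Parseval's identity diagonalizes the quadratic form
on the whole domain, without convergence of the expansion in the graph norm. -/
theorem IsEigenbasis.hasSum_inner (h : IsEigenbasis T φ e) (hT : IsSymmetric T) {x x' : H}
    (hx : (x, x') ∈ T.graph) :
    HasSum (fun n => e n * ‖inner ℂ (φ n) x‖ ^ 2) (inner ℂ x x').re := by
  have := Complex.hasSum_re (φ.hasSum_inner_mul_inner x x')
  convert! this using 1
  ext n
  rw [h.inner_eq hT hx, mul_left_comm, ← inner_conj_symm x, Complex.conj_mul', Complex.re_ofReal_mul]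
  norm_cast

theorem IsEigenbasis.isBoundedBelow (h : IsEigenbasis T φ e) (hT : IsSymmetric T) {c : ℝ}
    (hc : ∀ n, c ≤ e n) : IsBoundedBelow T := by
  refine ⟨c, fun x => ?_⟩
  refine hasSum_le (fun n => ?_) ((hasSum_norm_inner_sq φ (x : H)).mul_left c)
    (h.hasSum_inner hT (T.mem_graph x))
  exact mul_le_mul_of_nonneg_right (hc n) (by positivity)

theorem IsEigenbasis.inner_eq_zero (h : IsEigenbasis T φ e) (hT : IsSymmetric T) {z : ℂ} {x : H}
    (hx : x ∈ eigenspace T z) {n : ι} (hn : (e n : ℂ) ≠ z) : inner ℂ (φ n) x = 0 := by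
  have := h.inner_eq hT (mem_eigenspace.1 hx) n
  rw [inner_smul_right, ← sub_eq_zero, ← sub_mul, mul_eq_zero, sub_eq_zero] at this
  exact this.resolve_left hn.symm

/-- Eigenvalues are among those of an eigenbasis. -/
theorem IsEigenbasis.exists_eq (h : IsEigenbasis T φ e) (hT : IsSymmetric T) {z : ℂ}
    (hz : eigenspace T z ≠ ⊥) : ∃ n, (e n : ℂ) = z := by
  by_contra! hcon
  obtain ⟨x, hx, hx0⟩ := Submodule.exists_mem_ne_zero_of_ne_bot hz
  have := hasSum_norm_inner_sq φ x
  simp_rw [h.inner_eq_zero hT hx (hcon _)] at this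
  have h0 : ‖x‖ ^ 2 = 0 := this.unique (by simp)
  exact hx0 (by simpa using h0)

/-- An eigenvector at `z` is orthogonal to all basis vectors with other eigenvalues, so its
expansion is a finite sum. -/
theorem IsEigenbasis.eigenspace_eq_span (h : IsEigenbasis T φ e) (hT : IsSymmetric T) {z : ℂ}
    (hfin : {n | (e n : ℂ) = z}.Finite) :
    eigenspace T z = Submodule.span ℂ (φ '' {n | (e n : ℂ) = z}) := by
  apply le_antisymm
  · intro x hx
    have h1 := φ.hasSum_repr x
    have h2 : HasSum (fun n => φ.repr x n • φ n) (∑ n ∈ hfin.toFinset, φ.repr x n • φ n) := by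
      refine hasSum_sum_of_ne_finset_zero fun n hn => ?_
      rw [φ.repr_apply_apply, h.inner_eq_zero hT hx (by simpa using hn), zero_smul]
    rw [h1.unique h2]
    refine Submodule.sum_mem _ fun n hn => Submodule.smul_mem _ _ (Submodule.subset_span ⟨n, ?_, rfl⟩)
    simpa using hn
  · rw [Submodule.span_le]
    rintro _ ⟨n, hn, rfl⟩
    have := h n
    rw [show (e n : ℂ) = z from hn] at this
    exact this

theorem IsEigenbasis.finiteDimensional (h : IsEigenbasis T φ e) (hT : IsSymmetric T) {z : ℂ}
    (hfin : {n | (e n : ℂ) = z}.Finite) : FiniteDimensional ℂ (eigenspace T z) := by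
  rw [h.eigenspace_eq_span hT hfin]
  exact FiniteDimensional.span_of_finite ℂ (hfin.image _)

theorem IsEigenbasis.rank_eigenspace (h : IsEigenbasis T φ e) (hT : IsSymmetric T) {z : ℂ}
    (hfin : {n | (e n : ℂ) = z}.Finite) :
    Cardinal.toENat (Module.rank ℂ (eigenspace T z)) = {n | (e n : ℂ) = z}.encard := by
  have hli : LinearIndepOn ℂ id (φ '' {n | (e n : ℂ) = z}) :=
    (φ.orthonormal.linearIndependent.linearIndepOn _).id_image
  rw [h.eigenspace_eq_span hT hfin, rank_span_set hli,
    ← φ.orthonormal.linearIndependent.injective.injOn.encard_image]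
  rfl

end Eigenbasis

/-! ### Ordered eigenvalue lists and their comparison -/

section EigenvalueList

variable {T : H →ₗ.[ℂ] H} {φ : HilbertBasis ℕ ℂ H} {e : ℕ → ℝ}

theorem finite_setOf_norm_sub_le (he : Filter.Tendsto e Filter.atTop Filter.atTop) (z : ℂ) (r : ℝ) :
    {n | ‖(e n : ℂ) - z‖ ≤ r}.Finite := by
  obtain ⟨N, hN⟩ := Filter.eventually_atTop.1 (he.eventually_gt_atTop (r + ‖z‖))
  refine (Set.finite_lt_nat N).subset fun n hn => ?_
  by_contra hle
  have h1 := hN n (not_lt.1 hle)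
  have h2 : ‖(e n : ℂ)‖ ≤ ‖(e n : ℂ) - z‖ + ‖z‖ := by
    simpa using norm_add_le ((e n : ℂ) - z) z
  rw [Complex.norm_real] at h2
  have h3 : ‖(e n : ℂ) - z‖ ≤ r := hn
  have h4 := Real.le_norm_self (e n)
  linarith

theorem finite_setOf_eq (he : Filter.Tendsto e Filter.atTop Filter.atTop) (z : ℂ) :
    {n | (e n : ℂ) = z}.Finite :=
  (finite_setOf_norm_sub_le he z 0).subset fun n hn => by
    simp [show (e n : ℂ) = z from hn]

theorem IsEigenbasis.isEigenvalueList (h : IsEigenbasis T φ e) (hT : IsSymmetric T)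
    (hm : Monotone e) (he : Filter.Tendsto e Filter.atTop Filter.atTop) :
    IsEigenvalueList T e := by
  refine ⟨hm, fun l => ?_⟩
  rw [h.rank_eigenspace hT (finite_setOf_eq he _)]
  simp

theorem IsEigenbasis.hasPurelyDiscreteSpectrum (h : IsEigenbasis T φ e) (hT : IsSymmetric T)
    (he : Filter.Tendsto e Filter.atTop Filter.atTop)
    (hs : ∀ z ∈ spectrum T, eigenspace T z ≠ ⊥) : HasPurelyDiscreteSpectrum T := by
  refine fun z hz => ⟨?_, hs z hz, h.finiteDimensional hT (finite_setOf_eq he z)⟩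
  -- The eigenvalues within distance `1` of `z`, with `z` removed, form a finite, hence closed, set;
  -- a ball around `z` avoids it.
  have hfin : ((fun n => (e n : ℂ)) '' {n | ‖(e n : ℂ) - z‖ ≤ 1} \ {z}).Finite :=
    ((finite_setOf_norm_sub_le he z 1).image _).sdiff
  have hz' : z ∉ ((fun n => (e n : ℂ)) '' {n | ‖(e n : ℂ) - z‖ ≤ 1} \ {z}) := fun h => h.2 rfl
  obtain ⟨ε, hε, hb⟩ := Metric.isOpen_iff.1 hfin.isClosed.isOpen_compl z hz'
  refine ⟨min ε 1, by positivity, fun w hw hd => ?_⟩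
  by_contra hne
  obtain ⟨n, rfl⟩ := h.exists_eq hT (hs w hw)
  refine hb (hd.trans_le (min_le_left _ _)) ⟨⟨n, ?_, rfl⟩, hne⟩
  rw [Set.mem_ofPred_eq, ← dist_eq_norm]
  exact (hd.trans_le (min_le_right _ _)).le

/-- A monotone sequence with finite level sets is determined by the sizes of its level sets. -/
theorem eq_of_encard_eq {e e' : ℕ → ℝ} (he : Monotone e) (he' : Monotone e')
    (hfin : ∀ l, {n | e n = l}.Finite) (h : ∀ l, {n | e n = l}.encard = {n | e' n = l}.encard) :
    e = e' := by
  -- If the lists agree before `n` and `e n < e' n`, then `e'` takes the value `e n` only before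
  -- `n`, where it equals `e`, and it misses the index `n` itself. Its level set is then strictly
  -- smaller.
  have key {e e' : ℕ → ℝ} (he' : Monotone e')
      (hfin : ∀ l, {n | e n = l}.Finite)
      (h : ∀ l, {n | e n = l}.encard = {n | e' n = l}.encard) {n : ℕ}
      (ih : ∀ m < n, e m = e' m) : e' n ≤ e n := by
    by_contra! hlt
    have hss : {m | e' m = e n} ⊂ {m | e m = e n} := by
      refine ⟨fun m hm => ?_, fun hsub => hlt.ne' (hsub (show n ∈ {m | e m = e n} from rfl))⟩
      have hmn : m < n := by
        by_contra! hle
        have h1 := he' hle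
        have h2 : e' m = e n := hm
        linarith
      exact (ih m hmn).trans hm
    have hf : {m | e' m = e n}.Finite := (hfin _).subset hss.1
    exact (hf.encard_lt_encard hss).ne (h _).symm
  have hfin' (l : ℝ) : {n | e' n = l}.Finite := by
    rw [← Set.encard_ne_top_iff, ← h]
    exact Set.encard_ne_top_iff.2 (hfin l)
  funext n
  induction n using Nat.strong_induction_on with
  | _ n ih =>
    exact le_antisymm (key he hfin' (fun l => (h l).symm) fun m hm => (ih m hm).symm)
      (key he' hfin h ih)

/-- This transfers to an arbitrary eigenvalue list what is known for the list that comes with an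
eigenbasis. -/
theorem IsEigenbasis.eq_of_isEigenvalueList (h : IsEigenbasis T φ e) (hT : IsSymmetric T)
    (hm : Monotone e) (he : Filter.Tendsto e Filter.atTop Filter.atTop) {e' : ℕ → ℝ}
    (he' : IsEigenvalueList T e') : e' = e := by
  refine (eq_of_encard_eq hm he'.1 (fun l => ?_) fun l => ?_).symm
  · simpa using finite_setOf_eq he (l : ℂ)
  · rw [he'.2, (h.isEigenvalueList hT hm he).2]

/-- Comparison of the ordered eigenvalues of two operators on the same domain. -/
theorem IsEigenbasis.le_of_norm_sub_le {T' : H →ₗ.[ℂ] H} {φ' : HilbertBasis ℕ ℂ H} {e' : ℕ → ℝ}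
    (h : IsEigenbasis T φ e) (h' : IsEigenbasis T' φ' e') (hT' : IsSymmetric T')
    (hm : Monotone e) (hm' : Monotone e') {c δ : ℝ} (hδ : 0 ≤ δ) (hc : ∀ n, 0 ≤ e n + c)
    (hrel : ∀ x x', (x, x') ∈ T.graph →
      ∃ x'', (x, x'') ∈ T'.graph ∧ ‖x'' - x'‖ ≤ δ * ‖x' + (c : ℂ) • x‖) (n : ℕ) :
    e' n ≤ e n + δ * (e n + c) := by
  -- a nonzero combination of `φ 0, …, φ n` orthogonal to `φ' 0, …, φ' (n - 1)`
  let L : (Fin (n + 1) → ℂ) →ₗ[ℂ] (Fin n → ℂ) :=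
    LinearMap.pi fun j => ∑ i : Fin (n + 1), (inner ℂ (φ' j) (φ i)) • LinearMap.proj i
  obtain ⟨a, ha, ha0⟩ := Submodule.exists_mem_ne_zero_of_ne_bot
    (LinearMap.ker_ne_bot_of_finrank_lt (f := L) (by simp))
  have hL (j : Fin n) : ∑ i : Fin (n + 1), inner ℂ (φ' j) (φ i) * a i = 0 := by
    have := congrFun (LinearMap.mem_ker.1 ha) j
    simpa [L] using this
  set x : H := ∑ i : Fin (n + 1), a i • φ i with hx
  set x' : H := ∑ i : Fin (n + 1), a i • ((e i : ℂ) • φ i) with hx'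
  have hgr : (x, x') ∈ T.graph := by
    have := T.graph.sum_mem (t := Finset.univ) (f := fun i : Fin (n + 1) => a i • (φ i, (e i : ℂ) • φ i))
      fun i _ => T.graph.smul_mem _ (h i)
    simpa [hx, hx', Prod.fst_sum, Prod.snd_sum, Prod.ext_iff] using this
  obtain ⟨x'', hgr', hle⟩ := hrel x x' hgr
  have hinj : Function.Injective (fun i : Fin (n + 1) => (i : ℕ)) := Fin.val_injective
  have hon : Orthonormal ℂ fun i : Fin (n + 1) => φ i := φ.orthonormal.comp _ hinj
  have hinner (c d : Fin (n + 1) → ℂ) :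
      inner ℂ (∑ i, c i • φ i) (∑ i, d i • φ i) = ∑ i, starRingEnd ℂ (c i) * d i :=
    hon.inner_sum _ _ _
  have hnorm (c : Fin (n + 1) → ℂ) : ‖∑ i, c i • φ i‖ ^ 2 = ∑ i, ‖c i‖ ^ 2 := by
    have := congrArg Complex.re (hinner c c)
    rw [show (inner ℂ (∑ i, c i • φ i) (∑ i, c i • φ i)).re = _ from inner_self_eq_norm_sq (𝕜 := ℂ) _] at this
    simp_rw [this, Complex.conj_mul']
    norm_cast
  have hxpos : 0 < ‖x‖ := by
    rw [norm_pos_iff]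
    intro h0
    apply ha0
    have h1 := hnorm a
    rw [← hx, h0, norm_zero] at h1
    funext i
    have h2 := (Finset.sum_eq_zero_iff_of_nonneg (fun i _ => by positivity)).1
      (h1.symm.trans (by simp)) i (Finset.mem_univ i)
    simpa using h2
  have hei (i : Fin (n + 1)) : e i ≤ e n := hm (Nat.lt_succ_iff.1 i.2)
  have hTx : (inner ℂ x x').re ≤ e n * ‖x‖ ^ 2 := by
    have h1 : x' = ∑ i : Fin (n + 1), (a i * e i) • φ i := by simp_rw [hx', smul_smul]
    rw [h1, hx, hinner, hnorm, Complex.re_sum, Finset.mul_sum]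
    refine Finset.sum_le_sum fun i _ => ?_
    rw [← mul_assoc, Complex.conj_mul', mul_comm, Complex.re_ofReal_mul]
    norm_cast
    exact mul_le_mul_of_nonneg_right (hei i) (by positivity)
  -- The hypothesis `0 ≤ e i + c` is what allows `e i + c ≤ e n + c` to be squared.
  have hTc : ‖x' + (c : ℂ) • x‖ ≤ (e n + c) * ‖x‖ := by
    have h1 : x' + (c : ℂ) • x = ∑ i : Fin (n + 1), (a i * ((e i + c : ℝ) : ℂ)) • φ i := by
      rw [hx', hx, Finset.smul_sum, ← Finset.sum_add_distrib]
      refine Finset.sum_congr rfl fun i _ => ?_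
      rw [smul_smul, smul_smul, ← add_smul]
      congr 1
      push_cast
      ring
    refine le_of_sq_le_sq ?_ (mul_nonneg (hc n) (norm_nonneg _))
    rw [h1, mul_pow, hx, hnorm, hnorm, Finset.mul_sum]
    refine Finset.sum_le_sum fun i _ => ?_
    rw [norm_mul, mul_pow, mul_comm, Complex.norm_real, Real.norm_eq_abs, sq_abs]
    have h2 := hei i
    have h3 := hc i
    gcongr
  -- The lower half of min-max: the coefficients of `x` along `φ' m` vanish for `m < n`, so only
  -- eigenvalues at least `e' n` contribute.
  have hT'x : e' n * ‖x‖ ^ 2 ≤ (inner ℂ x x'').re := by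
    refine hasSum_le (fun m => ?_) ((hasSum_norm_inner_sq φ' x).mul_left (e' n))
      (h'.hasSum_inner hT' hgr')
    rcases lt_or_ge m n with hmn | hmn
    · have h0 : inner ℂ (φ' m) x = 0 := by
        have := hL ⟨m, hmn⟩
        rw [hx, inner_sum]
        simp_rw [inner_smul_right]
        simpa [mul_comm] using this
      simp [h0]
    · exact mul_le_mul_of_nonneg_right (hm' hmn) (by positivity)
  have hdiff : (inner ℂ x x'').re ≤ (inner ℂ x x').re + ‖x‖ * ‖x'' - x'‖ := by
    have h1 := (Complex.re_le_norm _).trans (norm_inner_le_norm (𝕜 := ℂ) x (x'' - x'))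
    rw [inner_sub_right, Complex.sub_re] at h1
    linarith
  have hfin : e' n * ‖x‖ ^ 2 ≤ (e n + δ * (e n + c)) * ‖x‖ ^ 2 := by
    have h1 : ‖x‖ * ‖x'' - x'‖ ≤ ‖x‖ * (δ * ((e n + c) * ‖x‖)) := by gcongr; exact hle.trans (by gcongr)
    nlinarith
  exact le_of_mul_le_mul_right hfin (by positivity)

end EigenvalueList

/-- Perturbation of a compact inverse: if `(T - z) R₀ = 1 + K` with `‖K‖ < 1`, then `T - z` has a
compact inverse. -/
theorem exists_isResolventAt_of_norm_le [CompleteSpace H] {T : H →ₗ.[ℂ] H} {z : ℂ}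
    {R₀ K : H →L[ℂ] H} (hR₀ : IsCompactOperator R₀)
    (hdom : ∀ x ∈ T.domain, x ∈ Set.range R₀)
    (hK : ∀ f, (R₀ f, f + K f + z • R₀ f) ∈ T.graph) (hlt : ‖K‖ < 1) :
    ∃ R : H →L[ℂ] H, IsResolventAt T z R ∧ IsCompactOperator R := by
  -- Neumann series: `1 + K` is invertible with inverse `Q`, and `R₀ Q` is the resolvent. That it is
  -- also a left inverse uses `hdom`: every `x` in the domain is some `R₀ f`.
  let U := Units.oneSub (-K) (by rwa [norm_neg])
  have hU : (U : H →L[ℂ] H) = 1 + K := by simp [U]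
  set Q : H →L[ℂ] H := (↑U⁻¹ : H →L[ℂ] H) with hQ
  have hQ1 : ∀ x, Q (x + K x) = x := by
    intro x
    have : (Q * (U : H →L[ℂ] H)) x = x := by rw [hQ, Units.inv_mul]; rfl
    rw [hU] at this
    simpa using this
  have hQ2 : ∀ x, Q x + K (Q x) = x := by
    intro x
    have : ((U : H →L[ℂ] H) * Q) x = x := by rw [hQ, Units.mul_inv]; rfl
    rw [hU] at this
    simpa using this
  refine ⟨R₀.comp Q, fun x y => ⟨fun hx => ?_, ?_⟩, hR₀.comp_clm Q⟩
  · obtain ⟨f, rfl⟩ := hdom x (LinearPMap.mem_domain_of_mem_graph hx)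
    have h1 := T.mem_graph_snd_inj hx (hK f) rfl
    rw [add_right_cancel h1, ContinuousLinearMap.comp_apply, hQ1]
  · rintro rfl
    have := hK (Q y)
    rwa [hQ2] at this

end UnboundedOperator

/-! ### Diagonal operators with respect to an orthonormal basis -/

namespace HilbertBasis

variable {H : Type*} [NormedAddCommGroup H] [InnerProductSpace ℂ H] {ι : Type*}

theorem ext_inner (b : HilbertBasis ι ℂ H) {x y : H} (h : ∀ i, inner ℂ (b i) x = inner ℂ (b i) y) :
    x = y := by
  apply b.repr.injective
  ext i
  rw [b.repr_apply_apply, b.repr_apply_apply, h]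

theorem norm_le_of_inner_eq_mul (b : HilbertBasis ι ℂ H) {x y : H} {m : ι → ℂ} {C : ℝ} (hC : 0 ≤ C)
    (hm : ∀ i, ‖m i‖ ≤ C) (h : ∀ i, inner ℂ (b i) y = m i * inner ℂ (b i) x) :
    ‖y‖ ≤ C * ‖x‖ := by
  refine le_of_sq_le_sq ?_ (by positivity)
  rw [mul_pow]
  refine hasSum_le (fun i => ?_) (UnboundedOperator.hasSum_norm_inner_sq b y)
    ((UnboundedOperator.hasSum_norm_inner_sq b x).mul_left (C ^ 2))
  rw [h, norm_mul, mul_pow]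
  gcongr
  exact hm i

theorem exists_inner_eq (b : HilbertBasis ι ℂ H) {c : ι → ℂ} (hc : Summable fun i => ‖c i‖ ^ 2) :
    ∃ x, ∀ i, inner ℂ (b i) x = c i := by
  have hmem : Memℓp c 2 := memℓp_gen (by simpa using hc)
  refine ⟨b.repr.symm ⟨c, hmem⟩, fun i => ?_⟩
  rw [← b.repr_apply_apply, LinearIsometryEquiv.apply_symm_apply]

theorem exists_diagonal (b : HilbertBasis ι ℂ H) {m : ι → ℂ} {C : ℝ} (hC : 0 ≤ C)
    (hm : ∀ i, ‖m i‖ ≤ C) :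
    ∃ D : H →L[ℂ] H, ∀ x i, inner ℂ (b i) (D x) = m i * inner ℂ (b i) x := by
  have h (x : H) : ∃ y, ∀ i, inner ℂ (b i) y = m i * inner ℂ (b i) x := by
    refine b.exists_inner_eq (Summable.of_nonneg_of_le (fun i => by positivity) (fun i => ?_)
      ((UnboundedOperator.hasSum_norm_inner_sq b x).summable.mul_left (C ^ 2)))
    rw [norm_mul, mul_pow]
    gcongr
    exact hm i
  choose D hD using h
  exact ⟨LinearMap.mkContinuous
    { toFun := D
      map_add' := fun x y => b.ext_inner fun i => by
        rw [hD, inner_add_right, inner_add_right, hD, hD, mul_add]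
      map_smul' := fun c x => b.ext_inner fun i => by
        rw [hD, inner_smul_right, RingHom.id_apply, inner_smul_right, hD, mul_left_comm] } C
    fun x => b.norm_le_of_inner_eq_mul hC hm (hD x), hD⟩

open Classical in
/-- The diagonal operator with entries `m`, for bounded `m`. -/
noncomputable def diagonal (b : HilbertBasis ι ℂ H) (m : ι → ℂ) : H →L[ℂ] H :=
  -- The default `0` keeps the bound on `m` out of the definition; it is not reached when `m` is
  -- bounded.
  if h : ∃ D : H →L[ℂ] H, ∀ x i, inner ℂ (b i) (D x) = m i * inner ℂ (b i) x then h.choose else 0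

theorem inner_diagonal (b : HilbertBasis ι ℂ H) {m : ι → ℂ} {C : ℝ} (hC : 0 ≤ C)
    (hm : ∀ i, ‖m i‖ ≤ C) (x : H) (i : ι) :
    inner ℂ (b i) (b.diagonal m x) = m i * inner ℂ (b i) x := by
  have h := b.exists_diagonal hC hm
  rw [diagonal, dif_pos h]
  exact h.choose_spec x i

theorem norm_diagonal_le (b : HilbertBasis ι ℂ H) {m : ι → ℂ} {C : ℝ} (hC : 0 ≤ C)
    (hm : ∀ i, ‖m i‖ ≤ C) : ‖b.diagonal m‖ ≤ C :=
  ContinuousLinearMap.opNorm_le_bound _ hC fun x =>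
    b.norm_le_of_inner_eq_mul hC hm (b.inner_diagonal hC hm x)

theorem isCompactOperator_smulRight (f : H →L[ℂ] ℂ) (v : H) :
    IsCompactOperator (f.smulRight v) :=
  (isCompactOperator_of_locallyCompactSpace_dom f).clm_comp
    (ContinuousLinearMap.toSpanSingleton ℂ v)

/-- A diagonal operator whose entries tend to zero is compact. -/
theorem isCompactOperator_diagonal [CompleteSpace H] (b : HilbertBasis ι ℂ H) {m : ι → ℂ} {C : ℝ}
    (hC : 0 ≤ C) (hm : ∀ i, ‖m i‖ ≤ C) (h0 : Filter.Tendsto m Filter.cofinite (nhds 0)) :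
    IsCompactOperator (b.diagonal m) := by
  classical
  have hcl := isClosed_setOfPred_isCompactOperator (𝕜₁ := ℂ) (𝕜₂ := ℂ) (σ₁₂ := RingHom.id ℂ)
    (M₁ := H) (M₂ := H)
  refine hcl.closure_subset (Metric.mem_closure_iff.2 fun ε hε => ?_)
  have hfin : {i | ¬ ‖m i‖ < ε / 2}.Finite := by
    have := h0.norm.eventually_lt_const (show ‖(0 : ℂ)‖ < ε / 2 by simpa using half_pos hε)
    exact this
  -- The finite-rank truncation to the entries of size at least `ε / 2`; the remainder is diagonal
  -- with norm at most `ε / 2`.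
  let D : H →L[ℂ] H := ∑ i ∈ hfin.toFinset, (innerSL ℂ (b i)).smulRight (m i • b i)
  have hD (x : H) (j : ι) : inner ℂ (b j) (D x) =
      (if j ∈ hfin.toFinset then m j else 0) * inner ℂ (b j) x := by
    have : D x = ∑ i ∈ hfin.toFinset, inner ℂ (b i) x • (m i • b i) := by
      simp [D]
    rw [this, inner_sum]
    simp_rw [inner_smul_right, orthonormal_iff_ite.1 b.orthonormal]
    simp only [mul_ite, mul_one, mul_zero, Finset.sum_ite_eq]
    split_ifs <;> ring
  refine ⟨D, ?_, ?_⟩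
  · have : D ∈ compactOperator (RingHom.id ℂ) H H :=
      Submodule.sum_mem _ fun i _ => isCompactOperator_smulRight _ _
    exact this
  · rw [dist_eq_norm]
    refine (ContinuousLinearMap.opNorm_le_bound _ (half_pos hε).le fun x =>
      b.norm_le_of_inner_eq_mul (m := fun i => if i ∈ hfin.toFinset then 0 else m i)
        (half_pos hε).le (fun i => ?_) fun i => ?_).trans_lt (half_lt_self hε)
    · split_ifs with h
      · simpa using (half_pos hε).le
      · simp only [Set.Finite.mem_toFinset, Set.mem_ofPred_eq, not_not] at h
        exact h.le
    · rw [sub_apply, inner_sub_right, b.inner_diagonal hC hm, hD, ← sub_mul]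
      split_ifs <;> simp

end HilbertBasis

/-! ### Fourier series on the torus `ℝ² / Γ` -/

namespace BlochFiber

variable {a b : Plane}

/-- The plane wave `x ↦ exp (i g · x)`. -/
noncomputable def planeWave (g : Plane) (x : Plane) : ℂ := Complex.exp (Complex.I * (inner ℝ g x : ℝ))

theorem contDiff_planeWave (g : Plane) : ContDiff ℝ (⊤ : ℕ∞) (planeWave g) := by
  refine ContDiff.cexp (contDiff_const.mul ?_)
  exact Complex.ofRealCLM.contDiff.comp (innerSL ℝ g).contDiff

theorem norm_planeWave (g x : Plane) : ‖planeWave g x‖ = 1 := by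
  rw [planeWave, mul_comm, Complex.norm_exp_ofReal_mul_I]

theorem planeWave_neg (g x : Plane) : planeWave (-g) x = starRingEnd ℂ (planeWave g x) := by
  rw [planeWave, planeWave, ← Complex.exp_conj]
  congr 1
  simp

theorem pderiv_planeWave (j : Fin 2) (g x : Plane) :
    pderiv j (planeWave g) x = Complex.I * g j * planeWave g x := by
  have h1 : HasFDerivAt (fun y : Plane => Complex.I * ((inner ℝ g y : ℝ) : ℂ))
      (Complex.I • (Complex.ofRealCLM ∘L innerSL ℝ g)) x :=
    (Complex.ofRealCLM.hasFDerivAt.comp x (innerSL ℝ g).hasFDerivAt).const_mul Complex.I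
  have h2 := h1.cexp.fderiv
  rw [pderiv, show fderiv ℝ (planeWave g) x = _ from h2]
  simp [planeWave, EuclideanSpace.inner_single_right]
  ring

theorem neg_mem_dualLattice {g : Plane} (hg : g ∈ dualLattice a b) : -g ∈ dualLattice a b := by
  intro l hl
  obtain ⟨m, hm⟩ := hg l hl
  exact ⟨-m, by rw [inner_neg_left, hm]; push_cast; ring⟩

theorem isTorusSmooth_planeWave {g : Plane} (hg : g ∈ dualLattice a b) :
    IsTorusSmooth a b (planeWave g) := by
  refine ⟨contDiff_planeWave g, fun l hl r => ?_⟩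
  obtain ⟨m, hm⟩ := hg l hl
  rw [planeWave, planeWave, inner_add_right, hm]
  push_cast
  rw [mul_add, Complex.exp_add, show Complex.I * (2 * Real.pi * m) = m * (2 * Real.pi * Complex.I) by ring,
    Complex.exp_int_mul_two_pi_mul_I, mul_one]

/-- The dual lattice vector with coordinates `n`. -/
noncomputable def freq (hab : LinearIndependent ℝ ![a, b]) (n : Fin 2 → ℤ) : Plane :=
  (InnerProductSpace.toDual ℝ Plane).symm ((2 * Real.pi) • ∑ i, (n i : ℝ) •
    ((ContinuousLinearMap.proj i : (Fin 2 → ℝ) →L[ℝ] ℝ) ∘L (coords a b hab : Plane →L[ℝ] Fin 2 → ℝ)))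

theorem inner_freq (hab : LinearIndependent ℝ ![a, b]) (n : Fin 2 → ℤ) (x : Plane) :
    inner ℝ (freq hab n) x = 2 * Real.pi * ∑ i, n i * coords a b hab x i := by
  rw [freq, InnerProductSpace.toDual_symm_apply]
  simp [mul_add]

theorem freq_mem_dualLattice (hab : LinearIndependent ℝ ![a, b]) (n : Fin 2 → ℤ) :
    freq hab n ∈ dualLattice a b := by
  intro g hg
  have h (i : Fin 2) := coords_add_lattice hab hg 0 i
  choose m hm using h
  refine ⟨∑ i, n i * m i, ?_⟩
  rw [inner_freq]
  simp only [zero_add, map_zero, Pi.zero_apply] at hm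
  simp [hm]

instance (a b : Plane) : MeasureTheory.IsFiniteMeasure (torusMeasure a b) := by
  unfold torusMeasure; infer_instance

/-- The torus `ℝ² / Γ` is parametrized by the standard torus. -/
theorem exists_measurePreserving (hab : LinearIndependent ℝ ![a, b]) :
    ∃ P : UnitAddTorus (Fin 2) → Plane,
      MeasureTheory.MeasurePreserving P (MeasureTheory.Measure.pi fun _ => AddCircle.haarAddCircle)
        (torusMeasure a b) ∧
      ∀ t i, ((coords a b hab (P t) i : ℝ) : UnitAddCircle) = t i := by
  -- The volume of the circle is fixed as the normalized Haar measure, the one in the statement.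
  let _ : MeasureTheory.MeasureSpace UnitAddCircle := ⟨AddCircle.haarAddCircle⟩
  set e := (coords a b hab).symm with he
  let em : (Fin 2 → ℝ) ≃ᵐ Plane := e.toHomeomorph.toMeasurableEquiv
  -- The half-open cube represents each point of the standard torus once and differs from the closed
  -- cube by a null set.
  let I : Set (Fin 2 → ℝ) := {x | ∀ i, x i ∈ Set.Ioc ((0 : Fin 2 → ℝ) i) ((0 : Fin 2 → ℝ) i + 1)}
  have hI : MeasurableSet I := MeasurableSet.univ_pi' fun i => measurableSet_Ioc
  have hIcc : I =ᵐ[MeasureTheory.volume] Set.Icc (0 : Fin 2 → ℝ) 1 := by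
    have h : I = Set.univ.pi fun i => Set.Ioc ((0 : Fin 2 → ℝ) i) ((1 : Fin 2 → ℝ) i) := by
      ext x
      simp [I]
    rw [h]
    exact MeasureTheory.Measure.univ_pi_Ioc_ae_eq_Icc (μ := fun _ : Fin 2 =>
      (MeasureTheory.volume : MeasureTheory.Measure ℝ))
  have hμ : torusMeasure a b = MeasureTheory.Measure.map em (MeasureTheory.volume.restrict I) := by
    rw [torusMeasure_eq_map hab, MeasureTheory.Measure.restrict_congr_set hIcc]
    rfl
  have hp : MeasureTheory.MeasurePreserving em (MeasureTheory.volume.restrict I)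
      (torusMeasure a b) := ⟨em.measurable, hμ.symm⟩
  let q := UnitAddTorus.measurableEquivPiIoc (0 : Fin 2 → ℝ)
  have hq : MeasureTheory.MeasurePreserving (fun t => (q t : Fin 2 → ℝ)) MeasureTheory.volume
      (MeasureTheory.volume.restrict I) := by
    have h1 := UnitAddTorus.measurePreserving_equivPiIoc (0 : Fin 2 → ℝ)
    have h2 : MeasureTheory.MeasurePreserving (Subtype.val : I → Fin 2 → ℝ)
        (MeasureTheory.Measure.comap Subtype.val MeasureTheory.volume)
        (MeasureTheory.volume.restrict I) :=
      ⟨measurable_subtype_coe, map_comap_subtype_coe hI _⟩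
    exact h2.comp h1
  refine ⟨em ∘ fun t => (q t : Fin 2 → ℝ), hp.comp hq, fun t i => ?_⟩
  have h1 : coords a b hab (em (q t : Fin 2 → ℝ)) = (q t : Fin 2 → ℝ) :=
    (coords a b hab).apply_symm_apply _
  rw [Function.comp_apply, h1]
  exact congrFun (q.symm_apply_apply t) i

/-- The class in `L²(ℝ² / Γ)` of a continuous function. -/
noncomputable def toTorusL2 (a b : Plane) (f : Plane → ℂ) (hf : Continuous f) : TorusL2 a b :=
  (memLp_of_continuous a b hf).toLp

theorem coeFn_toTorusL2 {f : Plane → ℂ} (hf : Continuous f) :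
    toTorusL2 a b f hf =ᵐ[torusMeasure a b] f :=
  (memLp_of_continuous a b hf).coeFn_toLp

theorem inner_toTorusL2 {f : Plane → ℂ} (hf : Continuous f) (u : TorusL2 a b) :
    inner ℂ (toTorusL2 a b f hf) u = ∫ x, u x * starRingEnd ℂ (f x) ∂torusMeasure a b := by
  rw [MeasureTheory.L2.inner_def]
  refine MeasureTheory.integral_congr_ae ?_
  filter_upwards [coeFn_toTorusL2 (a := a) (b := b) hf] with x hx
  rw [hx]
  rfl

theorem planeWave_freq_eq_mFourier (hab : LinearIndependent ℝ ![a, b]) (n : Fin 2 → ℤ) {x : Plane}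
    {t : UnitAddTorus (Fin 2)} (h : ∀ i, ((coords a b hab x i : ℝ) : UnitAddCircle) = t i) :
    planeWave (freq hab n) x = UnitAddTorus.mFourier n t := by
  have : t = fun i => ((coords a b hab x i : ℝ) : UnitAddCircle) := funext fun i => (h i).symm
  rw [this, planeWave, inner_freq]
  simp only [UnitAddTorus.mFourier, ContinuousMap.coe_mk, fourier_coe_apply]
  rw [← Complex.exp_sum, Finset.mul_sum]
  push_cast
  rw [Finset.mul_sum]
  congr 1
  refine Finset.sum_congr rfl fun i _ => ?_
  rw [div_one]
  ring

/-- Pulling back along `P` is an isometry `J` into `L²` of the standard torus that sends plane waves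
to Fourier monomials. Orthonormality is thus inherited, and completeness follows from injectivity of
`J`; surjectivity is not needed. -/
theorem exists_fourierBasis (hab : LinearIndependent ℝ ![a, b]) :
    ∃ F : HilbertBasis (Fin 2 → ℤ) ℂ (TorusL2 a b), ∀ n,
      F n = toTorusL2 a b (planeWave (freq hab n)) (contDiff_planeWave _).continuous := by
  let _ : MeasureTheory.MeasureSpace UnitAddCircle := ⟨AddCircle.haarAddCircle⟩
  obtain ⟨P, hP, hPt⟩ := exists_measurePreserving hab
  let J : TorusL2 a b →ₗᵢ[ℂ] MeasureTheory.Lp ℂ 2 (MeasureTheory.volume :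
      MeasureTheory.Measure (UnitAddTorus (Fin 2))) :=
    MeasureTheory.Lp.compMeasurePreservingₗᵢ ℂ P hP
  let v : (Fin 2 → ℤ) → TorusL2 a b := fun n =>
    toTorusL2 a b (planeWave (freq hab n)) (contDiff_planeWave _).continuous
  have hJ (n : Fin 2 → ℤ) : J (v n) = UnitAddTorus.mFourierBasis n := by
    rw [UnitAddTorus.coe_mFourierBasis]
    apply MeasureTheory.Lp.ext
    have h1 := MeasureTheory.Lp.coeFn_compMeasurePreserving (v n) hP
    have h2 := hP.quasiMeasurePreserving.ae_eq (coeFn_toTorusL2 (a := a) (b := b)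
      (contDiff_planeWave (freq hab n)).continuous)
    filter_upwards [h1, h2, UnitAddTorus.coeFn_mFourierLp 2 n] with t ht1 ht2 ht3
    rw [ht3, ← planeWave_freq_eq_mFourier hab n (hPt t)]
    exact ht1.trans ht2
  have hon : Orthonormal ℂ v := by
    rw [← J.orthonormal_comp_iff, show J ∘ v = UnitAddTorus.mFourierBasis from funext hJ]
    exact UnitAddTorus.mFourierBasis.orthonormal
  have hspan : (Submodule.span ℂ (Set.range v))ᗮ = ⊥ := by
    rw [Submodule.eq_bot_iff]
    intro g hg
    apply J.injective
    rw [map_zero]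
    refine UnitAddTorus.mFourierBasis.ext_inner fun n => ?_
    rw [← hJ, J.inner_map_map, inner_zero_right]
    exact (Submodule.mem_orthogonal _ _).1 hg _ (Submodule.subset_span ⟨n, rfl⟩)
  exact ⟨HilbertBasis.mkOfOrthogonalEqBot hon hspan, fun n => by
    rw [HilbertBasis.coe_mkOfOrthogonalEqBot]⟩

/-- The Fourier basis of `L²(ℝ² / Γ)`. -/
noncomputable def fourierBasis (hab : LinearIndependent ℝ ![a, b]) :
    HilbertBasis (Fin 2 → ℤ) ℂ (TorusL2 a b) :=
  (exists_fourierBasis hab).choose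

theorem fourierBasis_apply (hab : LinearIndependent ℝ ![a, b]) (n : Fin 2 → ℤ) :
    fourierBasis hab n = toTorusL2 a b (planeWave (freq hab n)) (contDiff_planeWave _).continuous :=
  (exists_fourierBasis hab).choose_spec n

theorem inner_fourierBasis (hab : LinearIndependent ℝ ![a, b]) (n : Fin 2 → ℤ) (u : TorusL2 a b) :
    inner ℂ (fourierBasis hab n) u =
      ∫ x, u x * planeWave (-freq hab n) x ∂torusMeasure a b := by
  rw [fourierBasis_apply, inner_toTorusL2]
  simp_rw [planeWave_neg]

/-- This is what makes the sequence of eigenvalues infinite. -/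
theorem not_finiteDimensional_torusL2 (hab : LinearIndependent ℝ ![a, b]) :
    ¬ FiniteDimensional ℂ (TorusL2 a b) := by
  intro h
  have := (fourierBasis hab).orthonormal.linearIndependent.finite
  exact not_finite (Fin 2 → ℤ)

/-! ### Integration by parts -/

theorem pderiv_mul {f g : Plane → ℂ} (hf : ContDiff ℝ 1 f) (hg : ContDiff ℝ 1 g) (j : Fin 2)
    (x : Plane) : pderiv j (fun y => f y * g y) x = f x * pderiv j g x + pderiv j f x * g x := by
  have h := fderiv_fun_mul (hf.differentiable one_ne_zero x) (hg.differentiable one_ne_zero x)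
  rw [pderiv, h]
  simp [pderiv, mul_comm]

theorem continuous_pderiv {f : Plane → ℂ} (hf : ContDiff ℝ 1 f) (j : Fin 2) :
    Continuous (pderiv j f) :=
  (hf.continuous_fderiv one_ne_zero).clm_apply continuous_const

theorem contDiff_conj {f : Plane → ℂ} {n : WithTop ℕ∞} (hf : ContDiff ℝ n f) :
    ContDiff ℝ n fun y => starRingEnd ℂ (f y) :=
  Complex.conjCLE.contDiff.comp hf

/-- The integral of a partial derivative of a periodic function vanishes. -/
theorem integral_pderiv_eq_zero (hab : LinearIndependent ℝ ![a, b]) {h : Plane → ℂ}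
    (hh : ContDiff ℝ 1 h) (hp : IsPeriodic a b h) (j : Fin 2) :
    ∫ x, pderiv j h x ∂torusMeasure a b = 0 := by
  set e := (coords a b hab).symm with he
  let em : (Fin 2 → ℝ) ≃ᵐ Plane := e.toHomeomorph.toMeasurableEquiv
  have h1 : ∫ x, pderiv j h x ∂torusMeasure a b =
      ∫ x in Set.Icc (0 : Fin 2 → ℝ) 1, pderiv j h (e x) := by
    rw [torusMeasure_eq_map hab]
    exact MeasureTheory.integral_map_equiv em (pderiv j h)
  let v : Fin 2 → ℝ := coords a b hab (EuclideanSpace.single j 1)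
  -- In lattice coordinates `∂_j` is the constant-coefficient operator `∑ v i ∂/∂x_i`, so the
  -- integrand is the divergence of `G` on the unit square.
  let G : Fin 2 → (Fin 2 → ℝ) → ℂ := fun i x => (v i : ℂ) * h (e x)
  have hG (i : Fin 2) (x : Fin 2 → ℝ) : HasFDerivAt (G i)
      ((v i : ℂ) • (fderiv ℝ h (e x) ∘L (e : (Fin 2 → ℝ) →L[ℝ] Plane))) x :=
    ((hh.differentiable one_ne_zero (e x)).hasFDerivAt.comp x
      e.toContinuousLinearMap.hasFDerivAt).const_mul _
  have hsum (x : Fin 2 → ℝ) : pderiv j h (e x) = ∑ i, ((v i : ℂ) • (fderiv ℝ h (e x) ∘L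
      (e : (Fin 2 → ℝ) →L[ℝ] Plane))) (Pi.single i 1) := by
    have hv : EuclideanSpace.single j (1 : ℝ) = ∑ i, v i • e (Pi.single i 1) := by
      have : v = ∑ i, v i • (Pi.single i 1 : Fin 2 → ℝ) := by
        ext k; simp [Finset.sum_apply, Pi.single_apply]
      calc EuclideanSpace.single j (1 : ℝ) = e v := ((coords a b hab).symm_apply_apply _).symm
        _ = _ := by conv_lhs => rw [this, map_sum]
                    simp only [map_smul]
    rw [pderiv, hv, map_sum]
    simp
  have hcont : Continuous fun x => pderiv j h (e x) := (continuous_pderiv hh j).comp e.continuous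
  rw [h1]
  simp_rw [hsum]
  rw [MeasureTheory.integral_divergence_of_hasFDerivAt_off_countable' (0 : Fin 2 → ℝ) 1
    (fun i => zero_le_one) G (fun i x => (v i : ℂ) • (fderiv ℝ h (e x) ∘L
      (e : (Fin 2 → ℝ) →L[ℝ] Plane))) ∅ Set.countable_empty
    (fun i => (continuous_const.mul (hh.continuous.comp e.continuous)).continuousOn)
    (fun x _ i => hG i x) (by
      simp_rw [← hsum]
      exact hcont.continuousOn.integrableOn_Icc)]
  refine Finset.sum_eq_zero fun i _ => sub_eq_zero.2 ?_
  congr 1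
  ext y
  simp only [G]
  congr 1
  -- Opposite faces differ by the lattice vector `a` or `b`, so the boundary terms cancel by
  -- periodicity.
  have hl : ∃ l ∈ lattice a b, e (i.insertNth ((1 : Fin 2 → ℝ) i) y) =
      e (i.insertNth ((0 : Fin 2 → ℝ) i) y) + l := by
    fin_cases i
    · refine ⟨a, ⟨1, 0, by simp⟩, ?_⟩
      simp [he, coords_symm_apply]
      abel
    · refine ⟨b, ⟨0, 1, by simp⟩, ?_⟩
      have h0 (c : ℝ) : (Fin.insertNth (1 : Fin 2) c y : Fin 2 → ℝ) = ![y 0, c] := by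
        ext k
        fin_cases k
        · rfl
        · rfl
      simp [he, coords_symm_apply, h0]
  obtain ⟨l, hl, hl'⟩ := hl
  rw [hl', hp l hl]

end BlochFiber

namespace BlochFiber

variable {a b : Plane}

/-! ### Weak derivatives and Fourier coefficients -/

theorem integral_pderiv_mul (hab : LinearIndependent ℝ ![a, b]) {f g : Plane → ℂ}
    (hf : ContDiff ℝ 1 f) (hg : ContDiff ℝ 1 g) (hfp : IsPeriodic a b f) (hgp : IsPeriodic a b g)
    (j : Fin 2) :
    ∫ x, pderiv j f x * g x ∂torusMeasure a b = - ∫ x, f x * pderiv j g x ∂torusMeasure a b := by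
  have h := integral_pderiv_eq_zero hab (hf.mul hg)
    (fun l hl r => by simp only [hfp l hl r, hgp l hl r]) j
  have hint {u : Plane → ℂ} (hu : Continuous u) : MeasureTheory.Integrable u (torusMeasure a b) :=
    (memLp_of_continuous a b hu).integrable (by norm_num)
  simp_rw [pderiv_mul hf hg j] at h
  rw [MeasureTheory.integral_add (f := fun x => f x * pderiv j g x)
    (g := fun x => pderiv j f x * g x) (hint (hf.continuous.mul (continuous_pderiv hg j)))
    (hint ((continuous_pderiv hf j).mul hg.continuous))] at h
  exact eq_neg_of_add_eq_zero_right h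

/-- Weak derivatives act on Fourier coefficients as multiplication by `i ξ`. -/
theorem IsWeakDeriv.inner_fourierBasis (hab : LinearIndependent ℝ ![a, b]) {j : Fin 2}
    {u g : TorusL2 a b} (h : IsWeakDeriv a b j u g) (n : Fin 2 → ℤ) :
    inner ℂ (fourierBasis hab n) g =
      Complex.I * freq hab n j * inner ℂ (fourierBasis hab n) u := by
  have h1 := h _ (isTorusSmooth_planeWave (neg_mem_dualLattice (freq_mem_dualLattice hab n)))
  rw [BlochFiber.inner_fourierBasis, BlochFiber.inner_fourierBasis, eq_comm, ← neg_eq_iff_eq_neg.2 h1,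
    ← MeasureTheory.integral_const_mul, ← MeasureTheory.integral_neg]
  refine MeasureTheory.integral_congr_ae (Filter.Eventually.of_forall fun x => ?_)
  simp only [pderiv_planeWave, PiLp.neg_apply]
  push_cast
  ring

/-- If the Fourier coefficients of `g` are those of a derivative of `u`, then integration by parts
holds for all continuously differentiable test functions. -/
theorem integral_mul_pderiv_of_inner_fourierBasis (hab : LinearIndependent ℝ ![a, b]) {j : Fin 2}
    {u g : TorusL2 a b} (h : ∀ n, inner ℂ (fourierBasis hab n) g =
      Complex.I * freq hab n j * inner ℂ (fourierBasis hab n) u) {f : Plane → ℂ}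
    (hf : ContDiff ℝ 1 f) (hfp : IsPeriodic a b f) :
    ∫ x, u x * pderiv j f x ∂torusMeasure a b = - ∫ x, g x * f x ∂torusMeasure a b := by
  have hf' : ContDiff ℝ 1 fun y => starRingEnd ℂ (f y) := contDiff_conj hf
  have hint {F : Plane → ℂ} (hF : Continuous F) (w : TorusL2 a b) :
      ∫ x, w x * F x ∂torusMeasure a b =
        inner ℂ (toTorusL2 a b _ (Complex.continuous_conj.comp hF)) w := by
    rw [inner_toTorusL2]
    simp
  have hcoeff (n : Fin 2 → ℤ) :
      inner ℂ (toTorusL2 a b _ (Complex.continuous_conj.comp (continuous_pderiv hf j)))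
        (fourierBasis hab n) = - (Complex.I * freq hab n j *
      inner ℂ (toTorusL2 a b _ (Complex.continuous_conj.comp hf.continuous))
        (fourierBasis hab n)) := by
    rw [← hint (continuous_pderiv hf j), ← hint hf.continuous]
    have hsm := isTorusSmooth_planeWave (freq_mem_dualLattice hab n)
    have h1 := integral_pderiv_mul hab hf (hsm.1.of_le (by simp)) hfp hsm.2 j
    have h2 {F : Plane → ℂ} : ∫ x, (fourierBasis hab n) x * F x ∂torusMeasure a b =
        ∫ x, planeWave (freq hab n) x * F x ∂torusMeasure a b := by
      refine MeasureTheory.integral_congr_ae ?_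
      rw [fourierBasis_apply]
      filter_upwards [coeFn_toTorusL2 (a := a) (b := b)
        (contDiff_planeWave (freq hab n)).continuous] with x hx
      rw [hx]
    rw [h2, h2]
    simp_rw [mul_comm (planeWave _ _)]
    rw [h1, ← MeasureTheory.integral_const_mul]
    congr 1
    refine MeasureTheory.integral_congr_ae (Filter.Eventually.of_forall fun x => ?_)
    simp only [pderiv_planeWave]
    ring
  rw [hint (continuous_pderiv hf j), hint hf.continuous]
  -- Both integrals are expanded by Parseval. The series agree term by term, because for plane waves
  -- integration by parts is classical (`hcoeff`).
  have h1 := (fourierBasis hab).hasSum_inner_mul_inner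
    (toTorusL2 a b _ (Complex.continuous_conj.comp (continuous_pderiv hf j))) u
  have h2 := ((fourierBasis hab).hasSum_inner_mul_inner
    (toTorusL2 a b _ (Complex.continuous_conj.comp hf.continuous)) g).neg
  refine h1.unique (h2.congr_fun fun n => ?_)
  rw [hcoeff, h]
  ring

/-- Weak differentiation becomes a Fourier multiplier. Plane waves are test functions, which gives
one direction; Parseval gives the other. -/
theorem isWeakDeriv_iff (hab : LinearIndependent ℝ ![a, b]) {j : Fin 2} {u g : TorusL2 a b} :
    IsWeakDeriv a b j u g ↔ ∀ n, inner ℂ (fourierBasis hab n) g =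
      Complex.I * freq hab n j * inner ℂ (fourierBasis hab n) u :=
  ⟨fun h => h.inner_fourierBasis hab, fun h _ hf =>
    integral_mul_pderiv_of_inner_fourierBasis hab h (hf.1.of_le (by simp)) hf.2⟩

/-- The multiplier `i ξ_j` is purely imaginary, so `∂_j` is skew-symmetric on its full weak domain.
-/
theorem IsWeakDeriv.inner_left (hab : LinearIndependent ℝ ![a, b]) {j : Fin 2}
    {u g v h : TorusL2 a b} (hu : IsWeakDeriv a b j u g) (hv : IsWeakDeriv a b j v h) :
    inner ℂ g v = - inner ℂ u h := by
  have h1 := (fourierBasis hab).hasSum_inner_mul_inner g v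
  have h2 := ((fourierBasis hab).hasSum_inner_mul_inner u h).neg
  refine h1.unique (h2.congr_fun fun n => ?_)
  rw [hv.inner_fourierBasis hab, ← inner_conj_symm g, ← inner_conj_symm u,
    hu.inner_fourierBasis hab]
  simp
  ring

theorem mem_graph_weakDeriv (hab : LinearIndependent ℝ ![a, b]) {j : Fin 2} {u g : TorusL2 a b} :
    (u, g) ∈ (weakDeriv a b j).graph ↔ IsWeakDeriv a b j u g := by
  rw [weakDeriv_graph hab]
  rfl

/-! ### Multiplication operators -/

theorem memLp_mul_of_continuous {φ : Plane → ℂ} (hφ : Continuous φ) (u : TorusL2 a b) :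
    MeasureTheory.MemLp (fun x => φ x * u x) 2 (torusMeasure a b) := by
  obtain ⟨C, hC⟩ := (isCompact_cell a b).exists_bound_of_continuousOn hφ.continuousOn
  refine (MeasureTheory.Lp.memLp u).of_le_mul (c := C)
    (hφ.aestronglyMeasurable.mul (MeasureTheory.Lp.aestronglyMeasurable u)) ?_
  refine ProbabilityTheory.ae_cond_of_forall_mem (isCompact_cell a b).measurableSet fun x hx => ?_
  rw [norm_mul]
  exact mul_le_mul_of_nonneg_right (hC x hx) (norm_nonneg _)

theorem norm_le_of_ae_norm_le {u v : TorusL2 a b} {C : ℝ}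
    (h : ∀ᵐ x ∂torusMeasure a b, ‖v x‖ ≤ C * ‖u x‖) : ‖v‖ ≤ C * ‖u‖ :=
  MeasureTheory.Lp.norm_le_mul_norm_of_ae_le_mul h

/-- Multiplication by a continuous function. -/
noncomputable def mulContinuous (a b : Plane) {φ : Plane → ℂ} (hφ : Continuous φ) :
    TorusL2 a b →L[ℂ] TorusL2 a b :=
  LinearMap.mkContinuousOfExistsBound
    { toFun := fun u => (memLp_mul_of_continuous hφ u).toLp
      map_add' := fun u v => by
        rw [← MeasureTheory.MemLp.toLp_add, MeasureTheory.MemLp.toLp_eq_toLp_iff]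
        filter_upwards [MeasureTheory.Lp.coeFn_add u v] with x hx
        simp only [hx, Pi.add_apply, mul_add]
      map_smul' := fun c u => by
        rw [RingHom.id_apply, ← MeasureTheory.MemLp.toLp_const_smul,
          MeasureTheory.MemLp.toLp_eq_toLp_iff]
        filter_upwards [MeasureTheory.Lp.coeFn_smul c u] with x hx
        simp only [hx, Pi.smul_apply, smul_eq_mul, mul_left_comm] }
    (by
      obtain ⟨C, hC⟩ := (isCompact_cell a b).exists_bound_of_continuousOn hφ.continuousOn
      refine ⟨C ⊔ 0, fun u => norm_le_of_ae_norm_le ?_⟩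
      filter_upwards [(memLp_mul_of_continuous hφ u).coeFn_toLp,
        ProbabilityTheory.ae_cond_of_forall_mem (isCompact_cell a b).measurableSet hC] with x hx hx'
      change ‖(memLp_mul_of_continuous hφ u).toLp _ x‖ ≤ _
      rw [hx, norm_mul]
      exact mul_le_mul_of_nonneg_right (hx'.trans le_sup_left) (norm_nonneg _))

theorem coeFn_mulContinuous {φ : Plane → ℂ} (hφ : Continuous φ) (u : TorusL2 a b) :
    mulContinuous a b hφ u =ᵐ[torusMeasure a b] fun x => φ x * u x :=
  (memLp_mul_of_continuous hφ u).coeFn_toLp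

/-- The Leibniz rule for the product with a continuously differentiable periodic function. -/
theorem IsWeakDeriv.mulContinuous (hab : LinearIndependent ℝ ![a, b]) {j : Fin 2}
    {u g : TorusL2 a b} (h : IsWeakDeriv a b j u g) {φ : Plane → ℂ} (hφ : ContDiff ℝ 1 φ)
    (hp : IsPeriodic a b φ) :
    IsWeakDeriv a b j (mulContinuous a b hφ.continuous u)
      (BlochFiber.mulContinuous a b hφ.continuous g +
        BlochFiber.mulContinuous a b (continuous_pderiv hφ j) u) := by
  intro f hf
  have hf1 : ContDiff ℝ 1 f := hf.1.of_le (by simp)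
  have hmul {ψ : Plane → ℂ} (hψ : Continuous ψ) (w : TorusL2 a b) (F : Plane → ℂ) :
      ∫ x, BlochFiber.mulContinuous a b hψ w x * F x ∂torusMeasure a b =
        ∫ x, w x * (ψ x * F x) ∂torusMeasure a b := by
    refine MeasureTheory.integral_congr_ae ?_
    filter_upwards [coeFn_mulContinuous hψ w] with x hx
    rw [hx]
    ring
  -- The product `φ f` is only continuously differentiable, hence no test function in the
  -- definition; the extended integration by parts covers it.
  have h1 := integral_mul_pderiv_of_inner_fourierBasis hab (h.inner_fourierBasis hab)
    (hφ.mul hf1) (fun l hl r => by simp only [hp l hl r, hf.2 l hl r])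
  rw [integral_add_mul a b _ _ hf1.continuous, hmul, hmul, hmul, neg_add]
  simp_rw [pderiv_mul hφ hf1, mul_add] at h1
  rw [MeasureTheory.integral_add (f := fun x => u x * (φ x * pderiv j f x))
    (g := fun x => u x * (pderiv j φ x * f x))
    (integrable_mul_of_continuous a b u (hφ.continuous.mul (continuous_pderiv hf1 j)))
    (integrable_mul_of_continuous a b u ((continuous_pderiv hφ j).mul hf1.continuous))] at h1
  linear_combination h1

theorem mem_graph_mulOp {f : Plane → ℝ} {u v : TorusL2 a b} :
    (u, v) ∈ (mulOp a b f).graph ↔ v =ᵐ[torusMeasure a b] fun x => (f x : ℂ) * u x := by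
  constructor
  · intro h
    obtain ⟨w, rfl, rfl⟩ := (LinearPMap.mem_graph_iff _).1 h
    exact MeasureTheory.MemLp.coeFn_toLp w.2
  · intro h
    have hu : MeasureTheory.MemLp (fun x => (f x : ℂ) * u x) 2 (torusMeasure a b) :=
      (MeasureTheory.memLp_congr_ae h).1 (MeasureTheory.Lp.memLp v)
    have h1 := (mulOp a b f).mem_graph ⟨u, hu⟩
    convert h1 using 2
    apply MeasureTheory.Lp.ext
    exact h.trans hu.coeFn_toLp.symm

theorem isSymmetric_mulOp (f : Plane → ℝ) : UnboundedOperator.IsSymmetric (mulOp a b f) := by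
  intro u u' v v' hu hv
  rw [mem_graph_mulOp] at hu hv
  rw [MeasureTheory.L2.inner_def, MeasureTheory.L2.inner_def]
  refine MeasureTheory.integral_congr_ae ?_
  filter_upwards [hu, hv] with x hx hx'
  rw [hx, hx']
  simp only [RCLike.inner_apply, map_mul]
  rw [show (starRingEnd ℂ) (f x : ℂ) = f x from Complex.conj_ofReal _]
  ring

/-- A function with absolutely summable Fourier coefficients is bounded. -/
theorem ae_norm_le_of_hasSum (hab : LinearIndependent ℝ ![a, b]) {u : TorusL2 a b} {S : ℝ}
    (h : HasSum (fun n => ‖inner ℂ (fourierBasis hab n) u‖) S) :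
    ∀ᵐ x ∂torusMeasure a b, ‖u x‖ ≤ S := by
  have h1 := (fourierBasis hab).hasSum_repr u
  have hF (n : Fin 2 → ℤ) : ∀ᵐ x ∂torusMeasure a b, ((fourierBasis hab).repr u n •
      fourierBasis hab n : TorusL2 a b) x =
        inner ℂ (fourierBasis hab n) u * planeWave (freq hab n) x := by
    filter_upwards [MeasureTheory.Lp.coeFn_smul ((fourierBasis hab).repr u n)
      (fourierBasis hab n), coeFn_toTorusL2 (a := a) (b := b)
      (contDiff_planeWave (freq hab n)).continuous] with x hx hx'
    rw [hx, Pi.smul_apply, smul_eq_mul, fourierBasis_apply, hx', HilbertBasis.repr_apply_apply,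
      fourierBasis_apply]
  -- Absolute summability of the norms makes the Fourier series converge almost everywhere to its
  -- `L²` sum, so it can be bounded pointwise.
  have h2 := MeasureTheory.Lp.hasSum_coeFn_tsum (p := 2)
    (f := fun n => (fourierBasis hab).repr u n • fourierBasis hab n) (μ := torusMeasure a b) (by
      simp_rw [← ofReal_norm, norm_smul, (fourierBasis hab).orthonormal.1, mul_one,
        HilbertBasis.repr_apply_apply]
      exact h.summable.tsum_ofReal_ne_top)
  rw [h1.tsum_eq] at h2
  filter_upwards [h2, MeasureTheory.ae_all_iff.2 hF] with x hx hFx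
  rw [← hx.tsum_eq]
  refine tsum_of_norm_bounded h fun n => ?_
  rw [hFx, norm_mul, norm_planeWave, mul_one]

end BlochFiber

namespace BlochFiber

variable {a b : Plane}

/-! ### The free resolvent -/

/-- The symbol `|ξ|² / 2` of the free Hamiltonian. -/
noncomputable def kineticSymbol (hab : LinearIndependent ℝ ![a, b]) (n : Fin 2 → ℤ) : ℝ :=
  ‖freq hab n‖ ^ 2 / 2

theorem kineticSymbol_nonneg (hab : LinearIndependent ℝ ![a, b]) (n : Fin 2 → ℤ) :
    0 ≤ kineticSymbol hab n := by
  unfold kineticSymbol; positivity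

theorem kineticSymbol_eq_sum (hab : LinearIndependent ℝ ![a, b]) (n : Fin 2 → ℤ) :
    kineticSymbol hab n = (freq hab n 0 ^ 2 + freq hab n 1 ^ 2) / 2 := by
  rw [kineticSymbol, EuclideanSpace.norm_sq_eq]
  simp

/-- Pairing the frequency with the lattice generators `a`, `b` returns `2π n i`; Cauchy–Schwarz then
bounds `n i` by the length of the frequency. -/
theorem exists_mul_sq_le_kineticSymbol (hab : LinearIndependent ℝ ![a, b]) :
    ∃ c > 0, ∀ n i, c * (n i : ℝ) ^ 2 ≤ kineticSymbol hab n := by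
  have hcoord (i : Fin 2) (n : Fin 2 → ℤ) :
      inner ℝ (freq hab n) ((coords a b hab).symm (Pi.single i 1)) = 2 * Real.pi * n i := by
    rw [inner_freq]
    simp [Pi.single_apply]
  set C : ℝ := 1 + ∑ i : Fin 2, ‖(coords a b hab).symm (Pi.single i 1)‖ ^ 2 with hC
  have hCpos : 0 < C := by positivity
  refine ⟨1 / (2 * C), by positivity, fun n i => ?_⟩
  have h1 := abs_real_inner_le_norm (freq hab n) ((coords a b hab).symm (Pi.single i 1))
  rw [hcoord] at h1
  have h2 : ‖(coords a b hab).symm (Pi.single i 1)‖ ^ 2 ≤ C := by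
    have := Finset.single_le_sum (f := fun i : Fin 2 => ‖(coords a b hab).symm (Pi.single i 1)‖ ^ 2)
      (fun i _ => by positivity) (Finset.mem_univ i)
    linarith
  have h3 := pow_le_pow_left₀ (abs_nonneg _) h1 2
  rw [sq_abs, mul_pow ‖_‖] at h3
  have h4 : (n i : ℝ) ^ 2 ≤ ‖freq hab n‖ ^ 2 * C := by
    have hpi : 1 ≤ (2 * Real.pi) ^ 2 := by nlinarith [Real.pi_gt_three]
    calc (n i : ℝ) ^ 2 ≤ (2 * Real.pi) ^ 2 * (n i : ℝ) ^ 2 := le_mul_of_one_le_left (by positivity) hpi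
      _ = (2 * Real.pi * n i) ^ 2 := (mul_pow _ _ 2).symm
      _ ≤ _ := h3
      _ ≤ _ := by gcongr
  rw [kineticSymbol, div_mul_eq_mul_div, one_mul, div_le_div_iff₀ (by positivity) two_pos]
  linarith

theorem summable_inv_mul_sq_add {c l : ℝ} (hc : 0 < c) (hl : 0 < l) :
    Summable fun n : ℤ => (c * (n : ℝ) ^ 2 + l)⁻¹ := by
  refine Summable.of_norm_bounded_eventually
    ((Real.summable_one_div_int_pow.2 one_lt_two).mul_left c⁻¹) ?_
  have h0 : {n : ℤ | ¬ n ≠ 0}.Finite := by simp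
  filter_upwards [show ∀ᶠ n : ℤ in Filter.cofinite, n ≠ 0 from h0] with n hn
  have hn' : 0 < (n : ℝ) ^ 2 := by positivity
  rw [Real.norm_of_nonneg (by positivity), one_div, ← mul_inv]
  gcongr
  linarith

/-- Here dimension two is used: one factor is bounded through `n 0`, the other through `n 1`, which
leaves a product of two convergent one-dimensional series. -/
theorem summable_inv_kineticSymbol_sq (hab : LinearIndependent ℝ ![a, b]) {l : ℝ} (hl : 0 < l) :
    Summable fun n => (kineticSymbol hab n + l)⁻¹ ^ 2 := by
  obtain ⟨c, hc, hcn⟩ := exists_mul_sq_le_kineticSymbol hab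
  have h1 := summable_inv_mul_sq_add hc hl
  have h2 := h1.mul_of_nonneg h1 (fun n => by positivity) (fun n => by positivity)
  have h3 := (finTwoArrowEquiv ℤ).summable_iff.2 h2
  refine Summable.of_nonneg_of_le (fun n => by positivity) (fun n => ?_) h3
  have hn := kineticSymbol_nonneg hab n
  have h4 (i : Fin 2) : (kineticSymbol hab n + l)⁻¹ ≤ (c * (n i : ℝ) ^ 2 + l)⁻¹ := by
    have := hcn n i
    gcongr
  rw [sq]
  exact mul_le_mul (h4 0) (h4 1) (by positivity) (by positivity)

/-- Dominated convergence with the series at `l = 1` as majorant. This makes the relative bound of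
`V` arbitrarily small. -/
theorem tendsto_tsum_inv_kineticSymbol_sq (hab : LinearIndependent ℝ ![a, b]) :
    Filter.Tendsto (fun l => ∑' n, (kineticSymbol hab n + l)⁻¹ ^ 2) Filter.atTop (nhds 0) := by
  have h := tendsto_tsum_of_dominated_convergence (𝓕 := Filter.atTop)
    (f := fun (l : ℝ) n => (kineticSymbol hab n + l)⁻¹ ^ 2) (g := fun _ => 0)
    (summable_inv_kineticSymbol_sq hab one_pos) (fun n => ?_) ?_
  · simpa using h
  · have := (Filter.tendsto_atTop_add_const_left Filter.atTop (kineticSymbol hab n)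
      Filter.tendsto_id).inv_tendsto_atTop.pow 2
    simpa using this
  · filter_upwards [Filter.eventually_ge_atTop 1] with l hl n
    have hn := kineticSymbol_nonneg hab n
    rw [Real.norm_of_nonneg (by positivity)]
    gcongr

/-- The free resolvent `(-Δ/2 + l)⁻¹`. -/
noncomputable def freeResolvent (hab : LinearIndependent ℝ ![a, b]) (l : ℝ) :
    TorusL2 a b →L[ℂ] TorusL2 a b :=
  (fourierBasis hab).diagonal fun n => (((kineticSymbol hab n + l)⁻¹ : ℝ) : ℂ)

/-- The operator `∂_j (-Δ/2 + l)⁻¹`. -/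
noncomputable def derivFreeResolvent (hab : LinearIndependent ℝ ![a, b]) (l : ℝ) (j : Fin 2) :
    TorusL2 a b →L[ℂ] TorusL2 a b :=
  (fourierBasis hab).diagonal fun n => Complex.I * freq hab n j * ((kineticSymbol hab n + l : ℝ) : ℂ)⁻¹

/-- The operator `∂_i ∂_j (-Δ/2 + l)⁻¹`. -/
noncomputable def derivTwoFreeResolvent (hab : LinearIndependent ℝ ![a, b]) (l : ℝ) (i j : Fin 2) :
    TorusL2 a b →L[ℂ] TorusL2 a b :=
  (fourierBasis hab).diagonal fun n =>
    Complex.I * freq hab n i * (Complex.I * freq hab n j * ((kineticSymbol hab n + l : ℝ) : ℂ)⁻¹)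

section

variable (hab : LinearIndependent ℝ ![a, b]) {l : ℝ} (hl : 0 < l)
include hl

theorem norm_freeResolvent_entry_le (n : Fin 2 → ℤ) :
    ‖(((kineticSymbol hab n + l)⁻¹ : ℝ) : ℂ)‖ ≤ l⁻¹ := by
  have hn := kineticSymbol_nonneg hab n
  rw [Complex.norm_real, Real.norm_of_nonneg (by positivity)]
  gcongr
  linarith

/-- By `2 |ξ_j| √l ≤ ξ_j² + l` and `ξ_j² ≤ |ξ|²`. The decay in `l` makes first-order terms small. -/
theorem norm_derivFreeResolvent_entry_le (j : Fin 2) (n : Fin 2 → ℤ) :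
    ‖Complex.I * freq hab n j * ((kineticSymbol hab n + l : ℝ) : ℂ)⁻¹‖ ≤ (√l)⁻¹ := by
  have hn := kineticSymbol_nonneg hab n
  have hpos : 0 < kineticSymbol hab n + l := by linarith
  rw [norm_mul, norm_mul, Complex.norm_I, one_mul, norm_inv, Complex.norm_real, Complex.norm_real,
    Real.norm_of_nonneg hpos.le, ← div_eq_mul_inv, div_le_iff₀ hpos, ← div_eq_inv_mul,
    le_div_iff₀ (Real.sqrt_pos.2 hl), Real.norm_eq_abs]
  have h1 : |freq hab n j| ^ 2 ≤ 2 * kineticSymbol hab n := by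
    rw [kineticSymbol_eq_sum, sq_abs]
    fin_cases j
    · simp only [Fin.zero_eta]; nlinarith [sq_nonneg (freq hab n 1)]
    · simp only [Fin.mk_one]; nlinarith [sq_nonneg (freq hab n 0)]
  nlinarith [Real.sq_sqrt hl.le, sq_nonneg (|freq hab n j| - √l)]

theorem norm_derivTwoFreeResolvent_entry_le (i j : Fin 2) (n : Fin 2 → ℤ) :
    ‖Complex.I * freq hab n i * (Complex.I * freq hab n j * ((kineticSymbol hab n + l : ℝ) : ℂ)⁻¹)‖
      ≤ 2 := by
  have hn := kineticSymbol_nonneg hab n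
  have hpos : 0 < kineticSymbol hab n + l := by linarith
  rw [norm_mul, norm_mul, norm_mul, norm_mul, Complex.norm_I, one_mul, one_mul, norm_inv,
    Complex.norm_real, Complex.norm_real, Complex.norm_real, Real.norm_of_nonneg hpos.le, ← mul_assoc,
    ← div_eq_mul_inv, div_le_iff₀ hpos, Real.norm_eq_abs, Real.norm_eq_abs]
  have h1 (j : Fin 2) : |freq hab n j| ^ 2 ≤ 2 * kineticSymbol hab n := by
    rw [kineticSymbol_eq_sum, sq_abs]
    fin_cases j
    · simp only [Fin.zero_eta]; nlinarith [sq_nonneg (freq hab n 1)]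
    · simp only [Fin.mk_one]; nlinarith [sq_nonneg (freq hab n 0)]
  nlinarith [h1 i, h1 j, sq_nonneg (|freq hab n i| - |freq hab n j|)]

theorem inner_freeResolvent (f : TorusL2 a b) (n : Fin 2 → ℤ) :
    inner ℂ (fourierBasis hab n) (freeResolvent hab l f) =
      ((kineticSymbol hab n + l)⁻¹ : ℝ) * inner ℂ (fourierBasis hab n) f :=
  (fourierBasis hab).inner_diagonal (inv_pos.2 hl).le (norm_freeResolvent_entry_le hab hl) f n

theorem inner_derivFreeResolvent (j : Fin 2) (f : TorusL2 a b) (n : Fin 2 → ℤ) :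
    inner ℂ (fourierBasis hab n) (derivFreeResolvent hab l j f) =
      Complex.I * freq hab n j * ((kineticSymbol hab n + l : ℝ) : ℂ)⁻¹ *
        inner ℂ (fourierBasis hab n) f :=
  (fourierBasis hab).inner_diagonal (by positivity) (norm_derivFreeResolvent_entry_le hab hl j) f n

theorem inner_derivTwoFreeResolvent (i j : Fin 2) (f : TorusL2 a b) (n : Fin 2 → ℤ) :
    inner ℂ (fourierBasis hab n) (derivTwoFreeResolvent hab l i j f) =
      Complex.I * freq hab n i * (Complex.I * freq hab n j * ((kineticSymbol hab n + l : ℝ) : ℂ)⁻¹) *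
        inner ℂ (fourierBasis hab n) f :=
  (fourierBasis hab).inner_diagonal two_pos.le (norm_derivTwoFreeResolvent_entry_le hab hl i j) f n

theorem norm_freeResolvent_le : ‖freeResolvent hab l‖ ≤ l⁻¹ :=
  (fourierBasis hab).norm_diagonal_le (inv_pos.2 hl).le (norm_freeResolvent_entry_le hab hl)

theorem norm_derivFreeResolvent_le (j : Fin 2) : ‖derivFreeResolvent hab l j‖ ≤ (√l)⁻¹ :=
  (fourierBasis hab).norm_diagonal_le (by positivity) (norm_derivFreeResolvent_entry_le hab hl j)

theorem isCompactOperator_freeResolvent : IsCompactOperator (freeResolvent hab l) := by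
  refine (fourierBasis hab).isCompactOperator_diagonal (inv_pos.2 hl).le
    (norm_freeResolvent_entry_le hab hl) ?_
  have h1 := (summable_inv_kineticSymbol_sq hab hl).tendsto_cofinite_zero.sqrt
  rw [Real.sqrt_zero] at h1
  rw [← Complex.ofReal_zero]
  refine (Complex.continuous_ofReal.tendsto 0).comp (h1.congr fun n => Real.sqrt_sq ?_)
  have hn := kineticSymbol_nonneg hab n
  positivity

theorem isWeakDeriv_freeResolvent (j : Fin 2) (f : TorusL2 a b) :
    IsWeakDeriv a b j (freeResolvent hab l f) (derivFreeResolvent hab l j f) := by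
  rw [isWeakDeriv_iff hab]
  intro n
  rw [inner_freeResolvent hab hl, inner_derivFreeResolvent hab hl, Complex.ofReal_inv, mul_assoc _ _⁻¹]

theorem isWeakDeriv_derivFreeResolvent (i j : Fin 2) (f : TorusL2 a b) :
    IsWeakDeriv a b i (derivFreeResolvent hab l j f) (derivTwoFreeResolvent hab l i j f) := by
  rw [isWeakDeriv_iff hab]
  intro n
  rw [inner_derivFreeResolvent hab hl, inner_derivTwoFreeResolvent hab hl]
  ring

/-- Only the pure second derivatives are assumed; the conclusion puts `u` in the range of the free
resolvent, so the mixed derivatives exist too. This is the elliptic regularity behind the domain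
statement. -/
theorem freeResolvent_eq {u : TorusL2 a b} {d d' : Fin 2 → TorusL2 a b}
    (h : ∀ j, IsWeakDeriv a b j u (d j)) (h' : ∀ j, IsWeakDeriv a b j (d j) (d' j)) :
    freeResolvent hab l ((-(1 / 2 : ℂ)) • (d' 0 + d' 1) + (l : ℂ) • u) = u := by
  refine (fourierBasis hab).ext_inner fun n => ?_
  have hn := kineticSymbol_nonneg hab n
  have hpos : ((kineticSymbol hab n + l : ℝ) : ℂ) ≠ 0 := by
    rw [Complex.ofReal_ne_zero]
    linarith
  rw [inner_freeResolvent hab hl, inner_add_right, inner_smul_right, inner_smul_right,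
    inner_add_right, (h' 0).inner_fourierBasis hab, (h' 1).inner_fourierBasis hab,
    (h 0).inner_fourierBasis hab, (h 1).inner_fourierBasis hab, Complex.ofReal_inv,
    inv_mul_eq_iff_eq_mul₀ hpos, kineticSymbol_eq_sum]
  push_cast
  linear_combination (-(1 / 2 : ℂ)) * ((freq hab n 0 : ℂ) ^ 2 + (freq hab n 1 : ℂ) ^ 2) *
    inner ℂ (fourierBasis hab n) u * Complex.I_sq

theorem derivTwoFreeResolvent_add (f : TorusL2 a b) :
    (-(1 / 2 : ℂ)) • (derivTwoFreeResolvent hab l 0 0 f + derivTwoFreeResolvent hab l 1 1 f) +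
      (l : ℂ) • freeResolvent hab l f = f := by
  refine (fourierBasis hab).ext_inner fun n => ?_
  have hn := kineticSymbol_nonneg hab n
  have hpos : ((kineticSymbol hab n + l : ℝ) : ℂ) ≠ 0 := by
    rw [Complex.ofReal_ne_zero]
    linarith
  rw [inner_add_right, inner_smul_right, inner_smul_right, inner_add_right,
    inner_freeResolvent hab hl, inner_derivTwoFreeResolvent hab hl,
    inner_derivTwoFreeResolvent hab hl, Complex.ofReal_inv]
  have h1 : ((kineticSymbol hab n + l : ℝ) : ℂ) =
      ((freq hab n 0 : ℂ) ^ 2 + (freq hab n 1 : ℂ) ^ 2) / 2 + l := by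
    rw [kineticSymbol_eq_sum]
    push_cast
    ring
  have h2 := mul_inv_cancel₀ hpos
  set q : ℂ := ((kineticSymbol hab n + l : ℝ) : ℂ)⁻¹ with hq
  rw [h1] at h2
  linear_combination inner ℂ (fourierBasis hab n) f * h2 +
    (-(1 / 2 : ℂ)) * ((freq hab n 0 : ℂ) ^ 2 + (freq hab n 1 : ℂ) ^ 2) * q *
    inner ℂ (fourierBasis hab n) f * Complex.I_sq

/-- The free resolvent maps into bounded functions. -/
theorem ae_norm_freeResolvent_le (f : TorusL2 a b) :
    ∀ᵐ x ∂torusMeasure a b, ‖freeResolvent hab l f x‖ ≤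
      √(∑' n, (kineticSymbol hab n + l)⁻¹ ^ 2) * ‖f‖ := by
  have hn := kineticSymbol_nonneg hab
  have h1 := (summable_inv_kineticSymbol_sq hab hl).hasSum
  have h2 := UnboundedOperator.hasSum_norm_inner_sq (fourierBasis hab) f
  have hS : 0 ≤ ∑' n, (kineticSymbol hab n + l)⁻¹ ^ 2 := tsum_nonneg fun n => by positivity
  -- Cauchy–Schwarz for the Fourier coefficients: the inverse symbols and the coefficients of `f`
  -- are both square summable.
  obtain ⟨S, -, hSle, hsum⟩ := Real.inner_le_Lp_mul_Lq_hasSum_of_nonneg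
    (p := 2) (q := 2) (by constructor <;> norm_num)
    (A := √(∑' n, (kineticSymbol hab n + l)⁻¹ ^ 2)) (B := ‖f‖)
    (f := fun n => (kineticSymbol hab n + l)⁻¹) (g := fun n => ‖inner ℂ (fourierBasis hab n) f‖)
    (by positivity) (norm_nonneg _) (fun n => by have := hn n; positivity) (fun n => norm_nonneg _)
    (by rw [Real.rpow_two, Real.sq_sqrt hS]; simpa only [Real.rpow_two] using h1) (by simpa using h2)
  have h3 : HasSum (fun n => ‖inner ℂ (fourierBasis hab n) (freeResolvent hab l f)‖) S := by
    refine hsum.congr_fun fun n => ?_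
    have := hn n
    rw [inner_freeResolvent hab hl, norm_mul, Complex.norm_real, Real.norm_of_nonneg (by positivity)]
  filter_upwards [ae_norm_le_of_hasSum hab h3] with x hx
  exact hx.trans hSle

/-- The free resolvent of `f` is bounded by a multiple of `‖f‖`, so its product with the square
integrable `V` is in `L²`. -/
theorem exists_mul_freeResolvent {V : Plane → ℝ}
    (hV : MeasureTheory.MemLp V 2 (torusMeasure a b)) :
    ∃ G : TorusL2 a b →L[ℂ] TorusL2 a b,
      (∀ f, G f =ᵐ[torusMeasure a b] fun x => (V x : ℂ) * freeResolvent hab l f x) ∧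
      ‖G‖ ≤ ‖hV.toLp‖ * √(∑' n, (kineticSymbol hab n + l)⁻¹ ^ 2) := by
  set S := √(∑' n, (kineticSymbol hab n + l)⁻¹ ^ 2) with hS
  have hbd (f : TorusL2 a b) : ∀ᵐ x ∂torusMeasure a b,
      ‖(V x : ℂ) * freeResolvent hab l f x‖ ≤ S * ‖f‖ * ‖V x‖ := by
    filter_upwards [ae_norm_freeResolvent_le hab hl f] with x hx
    rw [norm_mul, Complex.norm_real, mul_comm]
    gcongr
  have hmem (f : TorusL2 a b) : MeasureTheory.MemLp
      (fun x => (V x : ℂ) * freeResolvent hab l f x) 2 (torusMeasure a b) :=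
    hV.of_le_mul ((Complex.continuous_ofReal.comp_aestronglyMeasurable hV.1).mul
      (MeasureTheory.Lp.aestronglyMeasurable _)) (hbd f)
  refine ⟨LinearMap.mkContinuous
    { toFun := fun f => (hmem f).toLp
      map_add' := fun u v => by
        rw [← MeasureTheory.MemLp.toLp_add, MeasureTheory.MemLp.toLp_eq_toLp_iff, map_add]
        filter_upwards [MeasureTheory.Lp.coeFn_add (freeResolvent hab l u) (freeResolvent hab l v)]
          with x hx
        simp only [hx, Pi.add_apply, mul_add]
      map_smul' := fun c u => by
        rw [RingHom.id_apply, ← MeasureTheory.MemLp.toLp_const_smul,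
          MeasureTheory.MemLp.toLp_eq_toLp_iff, map_smul]
        filter_upwards [MeasureTheory.Lp.coeFn_smul c (freeResolvent hab l u)] with x hx
        simp only [hx, Pi.smul_apply, smul_eq_mul, mul_left_comm] } (‖hV.toLp‖ * S) ?_,
    fun f => (hmem f).coeFn_toLp, LinearMap.mkContinuous_norm_le _ (by positivity) _⟩
  intro f
  rw [mul_assoc, mul_comm]
  refine MeasureTheory.Lp.norm_le_mul_norm_of_ae_le_mul ?_
  filter_upwards [hbd f, (hmem f).coeFn_toLp, hV.coeFn_toLp] with x hx h1 h2
  change ‖(hmem f).toLp _ x‖ ≤ _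
  rw [h1, h2]
  exact hx

end

end BlochFiber

namespace BlochFiber

variable {a b : Plane} {A : Plane → Plane} {V : Plane → ℝ}

/-! ### The fiber operators -/

/-- The component `k_j - A_j` as a complex function. -/
noncomputable def shiftedPotential (A : Plane → Plane) (k : Plane) (j : Fin 2) (x : Plane) : ℂ :=
  ((k j - A x j : ℝ) : ℂ)

theorem WeakAssumption.contDiff_shiftedPotential (hAV : WeakAssumption a b A V) (k : Plane)
    (j : Fin 2) : ContDiff ℝ 1 (shiftedPotential A k j) :=
  Complex.ofRealCLM.contDiff.comp (contDiff_const.sub (hAV.contDiff_A j))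

theorem WeakAssumption.isPeriodic_shiftedPotential (hAV : WeakAssumption a b A V) (k : Plane)
    (j : Fin 2) : IsPeriodic a b (shiftedPotential A k j) := fun l hl r => by
  rw [shiftedPotential, shiftedPotential, hAV.periodic_A l hl r]

theorem WeakAssumption.memLp_torusMeasure (hAV : WeakAssumption a b A V) :
    MeasureTheory.MemLp V 2 (torusMeasure a b) := by
  rw [torusMeasure, ProbabilityTheory.cond]
  -- A null cell would make the normalizing factor infinite, but then the restricted measure is
  -- zero.
  by_cases h : MeasureTheory.volume (cell a b) = 0
  · rw [MeasureTheory.Measure.restrict_eq_zero.2 h, smul_zero]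
    simp
  · exact hAV.memLp_V.smul_measure (ENNReal.inv_ne_top.2 h)

theorem IsWeakDeriv.add {j : Fin 2} {u g v h : TorusL2 a b} (hu : IsWeakDeriv a b j u g)
    (hv : IsWeakDeriv a b j v h) : IsWeakDeriv a b j (u + v) (g + h) :=
  (weakDerivGraph a b j).add_mem (x := (u, g)) (y := (v, h)) hu hv

theorem IsWeakDeriv.smul {j : Fin 2} {u g : TorusL2 a b} (hu : IsWeakDeriv a b j u g) (c : ℂ) :
    IsWeakDeriv a b j (c • u) (c • g) :=
  (weakDerivGraph a b j).smul_mem (x := (u, g)) c hu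

section

variable (hAV : WeakAssumption a b A V)

/-- Multiplication by `k_j - A_j`. -/
noncomputable def mulShift (k : Plane) (j : Fin 2) : TorusL2 a b →L[ℂ] TorusL2 a b :=
  mulContinuous a b (hAV.contDiff_shiftedPotential k j).continuous

/-- Multiplication by `∂_j (k_j - A_j)`. -/
noncomputable def mulDerivShift (k : Plane) (j : Fin 2) : TorusL2 a b →L[ℂ] TorusL2 a b :=
  mulContinuous a b (continuous_pderiv (hAV.contDiff_shiftedPotential k j) j)

variable (hab : LinearIndependent ℝ ![a, b])
include hab

/-- Multiplication by the continuous periodic `k j - A j` is defined everywhere, so the domain is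
that of the weak derivative alone. -/
theorem mem_graph_kineticMomentum {k : Plane} {j : Fin 2} {u p : TorusL2 a b} :
    (u, p) ∈ (kineticMomentum a b A k j).graph ↔
      ∃ d, IsWeakDeriv a b j u d ∧ (-Complex.I) • d + mulShift hAV k j u = p := by
  have hmul (u v : TorusL2 a b) : (u, v) ∈ (mulOp a b fun x => k j - A x j).graph ↔
      mulShift hAV k j u = v := by
    rw [mem_graph_mulOp]
    have h1 := coeFn_mulContinuous (hAV.contDiff_shiftedPotential k j).continuous u
    constructor
    · intro h
      exact MeasureTheory.Lp.ext (h1.trans h.symm)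
    · rintro rfl
      exact h1
  rw [kineticMomentum, UnboundedOperator.mem_graph_add]
  constructor
  · rintro ⟨x, y, hx, hy, rfl⟩
    obtain ⟨d, hd, rfl⟩ := UnboundedOperator.mem_graph_smul.1 hx
    exact ⟨d, (mem_graph_weakDeriv hab).1 hd, by rw [(hmul u y).1 hy]⟩
  · rintro ⟨d, hd, rfl⟩
    exact ⟨_, _, UnboundedOperator.mem_graph_smul.2 ⟨d, (mem_graph_weakDeriv hab).2 hd, rfl⟩,
      (hmul _ _).2 rfl, rfl⟩

omit hAV in
theorem isSymmetric_kineticMomentum (k : Plane) (j : Fin 2) :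
    UnboundedOperator.IsSymmetric (kineticMomentum a b A k j) := by
  refine UnboundedOperator.IsSymmetric.add ?_ (isSymmetric_mulOp _)
  intro u u' v v' hu hv
  obtain ⟨d, hd, rfl⟩ := UnboundedOperator.mem_graph_smul.1 hu
  obtain ⟨d', hd', rfl⟩ := UnboundedOperator.mem_graph_smul.1 hv
  rw [mem_graph_weakDeriv hab] at hd hd'
  rw [inner_smul_left, inner_smul_right, hd.inner_left hab hd', map_neg, Complex.conj_I]
  ring

omit hab in
theorem mem_graph_fiberHamiltonian {k : Plane} {u y : TorusL2 a b} :
    (u, y) ∈ (fiberHamiltonian a b A V k).graph ↔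
      ∃ (p q : Fin 2 → TorusL2 a b) (v : TorusL2 a b),
        (∀ j, (u, p j) ∈ (kineticMomentum a b A k j).graph ∧
          (p j, q j) ∈ (kineticMomentum a b A k j).graph) ∧
        (v =ᵐ[torusMeasure a b] fun x => (V x : ℂ) * u x) ∧
        (1 / 2 : ℂ) • (q 0 + q 1) + v = y := by
  rw [fiberHamiltonian, UnboundedOperator.mem_graph_add]
  constructor
  · rintro ⟨x, v, hx, hv, rfl⟩
    obtain ⟨z, hz, rfl⟩ := UnboundedOperator.mem_graph_smul.1 hx
    obtain ⟨q₀, q₁, hq₀, hq₁, rfl⟩ := UnboundedOperator.mem_graph_add.1 hz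
    obtain ⟨p₀, hp₀, hp₀'⟩ := UnboundedOperator.mem_graph_comp.1 hq₀
    obtain ⟨p₁, hp₁, hp₁'⟩ := UnboundedOperator.mem_graph_comp.1 hq₁
    refine ⟨![p₀, p₁], ![q₀, q₁], v, fun j => ?_, mem_graph_mulOp.1 hv, rfl⟩
    fin_cases j
    · exact ⟨hp₀, hp₀'⟩
    · exact ⟨hp₁, hp₁'⟩
  · rintro ⟨p, q, v, hpq, hv, rfl⟩
    exact ⟨_, v, UnboundedOperator.mem_graph_smul.2 ⟨_, UnboundedOperator.mem_graph_add.2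
      ⟨q 0, q 1, UnboundedOperator.mem_graph_comp.2 ⟨p 0, hpq 0⟩,
        UnboundedOperator.mem_graph_comp.2 ⟨p 1, hpq 1⟩, rfl⟩, rfl⟩, mem_graph_mulOp.2 hv, rfl⟩

omit hAV in
theorem isSymmetric_fiberHamiltonian (k : Plane) :
    UnboundedOperator.IsSymmetric (fiberHamiltonian a b A V k) := by
  refine UnboundedOperator.IsSymmetric.add (UnboundedOperator.IsSymmetric.smul ?_ (by simp [map_ofNat]))
    (isSymmetric_mulOp V)
  exact (isSymmetric_kineticMomentum hab k 0).comp_self.add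
    (isSymmetric_kineticMomentum hab k 1).comp_self

/-- The square of the kinetic momentum on functions with two weak derivatives. -/
theorem mem_graph_kineticMomentum_sq (k : Plane) {j : Fin 2} {u d d' : TorusL2 a b}
    (h : IsWeakDeriv a b j u d) (h' : IsWeakDeriv a b j d d') :
    (u, (-Complex.I) • d + mulShift hAV k j u) ∈ (kineticMomentum a b A k j).graph ∧
    ((-Complex.I) • d + mulShift hAV k j u,
      (-Complex.I) • ((-Complex.I) • d' + (mulShift hAV k j d + mulDerivShift hAV k j u)) +
        mulShift hAV k j ((-Complex.I) • d + mulShift hAV k j u)) ∈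
      (kineticMomentum a b A k j).graph := by
  refine ⟨(mem_graph_kineticMomentum hAV hab).2 ⟨d, h, rfl⟩,
    (mem_graph_kineticMomentum hAV hab).2 ⟨_, ?_, rfl⟩⟩
  exact (h'.smul (-Complex.I)).add
    (h.mulContinuous hab (hAV.contDiff_shiftedPotential k j) (hAV.isPeriodic_shiftedPotential k j))

include hAV in
/-- A function in the domain of the square of the kinetic momentum has two weak derivatives. -/
theorem exists_isWeakDeriv_of_mem_graph {k : Plane} {j : Fin 2} {u p q : TorusL2 a b}
    (h : (u, p) ∈ (kineticMomentum a b A k j).graph)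
    (h' : (p, q) ∈ (kineticMomentum a b A k j).graph) :
    ∃ d d', IsWeakDeriv a b j u d ∧ IsWeakDeriv a b j d d' := by
  obtain ⟨d, hd, rfl⟩ := (mem_graph_kineticMomentum hAV hab).1 h
  obtain ⟨d', hd', -⟩ := (mem_graph_kineticMomentum hAV hab).1 h'
  -- Since `p = -i d + W u` and `W u` are both differentiable (the latter by Leibniz), so is `d = i
  -- (p - W u)`.
  have h1 := (hd'.add ((hd.mulContinuous hab (hAV.contDiff_shiftedPotential k j)
    (hAV.isPeriodic_shiftedPotential k j)).smul (-1))).smul Complex.I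
  refine ⟨d, Complex.I • (d' + (-1 : ℂ) • (mulShift hAV k j d + mulDerivShift hAV k j u)), hd, ?_⟩
  have h2 : d = Complex.I • ((-Complex.I) • d + mulShift hAV k j u + (-1 : ℂ) • mulShift hAV k j u) := by
    rw [neg_one_smul, add_neg_cancel_right, smul_smul]
    simp
  have h3 : IsWeakDeriv a b j
      (Complex.I • ((-Complex.I) • d + mulShift hAV k j u + (-1 : ℂ) • mulShift hAV k j u))
      (Complex.I • (d' + (-1 : ℂ) • (mulShift hAV k j d + mulDerivShift hAV k j u))) := h1
  rwa [← h2] at h3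

include hAV in
omit hab hAV in
-- The three terms are what remains of `½ (-i∂_j + W)²` besides `-½ ∂_j²`; `W'` stands for the
-- derivative of `W`, `D` for `∂_j R`.
theorem norm_perturbation_le {E : Type*} [NormedAddCommGroup E] [NormedSpace ℂ E]
    (W W' D R : E →L[ℂ] E) {r s : ℝ} (hD : ‖D‖ ≤ r) (hR : ‖R‖ ≤ s) :
    ‖(-Complex.I) • (W ∘L D) + (-(Complex.I / 2)) • (W' ∘L R) + (1 / 2 : ℂ) • (W ∘L W ∘L R)‖ ≤
      ‖W‖ * r + (‖W'‖ + ‖W‖ * ‖W‖) * s := by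
  have e1 : ‖(-Complex.I) • (W ∘L D)‖ ≤ ‖W‖ * r := by
    rw [norm_smul, norm_neg, Complex.norm_I, one_mul]
    exact (W.opNorm_comp_le _).trans (by gcongr)
  have e2 : ‖(-(Complex.I / 2)) • (W' ∘L R)‖ ≤ ‖W'‖ * s := by
    rw [norm_smul, norm_neg, norm_div, Complex.norm_I]
    have : ‖W' ∘L R‖ ≤ ‖W'‖ * s := (W'.opNorm_comp_le _).trans (by gcongr)
    exact (mul_le_of_le_one_left (norm_nonneg _) (by norm_num)).trans this
  have e3 : ‖(1 / 2 : ℂ) • (W ∘L W ∘L R)‖ ≤ ‖W‖ * ‖W‖ * s := by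
    rw [norm_smul]
    have : ‖W ∘L W ∘L R‖ ≤ ‖W‖ * ‖W‖ * s := by
      rw [mul_assoc]
      refine (W.opNorm_comp_le _).trans ?_
      gcongr
      exact (W.opNorm_comp_le _).trans (by gcongr)
    exact (mul_le_of_le_one_left (norm_nonneg _) (by norm_num)).trans this
  refine (norm_add₃_le).trans ?_
  rw [add_mul, ← add_assoc]
  exact add_le_add_three e1 e2 e3

omit hab hAV in
theorem perturbation_apply {E : Type*} [NormedAddCommGroup E] [NormedSpace ℂ E]
    (W W' D R : E →L[ℂ] E) (f d' : E) :
    (1 / 2 : ℂ) • ((-Complex.I) • ((-Complex.I) • d' + (W (D f) + W' (R f))) +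
      W ((-Complex.I) • D f + W (R f))) =
    (-(1 / 2 : ℂ)) • d' + ((-Complex.I) • (W ∘L D) + (-(Complex.I / 2)) • (W' ∘L R) +
      (1 / 2 : ℂ) • (W ∘L W ∘L R)) f := by
  have : (-Complex.I) • (-Complex.I) • d' = (-1 : ℂ) • d' := by
    rw [smul_smul]; simp
  rw [smul_add (-Complex.I), this]
  simp only [_root_.map_add, _root_.map_smul, add_apply, smul_apply, ContinuousLinearMap.comp_apply]
  module

include hAV in
/-- The resolvent identity `(H(k) + l) (-Δ/2 + l)⁻¹ = 1 + K`. -/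
theorem exists_mem_graph_freeResolvent (k : Plane) :
    ∃ C : ℝ, ∀ l : ℝ, 0 < l → ∃ K : TorusL2 a b →L[ℂ] TorusL2 a b,
      ‖K‖ ≤ C * (√l)⁻¹ + C * l⁻¹ + C * √(∑' n, (kineticSymbol hab n + l)⁻¹ ^ 2) ∧
      ∀ f, (freeResolvent hab l f, f + K f + (-l : ℂ) • freeResolvent hab l f) ∈
        (fiberHamiltonian a b A V k).graph := by
  set W := fun j => mulShift hAV k j with hW
  set W' := fun j => mulDerivShift hAV k j with hW'
  obtain ⟨v, hv⟩ : ∃ v : ℝ, ‖hAV.memLp_torusMeasure.toLp‖ = v := ⟨_, rfl⟩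
  have hv0 : 0 ≤ v := hv ▸ norm_nonneg _
  -- One constant, independent of `l`, that dominates the coefficients of all three decaying
  -- factors.
  refine ⟨‖W 0‖ + ‖W 1‖ + (‖W' 0‖ + ‖W 0‖ * ‖W 0‖ + (‖W' 1‖ + ‖W 1‖ * ‖W 1‖)) + v, fun l hl => ?_⟩
  obtain ⟨G, hG, hGn⟩ := exists_mul_freeResolvent hab hl hAV.memLp_torusMeasure
  rw [hv] at hGn
  let N (j : Fin 2) : TorusL2 a b →L[ℂ] TorusL2 a b :=
    (-Complex.I) • (W j ∘L derivFreeResolvent hab l j) +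
      (-(Complex.I / 2)) • (W' j ∘L freeResolvent hab l) +
      (1 / 2 : ℂ) • (W j ∘L W j ∘L freeResolvent hab l)
  have hN (j : Fin 2) : ‖N j‖ ≤ ‖W j‖ * (√l)⁻¹ + (‖W' j‖ + ‖W j‖ * ‖W j‖) * l⁻¹ :=
    norm_perturbation_le _ _ _ _ (norm_derivFreeResolvent_le hab hl j) (norm_freeResolvent_le hab hl)
  refine ⟨N 0 + N 1 + G, ?_, fun f => ?_⟩
  · have h0 := hN 0
    have h1 := hN 1
    refine (norm_add₃_le).trans ?_
    have hs0 : 0 ≤ √(∑' n, (kineticSymbol hab n + l)⁻¹ ^ 2) := Real.sqrt_nonneg _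
    have hl1 : 0 ≤ (√l)⁻¹ := by positivity
    have hl2 : 0 ≤ l⁻¹ := by positivity
    have hw : 0 ≤ ‖W 0‖ + ‖W 1‖ := by positivity
    have hw' : 0 ≤ ‖W' 0‖ + ‖W 0‖ * ‖W 0‖ + (‖W' 1‖ + ‖W 1‖ * ‖W 1‖) := by positivity
    generalize √(∑' n, (kineticSymbol hab n + l)⁻¹ ^ 2) = s at *
    generalize ‖N 0‖ = n₀, ‖N 1‖ = n₁, ‖G‖ = g at *
    generalize ‖W' 0‖ + ‖W 0‖ * ‖W 0‖ = y₀, ‖W' 1‖ + ‖W 1‖ * ‖W 1‖ = y₁ at *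
    generalize ‖W 0‖ = w₀, ‖W 1‖ = w₁, (√l)⁻¹ = r, l⁻¹ = t at *
    nlinarith [mul_nonneg hw' hl1, mul_nonneg hv0 hl1, mul_nonneg hw hl2, mul_nonneg hv0 hl2,
      mul_nonneg hw hs0, mul_nonneg hw' hs0]
  · have hd (j : Fin 2) := mem_graph_kineticMomentum_sq hAV hab k
      (isWeakDeriv_freeResolvent hab hl j f) (isWeakDeriv_derivFreeResolvent hab hl j j f)
    rw [mem_graph_fiberHamiltonian]
    refine ⟨_, _, G f, hd, hG f, ?_⟩
    have h1 := derivTwoFreeResolvent_add hab hl f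
    have hI (j : Fin 2) := perturbation_apply (W j) (W' j) (derivFreeResolvent hab l j)
      (freeResolvent hab l) f (derivTwoFreeResolvent hab l j j f)
    change ∀ j, _ = _ + N j f at hI
    rw [smul_add]
    refine (congrArg₂ (fun x y => x + y + G f) (hI 0) (hI 1)).trans ?_
    change _ = f + (N 0 f + N 1 f + G f) + _
    generalize N 0 f = n₀, N 1 f = n₁, G f = g
    rw [← eq_sub_iff_add_eq] at h1
    rw [smul_add] at h1
    calc _ = ((-(1 / 2 : ℂ)) • derivTwoFreeResolvent hab l 0 0 f +
          (-(1 / 2 : ℂ)) • derivTwoFreeResolvent hab l 1 1 f) + (n₀ + n₁ + g) := by abel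
      _ = _ := by rw [h1]; module

end

end BlochFiber

namespace BlochFiber

variable {a b : Plane} {A : Plane → Plane} {V : Plane → ℝ}

/-! ### Domain and resolvent of the fiber operators -/

/-- The natural domain requires each squared momentum separately, so no cancellation with `V` can
enlarge it. -/
theorem exists_freeResolvent_eq_of_mem_graph (hab : LinearIndependent ℝ ![a, b])
    (hAV : WeakAssumption a b A V) {k : Plane} {u y : TorusL2 a b}
    (h : (u, y) ∈ (fiberHamiltonian a b A V k).graph) {l : ℝ} (hl : 0 < l) :
    ∃ f, freeResolvent hab l f = u := by
  obtain ⟨p, q, v, hpq, -, -⟩ := mem_graph_fiberHamiltonian.1 h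
  have h1 (j : Fin 2) := exists_isWeakDeriv_of_mem_graph hAV hab (hpq j).1 (hpq j).2
  choose d d' hd hd' using h1
  exact ⟨_, freeResolvent_eq hab hl hd hd'⟩

theorem domain_fiberHamiltonian (hab : LinearIndependent ℝ ![a, b]) (hAV : WeakAssumption a b A V)
    (k : Plane) : ((fiberHamiltonian a b A V k).domain : Set (TorusL2 a b)) = sobolevTwo a b := by
  ext u
  constructor
  · intro hu
    obtain ⟨f, rfl⟩ := exists_freeResolvent_eq_of_mem_graph hab hAV
      ((fiberHamiltonian a b A V k).mem_graph ⟨u, hu⟩) one_pos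
    exact fun i => ⟨_, isWeakDeriv_freeResolvent hab one_pos i f, fun j =>
      ⟨_, isWeakDeriv_derivFreeResolvent hab one_pos j i f⟩⟩
  · intro hu
    choose d hd d' hd' using hu
    obtain ⟨C, hC⟩ := exists_mem_graph_freeResolvent hAV hab k
    obtain ⟨K, -, hK⟩ := hC 1 one_pos
    rw [← freeResolvent_eq hab one_pos (d' := fun j => d' j j) hd fun j => hd' j j]
    exact LinearPMap.mem_domain_of_mem_graph (hK _)

/-- Each of the three bounds on `K` vanishes as `l → ∞`. The value `1 / 2` also gives `‖f‖ ≤ 2 ‖f +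
K f‖` later. -/
theorem exists_mem_graph_freeResolvent_of_le (hab : LinearIndependent ℝ ![a, b])
    (hAV : WeakAssumption a b A V) (k : Plane) :
    ∃ l₀ > 0, ∀ l ≥ l₀, ∃ K : TorusL2 a b →L[ℂ] TorusL2 a b, ‖K‖ ≤ 1 / 2 ∧
      ∀ f, (freeResolvent hab l f, f + K f + (-l : ℂ) • freeResolvent hab l f) ∈
        (fiberHamiltonian a b A V k).graph := by
  obtain ⟨C, hC⟩ := exists_mem_graph_freeResolvent hAV hab k
  have h1 : Filter.Tendsto (fun l => C * (√l)⁻¹ + C * l⁻¹ +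
      C * √(∑' n, (kineticSymbol hab n + l)⁻¹ ^ 2)) Filter.atTop (nhds 0) := by
    have e1 := (Real.tendsto_sqrt_atTop.inv_tendsto_atTop).const_mul C
    have e2 := (tendsto_inv_atTop_zero (𝕜 := ℝ)).const_mul C
    have e3 := ((tendsto_tsum_inv_kineticSymbol_sq hab).sqrt).const_mul C
    simpa using (e1.add e2).add e3
  obtain ⟨l₀, hl₀⟩ := Filter.eventually_atTop.1 (h1.eventually_lt_const (show (0 : ℝ) < 1 / 2 by norm_num))
  refine ⟨max l₀ 1, by positivity, fun l hl => ?_⟩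
  obtain ⟨K, hK, hK'⟩ := hC l (one_pos.trans_le ((le_max_right _ _).trans hl))
  exact ⟨K, hK.trans (hl₀ l ((le_max_left _ _).trans hl)).le, hK'⟩

/-- Below some point of the real line, `H(k)` has no spectrum and a compact resolvent. -/
theorem exists_isResolventAt (hab : LinearIndependent ℝ ![a, b]) (hAV : WeakAssumption a b A V)
    (k : Plane) {l₀ : ℝ} (hl₀ : 0 < l₀)
    (h : ∀ l ≥ l₀, ∃ K : TorusL2 a b →L[ℂ] TorusL2 a b, ‖K‖ ≤ 1 / 2 ∧
      ∀ f, (freeResolvent hab l f, f + K f + (-l : ℂ) • freeResolvent hab l f) ∈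
        (fiberHamiltonian a b A V k).graph) {c : ℝ} (hc : c ≤ -l₀) :
    ∃ R : TorusL2 a b →L[ℂ] TorusL2 a b,
      UnboundedOperator.IsResolventAt (fiberHamiltonian a b A V k) c R ∧ IsCompactOperator R := by
  have hc' : 0 < -c := by linarith
  obtain ⟨K, hK, hK'⟩ := h (-c) (by linarith)
  refine UnboundedOperator.exists_isResolventAt_of_norm_le (K := K)
    (isCompactOperator_freeResolvent hab hc') (fun x hx => ?_) (fun f => ?_)
    (hK.trans_lt (by norm_num))
  · exact exists_freeResolvent_eq_of_mem_graph hab hAV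
      ((fiberHamiltonian a b A V k).mem_graph ⟨x, hx⟩) hc'
  · simpa using hK' f

theorem eq_zero_of_mem_graph_smul (hab : LinearIndependent ℝ ![a, b])
    (hAV : WeakAssumption a b A V) (k : Plane) {l₀ : ℝ} (hl₀ : 0 < l₀)
    (h : ∀ l ≥ l₀, ∃ K : TorusL2 a b →L[ℂ] TorusL2 a b, ‖K‖ ≤ 1 / 2 ∧
      ∀ f, (freeResolvent hab l f, f + K f + (-l : ℂ) • freeResolvent hab l f) ∈
        (fiberHamiltonian a b A V k).graph) {c : ℝ} (hc : c ≤ -l₀) {x : TorusL2 a b}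
    (hx : (x, (c : ℂ) • x) ∈ (fiberHamiltonian a b A V k).graph) : x = 0 := by
  obtain ⟨R, hR, -⟩ := exists_isResolventAt hab hAV k hl₀ h hc
  have := hR.apply_eq hx
  rwa [sub_self, map_zero, eq_comm] at this

theorem exists_isEigenbasis_fiberHamiltonian (hab : LinearIndependent ℝ ![a, b])
    (hAV : WeakAssumption a b A V) (k : Plane) {l₀ : ℝ} (hl₀ : 0 < l₀)
    (h : ∀ l ≥ l₀, ∃ K : TorusL2 a b →L[ℂ] TorusL2 a b, ‖K‖ ≤ 1 / 2 ∧
      ∀ f, (freeResolvent hab l f, f + K f + (-l : ℂ) • freeResolvent hab l f) ∈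
        (fiberHamiltonian a b A V k).graph) :
    ∃ (φ : HilbertBasis ℕ ℂ (TorusL2 a b)) (e : ℕ → ℝ),
      UnboundedOperator.IsEigenbasis (fiberHamiltonian a b A V k) φ e ∧ Monotone e ∧
      Filter.Tendsto e Filter.atTop Filter.atTop ∧ ∀ n, -l₀ < e n := by
  obtain ⟨R, hR, hRc⟩ := exists_isResolventAt hab hAV k hl₀ h le_rfl
  exact hR.exists_isEigenbasis (not_finiteDimensional_torusL2 hab)
    (isSymmetric_fiberHamiltonian hab k) hRc
    fun l hl x hx => eq_zero_of_mem_graph_smul hab hAV k hl₀ h hl hx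

/-- Any list of the eigenvalues of `H(k)` comes from an orthonormal basis of eigenvectors. -/
theorem exists_isEigenbasis_of_isEigenvalueList (hab : LinearIndependent ℝ ![a, b])
    (hAV : WeakAssumption a b A V) (k : Plane) {e : ℕ → ℝ}
    (he : UnboundedOperator.IsEigenvalueList (fiberHamiltonian a b A V k) e) :
    ∃ φ : HilbertBasis ℕ ℂ (TorusL2 a b),
      UnboundedOperator.IsEigenbasis (fiberHamiltonian a b A V k) φ e ∧
      Filter.Tendsto e Filter.atTop Filter.atTop := by
  obtain ⟨l₀, hl₀, h⟩ := exists_mem_graph_freeResolvent_of_le hab hAV k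
  obtain ⟨φ, e', hφ, hm, ht, -⟩ := exists_isEigenbasis_fiberHamiltonian hab hAV k hl₀ h
  obtain rfl := hφ.eq_of_isEigenvalueList (isSymmetric_fiberHamiltonian hab k) hm ht he
  exact ⟨φ, hφ, ht⟩

theorem isEigenvalueList_unique (hab : LinearIndependent ℝ ![a, b])
    (hAV : WeakAssumption a b A V) (k : Plane) {e e' : ℕ → ℝ}
    (he : UnboundedOperator.IsEigenvalueList (fiberHamiltonian a b A V k) e)
    (he' : UnboundedOperator.IsEigenvalueList (fiberHamiltonian a b A V k) e') : e = e' := by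
  obtain ⟨φ, hφ, ht⟩ := exists_isEigenbasis_of_isEigenvalueList hab hAV k he
  exact (hφ.eq_of_isEigenvalueList (isSymmetric_fiberHamiltonian hab k) he.1 ht he').symm

/-! ### Continuity in the quasimomentum -/

theorem mem_graph_kineticMomentum_add (hab : LinearIndependent ℝ ![a, b])
    (hAV : WeakAssumption a b A V) {k : Plane} (g : Plane) {j : Fin 2} {u p : TorusL2 a b}
    (h : (u, p) ∈ (kineticMomentum a b A k j).graph) :
    (u, p + (g j : ℂ) • u) ∈ (kineticMomentum a b A (k + g) j).graph := by
  obtain ⟨d, hd, rfl⟩ := (mem_graph_kineticMomentum hAV hab).1 h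
  refine (mem_graph_kineticMomentum hAV hab).2 ⟨d, hd, ?_⟩
  rw [add_assoc]
  congr 1
  apply MeasureTheory.Lp.ext
  filter_upwards [coeFn_mulContinuous (hAV.contDiff_shiftedPotential k j).continuous u,
    coeFn_mulContinuous (hAV.contDiff_shiftedPotential (k + g) j).continuous u,
    MeasureTheory.Lp.coeFn_add (mulShift hAV k j u) ((g j : ℂ) • u),
    MeasureTheory.Lp.coeFn_smul (g j : ℂ) u] with x h1 h2 h3 h4
  rw [h3, Pi.add_apply, h4, Pi.smul_apply]
  change mulContinuous a b _ u x = mulContinuous a b _ u x + _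
  rw [h1, h2, shiftedPotential, shiftedPotential, PiLp.add_apply, smul_eq_mul]
  push_cast
  ring

/-- The numbers `g j` commute with the momenta, so `½ (p + g)² = ½ p² + g·p + ½ |g|²`. -/
theorem mem_graph_fiberHamiltonian_add (hab : LinearIndependent ℝ ![a, b])
    (hAV : WeakAssumption a b A V) {k : Plane} (g : Plane) {u y : TorusL2 a b}
    (h : (u, y) ∈ (fiberHamiltonian a b A V k).graph) :
    ∃ p : Fin 2 → TorusL2 a b, (∀ j, (u, p j) ∈ (kineticMomentum a b A k j).graph) ∧
      (u, y + ((g 0 : ℂ) • p 0 + (g 1 : ℂ) • p 1 + ((g 0 ^ 2 + g 1 ^ 2) / 2 : ℂ) • u)) ∈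
        (fiberHamiltonian a b A V (k + g)).graph := by
  obtain ⟨p, q, v, hpq, hv, rfl⟩ := mem_graph_fiberHamiltonian.1 h
  refine ⟨p, fun j => (hpq j).1, mem_graph_fiberHamiltonian.2
    ⟨fun j => p j + (g j : ℂ) • u,
      fun j => q j + (g j : ℂ) • p j + (g j : ℂ) • (p j + (g j : ℂ) • u), v, fun j => ⟨?_, ?_⟩, hv, ?_⟩⟩
  · exact mem_graph_kineticMomentum_add hab hAV g (hpq j).1
  · have h1 := mem_graph_kineticMomentum_add hab hAV g (hpq j).2
    have h2 := (kineticMomentum a b A (k + g) j).graph.smul_mem (g j : ℂ)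
      (mem_graph_kineticMomentum_add hab hAV g (hpq j).1)
    exact (kineticMomentum a b A (k + g) j).graph.add_mem h1 h2
  · dsimp only
    generalize (g 0 : ℂ) = s, (g 1 : ℂ) = t, p 0 = p₀, p 1 = p₁, q 0 = q₀, q 1 = q₁
    module

/-- The operators `H(k + g)` are small perturbations of `H(k)`, for small `g`. -/
theorem exists_norm_sub_le (hab : LinearIndependent ℝ ![a, b])
    (hAV : WeakAssumption a b A V) (k : Plane) {l₀ : ℝ} (hl₀ : 0 < l₀)
    (h : ∀ l ≥ l₀, ∃ K : TorusL2 a b →L[ℂ] TorusL2 a b, ‖K‖ ≤ 1 / 2 ∧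
      ∀ f, (freeResolvent hab l f, f + K f + (-l : ℂ) • freeResolvent hab l f) ∈
        (fiberHamiltonian a b A V k).graph) :
    ∃ C ≥ 0, ∀ l ≥ l₀, ∀ g x y y', (x, y) ∈ (fiberHamiltonian a b A V k).graph →
      (x, y') ∈ (fiberHamiltonian a b A V (k + g)).graph →
      ‖y' - y‖ ≤ C * (|g 0| + |g 1| + (g 0 ^ 2 + g 1 ^ 2) / 2) * ‖y + (l : ℂ) • x‖ := by
  -- Bounds both `p j` and `x` by `(H(k) + l) x = f + K f`, uniformly in `l ≥ l₀`. The factor `2` is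
  -- from `‖f‖ ≤ 2 ‖f + K f‖`, the summand `1` covers `x` itself.
  set M : ℝ := 2 * ((√l₀)⁻¹ + (‖mulShift hAV k 0‖ + ‖mulShift hAV k 1‖ + 1) * l₀⁻¹) with hM
  have hM0 : 0 ≤ M := by positivity
  refine ⟨M, hM0, fun l hl g x y y' hy hy' => ?_⟩
  have hlpos : 0 < l := hl₀.trans_le hl
  obtain ⟨f, rfl⟩ := exists_freeResolvent_eq_of_mem_graph hab hAV hy hlpos
  obtain ⟨K, hK, hKg⟩ := h l hl
  obtain rfl := (fiberHamiltonian a b A V k).mem_graph_snd_inj hy (hKg f) rfl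
  obtain ⟨p, hp, hgr⟩ := mem_graph_fiberHamiltonian_add hab hAV g hy
  obtain rfl := (fiberHamiltonian a b A V (k + g)).mem_graph_snd_inj hy' hgr rfl
  rw [add_sub_cancel_left]
  have e0 : f + K f + (-l : ℂ) • freeResolvent hab l f + (l : ℂ) • freeResolvent hab l f =
      f + K f := by
    rw [add_assoc, ← add_smul, neg_add_cancel, zero_smul, add_zero]
  rw [e0]
  have hf : ‖f‖ ≤ 2 * ‖f + K f‖ := by
    have h1 : ‖K f‖ ≤ 1 / 2 * ‖f‖ := K.le_of_opNorm_le hK f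
    have h2 : ‖f‖ ≤ ‖f + K f‖ + ‖K f‖ := by
      simpa using norm_sub_le (f + K f) (K f)
    linarith
  have hR : ‖freeResolvent hab l f‖ ≤ l₀⁻¹ * ‖f‖ :=
    (freeResolvent hab l).le_of_opNorm_le ((norm_freeResolvent_le hab hlpos).trans (by gcongr)) f
  have hW (j : Fin 2) : ‖mulShift hAV k j‖ ≤ ‖mulShift hAV k 0‖ + ‖mulShift hAV k 1‖ := by
    fin_cases j
    · exact le_add_of_nonneg_right (norm_nonneg _)
    · exact le_add_of_nonneg_left (norm_nonneg _)
  have hfk : (0 : ℝ) ≤ ‖f + K f‖ := norm_nonneg _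
  have hpn (j : Fin 2) : ‖p j‖ ≤ M * ‖f + K f‖ := by
    obtain ⟨d, hd, hdp⟩ := (mem_graph_kineticMomentum hAV hab).1 (hp j)
    have hd' : d = derivFreeResolvent hab l j f := by
      refine (fourierBasis hab).ext_inner fun n => ?_
      rw [hd.inner_fourierBasis hab, (isWeakDeriv_freeResolvent hab hlpos j f).inner_fourierBasis hab]
    have hD : ‖d‖ ≤ (√l₀)⁻¹ * ‖f‖ := by
      rw [hd']
      refine (derivFreeResolvent hab l j).le_of_opNorm_le
        ((norm_derivFreeResolvent_le hab hlpos j).trans ?_) f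
      gcongr
    have hWR : ‖mulShift hAV k j (freeResolvent hab l f)‖ ≤
        (‖mulShift hAV k 0‖ + ‖mulShift hAV k 1‖) * (l₀⁻¹ * ‖f‖) :=
      ((mulShift hAV k j).le_opNorm _).trans (by gcongr; exact hW j)
    rw [← hdp]
    refine (norm_add_le _ _).trans ?_
    rw [norm_smul, norm_neg, Complex.norm_I, one_mul]
    have h0 : 0 ≤ l₀⁻¹ * ‖f‖ := by positivity
    calc ‖d‖ + ‖mulShift hAV k j (freeResolvent hab l f)‖
        ≤ ((√l₀)⁻¹ + (‖mulShift hAV k 0‖ + ‖mulShift hAV k 1‖ + 1) * l₀⁻¹) * ‖f‖ := by linarith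
      _ ≤ ((√l₀)⁻¹ + (‖mulShift hAV k 0‖ + ‖mulShift hAV k 1‖ + 1) * l₀⁻¹) * (2 * ‖f + K f‖) := by
          gcongr
      _ = M * ‖f + K f‖ := by rw [hM]; ring
  have hxn : ‖freeResolvent hab l f‖ ≤ M * ‖f + K f‖ := by
    have h1 : l₀⁻¹ ≤ (√l₀)⁻¹ + (‖mulShift hAV k 0‖ + ‖mulShift hAV k 1‖ + 1) * l₀⁻¹ := by
      have : 0 ≤ (√l₀)⁻¹ + (‖mulShift hAV k 0‖ + ‖mulShift hAV k 1‖) * l₀⁻¹ := by positivity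
      linarith
    calc ‖freeResolvent hab l f‖ ≤ l₀⁻¹ * ‖f‖ := hR
      _ ≤ ((√l₀)⁻¹ + (‖mulShift hAV k 0‖ + ‖mulShift hAV k 1‖ + 1) * l₀⁻¹) * (2 * ‖f + K f‖) := by
          gcongr
      _ = M * ‖f + K f‖ := by rw [hM]; ring
  have hq : ‖((g 0 ^ 2 + g 1 ^ 2) / 2 : ℂ)‖ = (g 0 ^ 2 + g 1 ^ 2) / 2 := by
    rw [show ((g 0 ^ 2 + g 1 ^ 2) / 2 : ℂ) = (((g 0 ^ 2 + g 1 ^ 2) / 2 : ℝ) : ℂ) by push_cast; rfl,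
      Complex.norm_real, Real.norm_of_nonneg (by positivity)]
  refine (norm_add₃_le).trans ?_
  rw [norm_smul, norm_smul, norm_smul, hq, Complex.norm_real, Complex.norm_real, Real.norm_eq_abs,
    Real.norm_eq_abs]
  calc _ ≤ |g 0| * (M * ‖f + K f‖) + |g 1| * (M * ‖f + K f‖) +
        (g 0 ^ 2 + g 1 ^ 2) / 2 * (M * ‖f + K f‖) := by
        gcongr
        · exact hpn 0
        · exact hpn 1
    _ = _ := by ring

theorem mem_graph_fiberHamiltonian_iff (hab : LinearIndependent ℝ ![a, b])
    (hAV : WeakAssumption a b A V) (k k' : Plane) {x : TorusL2 a b} :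
    (∃ y, (x, y) ∈ (fiberHamiltonian a b A V k).graph) ↔
      ∃ y, (x, y) ∈ (fiberHamiltonian a b A V k').graph := by
  rw [← LinearPMap.mem_domain_iff, ← LinearPMap.mem_domain_iff, ← SetLike.mem_coe,
    domain_fiberHamiltonian hab hAV, ← domain_fiberHamiltonian hab hAV k', SetLike.mem_coe]

/-- Two-sided comparison of the ordered eigenvalues of `H(k)` and `H(k + g)`. -/
theorem eigenvalue_comparison (hab : LinearIndependent ℝ ![a, b]) (hAV : WeakAssumption a b A V)
    {k g : Plane} {l₀ δ : ℝ} (hl₀ : 0 < l₀)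
    (h : ∀ l ≥ l₀, ∃ K : TorusL2 a b →L[ℂ] TorusL2 a b, ‖K‖ ≤ 1 / 2 ∧
      ∀ f, (freeResolvent hab l f, f + K f + (-l : ℂ) • freeResolvent hab l f) ∈
        (fiberHamiltonian a b A V k).graph)
    (hδ : 0 ≤ δ) (hδ' : δ ≤ 1 / 2)
    (hrel : ∀ l ≥ l₀, ∀ x y y', (x, y) ∈ (fiberHamiltonian a b A V k).graph →
      (x, y') ∈ (fiberHamiltonian a b A V (k + g)).graph → ‖y' - y‖ ≤ δ * ‖y + (l : ℂ) • x‖)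
    {e e' : ℕ → ℝ}
    (he : UnboundedOperator.IsEigenvalueList (fiberHamiltonian a b A V k) e)
    (he' : UnboundedOperator.IsEigenvalueList (fiberHamiltonian a b A V (k + g)) e') (n : ℕ) :
    e' n + l₀ ≤ (1 + δ) * (e n + l₀) ∧ e n + l₀ ≤ (1 + 2 * δ) * (e' n + l₀) := by
  obtain ⟨φ, hφ, -⟩ := exists_isEigenbasis_of_isEigenvalueList hab hAV k he
  obtain ⟨φ', hφ', -⟩ := exists_isEigenbasis_of_isEigenvalueList hab hAV (k + g) he'
  have hpos (n : ℕ) : 0 ≤ e n + l₀ := by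
    by_contra! hlt
    exact φ.orthonormal.ne_zero n
      (eq_zero_of_mem_graph_smul hab hAV k hl₀ h (c := e n) (by linarith) (hφ n))
  have hpos' (n : ℕ) : 0 ≤ e' n + l₀ := by
    by_contra! hlt
    obtain ⟨y, hy⟩ := (mem_graph_fiberHamiltonian_iff hab hAV (k + g) k).1 ⟨_, hφ' n⟩
    -- An eigenvalue `e' n < -l₀` allows `l = -e' n`. Both sides then contain the same norm, and `δ
    -- < 1` forces it to vanish, so `φ' n` is an eigenvector of `H(k)` below `-l₀`.
    have h1 := hrel (-e' n) (by linarith) _ _ _ hy (hφ' n)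
    rw [Complex.ofReal_neg, neg_smul, ← sub_eq_add_neg, norm_sub_rev] at h1
    have h2 : ‖y - (e' n : ℂ) • φ' n‖ = 0 := by
      have := norm_nonneg (y - (e' n : ℂ) • φ' n)
      nlinarith
    rw [norm_eq_zero, sub_eq_zero] at h2
    exact φ'.orthonormal.ne_zero n
      (eq_zero_of_mem_graph_smul hab hAV k hl₀ h (c := e' n) (by linarith) (h2 ▸ hy))
  have h1 := hφ.le_of_norm_sub_le hφ' (isSymmetric_fiberHamiltonian hab (k + g)) he.1 he'.1 hδ hpos
    (fun x y hy => by
      obtain ⟨y', hy'⟩ := (mem_graph_fiberHamiltonian_iff hab hAV k (k + g)).1 ⟨y, hy⟩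
      exact ⟨y', hy', hrel l₀ le_rfl x y y' hy hy'⟩) n
  have h2 := hφ'.le_of_norm_sub_le hφ (isSymmetric_fiberHamiltonian hab k) he'.1 he.1
    -- Exchanging the operators doubles `δ`: as `δ ≤ 1/2`, the triangle inequality gives `‖(H(k) +
    -- l₀) x‖ ≤ 2 ‖(H(k + g) + l₀) x‖`.
    (δ := 2 * δ) (by linarith) hpos'
    (fun x y' hy' => by
      obtain ⟨y, hy⟩ := (mem_graph_fiberHamiltonian_iff hab hAV (k + g) k).1 ⟨y', hy'⟩
      refine ⟨y, hy, ?_⟩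
      have h3 := hrel l₀ le_rfl x y y' hy hy'
      have h4 : ‖y + (l₀ : ℂ) • x‖ ≤ ‖y' + (l₀ : ℂ) • x‖ + ‖y' - y‖ := by
        have := norm_sub_le (y' + (l₀ : ℂ) • x) (y' - y)
        rwa [show y' + (l₀ : ℂ) • x - (y' - y) = y + (l₀ : ℂ) • x by abel] at this
      rw [norm_sub_rev]
      have h5 := norm_nonneg (y' - y)
      have h6 := norm_nonneg (y' + (l₀ : ℂ) • x)
      nlinarith) n
  constructor <;> linarith

/-- With `l₀` fixed at the base point `k`, the comparison squeezes `E n k' + l₀` between multiples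
of `E n k + l₀` whose factors tend to `1`. -/
theorem continuous_eigenvalue (hab : LinearIndependent ℝ ![a, b]) (hAV : WeakAssumption a b A V)
    {E : ℕ → Plane → ℝ} (hE : ∀ k, UnboundedOperator.IsEigenvalueList
      (fiberHamiltonian a b A V k) fun n => E n k) (n : ℕ) : Continuous (E n) := by
  rw [continuous_iff_continuousAt]
  intro k
  obtain ⟨l₀, hl₀, h⟩ := exists_mem_graph_freeResolvent_of_le hab hAV k
  obtain ⟨C, hC, hrel⟩ := exists_norm_sub_le hab hAV k hl₀ h
  let δ : Plane → ℝ := fun k' => C * (|(k' - k) 0| + |(k' - k) 1| +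
    ((k' - k) 0 ^ 2 + (k' - k) 1 ^ 2) / 2)
  have hδ0 (k' : Plane) : 0 ≤ δ k' := by
    simp only [δ]
    positivity
  have hδc : Continuous δ := by fun_prop
  have hδ : Filter.Tendsto δ (nhds k) (nhds 0) := by
    have := hδc.tendsto k
    simpa [δ] using this
  have hev : ∀ᶠ k' in nhds k, E n k' + l₀ ≤ (1 + δ k') * (E n k + l₀) ∧
      E n k + l₀ ≤ (1 + 2 * δ k') * (E n k' + l₀) := by
    filter_upwards [hδ.eventually_lt_const (show (0 : ℝ) < 1 / 2 by norm_num)] with k' hk'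
    have hk : k + (k' - k) = k' := add_sub_cancel k k'
    exact eigenvalue_comparison hab hAV (g := k' - k) hl₀ h (hδ0 k') hk'.le
      (fun l hl => hrel l hl (k' - k)) (hE k) (by rw [hk]; exact hE k') n
  have hup : Filter.Tendsto (fun k' => (1 + δ k') * (E n k + l₀) - l₀) (nhds k) (nhds (E n k)) := by
    simpa using ((hδ.const_add 1).mul_const (E n k + l₀)).sub_const l₀
  have hlo : Filter.Tendsto (fun k' => (E n k + l₀) / (1 + 2 * δ k') - l₀) (nhds k)
      (nhds (E n k)) := by
    have := ((tendsto_const_nhds (x := E n k + l₀)).div ((hδ.const_mul 2).const_add 1)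
      (by norm_num)).sub_const l₀
    simpa using this
  refine tendsto_of_tendsto_of_tendsto_of_le_of_le' hlo hup ?_ ?_
  · filter_upwards [hev] with k' hk'
    have h1 : 0 < 1 + 2 * δ k' := by have := hδ0 k'; linarith
    rw [sub_le_iff_le_add, div_le_iff₀ h1, mul_comm]
    exact hk'.2
  · filter_upwards [hev] with k' hk'
    rw [le_sub_iff_add_le]
    exact hk'.1

/-! ### Periodicity in the quasimomentum -/

/-- Multiplication by the plane wave `exp (i g · x)`. -/
noncomputable def mulPlaneWave (a b : Plane) (g : Plane) : TorusL2 a b →L[ℂ] TorusL2 a b :=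
  mulContinuous a b (contDiff_planeWave g).continuous

theorem coeFn_mulPlaneWave (g : Plane) (u : TorusL2 a b) :
    mulPlaneWave a b g u =ᵐ[torusMeasure a b] fun x => planeWave g x * u x :=
  coeFn_mulContinuous _ u

theorem injective_mulPlaneWave (g : Plane) : Function.Injective (mulPlaneWave a b g) := by
  rw [injective_iff_map_eq_zero]
  intro u hu
  apply MeasureTheory.Lp.ext
  have h0 := coeFn_mulPlaneWave g u
  rw [hu] at h0
  filter_upwards [h0, MeasureTheory.Lp.coeFn_zero ℂ 2 (torusMeasure a b)] with x hx hx'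
  rw [hx', Pi.zero_apply] at hx
  have : planeWave g x ≠ 0 := by
    rw [← norm_ne_zero_iff, norm_planeWave]
    exact one_ne_zero
  rw [hx', Pi.zero_apply]
  exact (mul_eq_zero.1 hx.symm).resolve_left this

/-- Differentiating `exp(-i g·x)` produces `-g j`, which the shift from `k` to `k + g` compensates.
Membership of `g` in the dual lattice makes the wave periodic, as the Leibniz rule on the torus
requires. -/
theorem mem_graph_kineticMomentum_mulPlaneWave (hab : LinearIndependent ℝ ![a, b])
    (hAV : WeakAssumption a b A V) {k g : Plane} (hg : g ∈ dualLattice a b) {j : Fin 2}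
    {u p : TorusL2 a b} (h : (u, p) ∈ (kineticMomentum a b A k j).graph) :
    (mulPlaneWave a b (-g) u, mulPlaneWave a b (-g) p) ∈ (kineticMomentum a b A (k + g) j).graph := by
  obtain ⟨d, hd, rfl⟩ := (mem_graph_kineticMomentum hAV hab).1 h
  have hφ : ContDiff ℝ 1 (planeWave (-g)) := (contDiff_planeWave (-g)).of_le (by simp)
  refine (mem_graph_kineticMomentum hAV hab).2 ⟨_, hd.mulContinuous hab hφ
    (isTorusSmooth_planeWave (neg_mem_dualLattice hg)).2, ?_⟩
  change (-Complex.I) • (mulPlaneWave a b (-g) d + mulContinuous a b (continuous_pderiv hφ j) u) +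
    mulContinuous a b _ (mulPlaneWave a b (-g) u) =
    mulPlaneWave a b (-g) ((-Complex.I) • d + mulContinuous a b _ u)
  rw [_root_.map_add, _root_.map_smul]
  apply MeasureTheory.Lp.ext
  set m := mulContinuous a b (hAV.contDiff_shiftedPotential k j).continuous u with hm
  set m' := mulContinuous a b (hAV.contDiff_shiftedPotential (k + g) j).continuous
    (mulPlaneWave a b (-g) u) with hm'
  set D := mulContinuous a b (continuous_pderiv hφ j) u with hD
  filter_upwards [MeasureTheory.Lp.coeFn_add ((-Complex.I) • (mulPlaneWave a b (-g) d + D)) m',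
    MeasureTheory.Lp.coeFn_smul (-Complex.I) (mulPlaneWave a b (-g) d + D),
    MeasureTheory.Lp.coeFn_add (mulPlaneWave a b (-g) d) D,
    MeasureTheory.Lp.coeFn_add ((-Complex.I) • mulPlaneWave a b (-g) d) (mulPlaneWave a b (-g) m),
    MeasureTheory.Lp.coeFn_smul (-Complex.I) (mulPlaneWave a b (-g) d),
    coeFn_mulPlaneWave (-g) d, coeFn_mulPlaneWave (-g) u, coeFn_mulPlaneWave (-g) m,
    coeFn_mulContinuous (continuous_pderiv hφ j) u,
    coeFn_mulContinuous (hAV.contDiff_shiftedPotential k j).continuous u,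
    coeFn_mulContinuous (hAV.contDiff_shiftedPotential (k + g) j).continuous
      (mulPlaneWave a b (-g) u)] with x h1 h2 h3 h4 h5 h6 h7 h8 h9 h10 h11
  rw [h1, Pi.add_apply, h2, Pi.smul_apply, h3, Pi.add_apply, h4, Pi.add_apply, h5, Pi.smul_apply,
    h8, hD, h9, hm', h11, h6, h7, hm, h10, pderiv_planeWave, shiftedPotential, shiftedPotential,
    PiLp.add_apply, PiLp.neg_apply, smul_eq_mul, smul_eq_mul]
  push_cast
  linear_combination (g j : ℂ) * planeWave (-g) x * u x * Complex.I_sq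

theorem mem_graph_fiberHamiltonian_mulPlaneWave (hab : LinearIndependent ℝ ![a, b])
    (hAV : WeakAssumption a b A V) {k g : Plane} (hg : g ∈ dualLattice a b)
    {u y : TorusL2 a b} (h : (u, y) ∈ (fiberHamiltonian a b A V k).graph) :
    (mulPlaneWave a b (-g) u, mulPlaneWave a b (-g) y) ∈
      (fiberHamiltonian a b A V (k + g)).graph := by
  obtain ⟨p, q, v, hpq, hv, rfl⟩ := mem_graph_fiberHamiltonian.1 h
  refine mem_graph_fiberHamiltonian.2 ⟨fun j => mulPlaneWave a b (-g) (p j),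
    fun j => mulPlaneWave a b (-g) (q j), mulPlaneWave a b (-g) v,
    fun j => ⟨mem_graph_kineticMomentum_mulPlaneWave hab hAV hg (hpq j).1,
      mem_graph_kineticMomentum_mulPlaneWave hab hAV hg (hpq j).2⟩, ?_, by simp⟩
  filter_upwards [hv, coeFn_mulPlaneWave (-g) v, coeFn_mulPlaneWave (-g) u] with x h1 h2 h3
  rw [h2, h1, h3]
  ring

theorem rank_eigenspace_le (hab : LinearIndependent ℝ ![a, b])
    (hAV : WeakAssumption a b A V) (k : Plane) {g : Plane} (hg : g ∈ dualLattice a b) (z : ℂ) :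
    Module.rank ℂ (UnboundedOperator.eigenspace (fiberHamiltonian a b A V k) z) ≤
      Module.rank ℂ (UnboundedOperator.eigenspace (fiberHamiltonian a b A V (k + g)) z) := by
  have hmap : ∀ x ∈ UnboundedOperator.eigenspace (fiberHamiltonian a b A V k) z,
      (mulPlaneWave a b (-g) : TorusL2 a b →ₗ[ℂ] TorusL2 a b) x ∈
        UnboundedOperator.eigenspace (fiberHamiltonian a b A V (k + g)) z := by
    intro x hx
    have := mem_graph_fiberHamiltonian_mulPlaneWave hab hAV hg (UnboundedOperator.mem_eigenspace.1 hx)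
    rwa [_root_.map_smul] at this
  refine LinearMap.rank_le_of_injective
    ((mulPlaneWave a b (-g) : TorusL2 a b →ₗ[ℂ] TorusL2 a b).restrict hmap) fun x y hxy => ?_
  exact Subtype.ext (injective_mulPlaneWave (-g) (congrArg Subtype.val hxy))

theorem eigenvalue_add_eq (hab : LinearIndependent ℝ ![a, b]) (hAV : WeakAssumption a b A V)
    {E : ℕ → Plane → ℝ} (hE : ∀ k, UnboundedOperator.IsEigenvalueList
      (fiberHamiltonian a b A V k) fun n => E n k) (n : ℕ) {g : Plane} (hg : g ∈ dualLattice a b)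
    (k : Plane) : E n (k + g) = E n k := by
  -- The reverse inequality is the same one for `-g` at the point `k + g`.
  have hrank (z : ℂ) := le_antisymm (rank_eigenspace_le hab hAV k hg z) (by
    have := rank_eigenspace_le hab hAV (k + g) (neg_mem_dualLattice hg) z
    rwa [add_neg_cancel_right] at this)
  have h : UnboundedOperator.IsEigenvalueList (fiberHamiltonian a b A V k) fun n => E n (k + g) :=
    ⟨(hE (k + g)).1, fun l => by rw [hrank]; exact (hE (k + g)).2 l⟩
  exact congrFun (isEigenvalueList_unique hab hAV k h (hE k)) n

end BlochFiber

/-! ### Assembly of the three claims -/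

theorem proposition3p1 (a b : BlochFiber.Plane) (hab : LinearIndependent ℝ ![a, b])
    (A : BlochFiber.Plane → BlochFiber.Plane) (V : BlochFiber.Plane → ℝ)
    (hAV : BlochFiber.WeakAssumption a b A V) :
    (∀ k : BlochFiber.Plane,
      ((BlochFiber.fiberHamiltonian a b A V k).domain : Set (BlochFiber.TorusL2 a b)) =
          BlochFiber.sobolevTwo a b ∧
        IsSelfAdjoint (BlochFiber.fiberHamiltonian a b A V k) ∧
        UnboundedOperator.IsBoundedBelow (BlochFiber.fiberHamiltonian a b A V k)) ∧
    (∀ k : BlochFiber.Plane,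
      UnboundedOperator.HasCompactResolvent (BlochFiber.fiberHamiltonian a b A V k) ∧
        UnboundedOperator.HasPurelyDiscreteSpectrum (BlochFiber.fiberHamiltonian a b A V k) ∧
        (∃ e : ℕ → ℝ,
          UnboundedOperator.IsEigenvalueList (BlochFiber.fiberHamiltonian a b A V k) e) ∧
        ∀ e : ℕ → ℝ,
          UnboundedOperator.IsEigenvalueList (BlochFiber.fiberHamiltonian a b A V k) e →
            Filter.Tendsto e Filter.atTop Filter.atTop) ∧
    (∀ E : ℕ → BlochFiber.Plane → ℝ,
      (∀ k : BlochFiber.Plane, UnboundedOperator.IsEigenvalueList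
        (BlochFiber.fiberHamiltonian a b A V k) fun n => E n k) →
      ∀ n : ℕ, Continuous (E n) ∧
        ∀ g ∈ BlochFiber.dualLattice a b, ∀ k : BlochFiber.Plane, E n (k + g) = E n k) := by
  refine ⟨fun k => ?_, fun k => ?_, fun E hE n =>
    ⟨BlochFiber.continuous_eigenvalue hab hAV hE n, fun g hg k =>
      BlochFiber.eigenvalue_add_eq hab hAV hE n hg k⟩⟩
  -- For both remaining claims, `-l₀` serves as a real resolvent point and as a strict lower bound
  -- of the eigenvalues.
  all_goals
    have hs := BlochFiber.isSymmetric_fiberHamiltonian (A := A) (V := V) hab k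
    obtain ⟨l₀, hl₀, h⟩ := BlochFiber.exists_mem_graph_freeResolvent_of_le hab hAV k
    obtain ⟨R, hR, hRc⟩ := BlochFiber.exists_isResolventAt hab hAV k hl₀ h le_rfl
    obtain ⟨φ, e, hφ, hm, ht, hlt⟩ :=
      BlochFiber.exists_isEigenbasis_fiberHamiltonian hab hAV k hl₀ h
  · exact ⟨BlochFiber.domain_fiberHamiltonian hab hAV k, hR.isSelfAdjoint hs,
      hφ.isBoundedBelow hs fun n => (hlt n).le⟩
  · exact ⟨hR.hasCompactResolvent hRc,
      hφ.hasPurelyDiscreteSpectrum hs ht fun z hz => hR.eigenspace_ne_bot hRc hz,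
      ⟨e, hφ.isEigenvalueList hs hm ht⟩,
      fun e' he' => (BlochFiber.exists_isEigenbasis_of_isEigenvalueList hab hAV k he').choose_spec.2⟩
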